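/- Let $M$ be a hyperkähler manifold: a smooth, Hausdorff, second countable manifold with a Riemannian metric $g$ and a reference frame of orthogonal complex structures $(I_1,I_2,I_3)$ with $I_1I_2=I_3=-I_2I_1$ that are parallel for the Levi-Civita connection. Let a compact connected Lie group $K$ with Lie algebra $\mathfrak k$ act smoothly on $M$, preserving $g,I_1,I_2,I_3$. Fix a $K$-invariant inner product on $\mathfrak k$ and use it to identify $\mathfrak k^*$ with $\mathfrak k$. Let $\mu=(\mu_1,\mu_2,\mu_3):M\to\mathfrak k\otimes\mathbb R^3$ be a moment map: a smooth $K$-equivariant map with $\langle d\mu_l(v),\xi\rangle=g(\xi_M,I_lv)$ for $\xi\in\mathfrak k$ and $l=1,2,3$, where $\xi_M$ is the vector field on $M$ generated by $\xi$. For $A\in SO(3)$, the rotated hyperkähler frame $(\mathbf i,\mathbf j,\mathbf k)$ has the $l$-th complex structure $\sum_mA_{lm}I_m$ and the moment map $\mu^A=(\mu^A_1,\mu^A_2,\mu^A_3)$ with $\mu_l^A=\sum_mA_{lm}\mu_m$; put $\mu^A_{\mathbb C}=\mu^A_2+\sqrt{-1}\,\mu^A_3$ and $W=(\mu^A_{\mathbb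 C})^{-1}(0)$. General frames. Let $T$ be a maximal torus of $K$. Consider all connected components $Z$ of the fixed point sets in $M$ of those nontrivial subtori of $T$ that are identity components of stabilizers in $T$ of points of $M$. For such $Z$ let $T_Z$ be the identity component of the stabilizer in $T$ of a general point of $Z$, and let $\rho_Z=\sup\{\|\langle\mu(x),\gamma\rangle\| : x\in Z,\ \gamma\in\mathrm{Lie}(T_Z),\ \|\gamma\|=1\}$. Choose $\gamma_Z\in\mathrm{Lie}(T_Z)$ for every $Z$, such that $\langle\mu(x),\gamma_Z\rangle\neq0$ in $\mathbb R^3$ for all $x\in Z$ whenever $\rho_Z>0$. (On each $Z$ the function $\langle\mu,\gamma\rangle$ is constant for every $\gamma\in\mathrm{Lie}(T_Z)$.) The frame given by $A$ is called general (with respect to these choices) if $\langle\mu^A_{\mathbb C}(x),\gamma_Z\rangle\ne0$ for all $x\in Z$, for every $Z$ with $\rho_Z>0$. Semistability. A point $x\in W$ is semistable if the trajectory $c:[0,\infty)\to M$ of the gradient flow of $-\|\mu^A_1\|^2$ from $x$ exists for all times and has a limit point, as $t\to\infty$, in $(\mu_1^A)^{-1}(0)$. Let $W^{ss}\subseteq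 W$ be the set of semistable points. Proposition. Let the frame $(\mathbf i,\mathbf j,\mathbf k)$ given by $A$ be general, and suppose that for every $x\in W$ the (forward) gradient flow of $-\|\mu^A_1\|^2$ from $x$ is contained in a compact set. Then $W=W^{ss}$. If furthermore $0$ is a regular value of $\mu^A$ (so that $(\mu^A)^{-1}(0)$ is smooth), then $W$ is smooth: $0$ is a regular value of $\mu^A_{\mathbb C}$, and $W$ is an embedded complex submanifold of $(M,\mathbf i)$. -/

import Mathlib

open Set Filter Topology Manifold Bundle
open scoped ContDiff Manifold ENNReal

noncomputable section

namespace HK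

/-! ### Lie groups and their actions

A Lie group `K` is modelled on a real vector space `𝔨`; the Lie algebra `T₁K` is by definition
`𝔨` itself. -/

section LieGroups

variable {𝔨 : Type*} [NormedAddCommGroup 𝔨] [NormedSpace ℝ 𝔨]
  {K : Type*} [TopologicalSpace K] [ChartedSpace 𝔨 K] [Group K]

/-- The adjoint action of `k` on the Lie algebra: the differential at `1` of conjugation by `k`. -/
def Ad (k : K) (ξ : 𝔨) : 𝔨 :=
  mfderiv 𝓘(ℝ, 𝔨) 𝓘(ℝ, 𝔨) (fun h : K => k * h * k⁻¹) 1 ξ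

/-- `B` is a `K`-invariant inner product on the Lie algebra. -/
structure IsInvariantInner (K : Type*) [TopologicalSpace K] [ChartedSpace 𝔨 K] [Group K]
    (B : 𝔨 →L[ℝ] 𝔨 →L[ℝ] ℝ) : Prop where
  symm : ∀ ξ η, B ξ η = B η ξ
  pos : ∀ ξ, ξ ≠ 0 → 0 < B ξ ξ
  invariant : ∀ (k : K) (ξ η : 𝔨), B (Ad k ξ) (Ad k η) = B ξ η

/-- The Lie algebra of a closed subgroup `S` of `K`: the initial velocities of the one-parameter
subgroups `c : ℝ → K` with values in `S`. -/
def lieAlg (S : Set K) : Set 𝔨 :=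
  {ξ | ∃ c : ℝ → K, (∀ s t, c (s + t) = c s * c t) ∧ (∀ t, c t ∈ S) ∧
    HasMFDerivAt 𝓘(ℝ, ℝ) 𝓘(ℝ, 𝔨) c 0 ((1 : ℝ →L[ℝ] ℝ).smulRight ξ)}

end LieGroups

/-- A closed connected commutative subgroup; in a compact Lie group these are exactly the tori. -/
def IsTorus {K : Type*} [TopologicalSpace K] [Group K] (T : Subgroup K) : Prop :=
  IsClosed (T : Set K) ∧ IsConnected (T : Set K) ∧ ∀ a ∈ T, ∀ b ∈ T, a * b = b * a

def IsMaximalTorus {K : Type*} [TopologicalSpace K] [Group K] (T : Subgroup K) : Prop :=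
  Maximal IsTorus T

/-- The stabilizer of `x` in the subgroup `T`. -/
def stabIn {K M : Type*} [Group K] [MulAction K M] (T : Subgroup K) (x : M) : Subgroup K :=
  T ⊓ MulAction.stabilizer K x

/-- The identity component of a subgroup. -/
def idComponent {K : Type*} [TopologicalSpace K] [Group K] (S : Subgroup K) : Set K :=
  connectedComponentIn (S : Set K) 1

/-- The points fixed by all elements of `S`. -/
def fixedSet {K : Type*} (M : Type*) [Group K] [MulAction K M] (S : Set K) : Set M :=
  {x | ∀ k ∈ S, k • x = x}

/-- The nontrivial subtori of `T` that are identity components of stabilizers in `T` of points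
of `M`. -/
def stabilizerTori {K : Type*} (M : Type*) [TopologicalSpace K] [Group K] [MulAction K M]
    (T : Subgroup K) : Set (Set K) :=
  {S | S ≠ {1} ∧ ∃ x : M, S = idComponent (stabIn T x)}

/-- The connected components `Z` of the fixed point sets of the tori in `stabilizerTori M T`. -/
def fixedComponents {K : Type*} (M : Type*) [TopologicalSpace K] [Group K] [TopologicalSpace M]
    [MulAction K M] (T : Subgroup K) : Set (Set M) :=
  {Z | ∃ S ∈ stabilizerTori M T, ∃ x ∈ fixedSet M S, Z = connectedComponentIn (fixedSet M S) x}

section Actions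

variable {𝔨 : Type*} [NormedAddCommGroup 𝔨] [NormedSpace ℝ 𝔨]
  {K : Type*} [TopologicalSpace K] [ChartedSpace 𝔨 K] [Group K]
  {E : Type*} [NormedAddCommGroup E] [NormedSpace ℝ E]
  {M : Type*} [TopologicalSpace M] [ChartedSpace E M] [MulAction K M]

/-- The Lie algebra of `T_Z`, the identity component of the stabilizer in `T` of a general point
of `Z`; "general" means: for all points of an open dense subset of `Z`. -/
def genericLieAlg (T : Subgroup K) (Z : Set M) : Set 𝔨 :=
  {ξ | ∃ U : Set M, IsOpen U ∧ Z ⊆ closure (Z ∩ U) ∧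
    ∀ x ∈ Z ∩ U, ξ ∈ lieAlg (𝔨 := 𝔨) (idComponent (stabIn T x))}

variable (K) in
/-- The value at `x` of the fundamental vector field of `ξ`: the differential at `1` of the orbit
map `k ↦ k • x`. -/
def fund (ξ : 𝔨) (x : M) : TangentSpace 𝓘(ℝ, E) x :=
  mfderiv 𝓘(ℝ, 𝔨) 𝓘(ℝ, E) (fun k : K => k • x) 1 ξ

/-- The pairing `⟨μ(x), ξ⟩ ∈ ℝ³`, where `𝔨` is identified with its dual by `B`. -/
def pairing (B : 𝔨 →L[ℝ] 𝔨 →L[ℝ] ℝ) (μ : Fin 3 → M → 𝔨) (x : M) (ξ : 𝔨) :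
    EuclideanSpace ℝ (Fin 3) :=
  WithLp.toLp 2 fun l => B (μ l x) ξ

/-- `ρ_Z = sup { ‖⟨μ(Z), ξ⟩‖ : ξ ∈ Lie(T_Z), ‖ξ‖ = 1 }`. -/
def rho (B : 𝔨 →L[ℝ] 𝔨 →L[ℝ] ℝ) (μ : Fin 3 → M → 𝔨) (T : Subgroup K) (Z : Set M) : ℝ≥0∞ :=
  ⨆ ξ ∈ {ξ : 𝔨 | ξ ∈ genericLieAlg T Z ∧ B ξ ξ = 1}, ⨆ x ∈ Z, ‖pairing B μ x ξ‖ₑ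

/-- A choice of `γ_Z ∈ Lie(T_Z)` for every component `Z`, with `⟨μ(Z), γ_Z⟩ ≠ 0` if `ρ_Z > 0`. -/
def IsGammaChoice (B : 𝔨 →L[ℝ] 𝔨 →L[ℝ] ℝ) (μ : Fin 3 → M → 𝔨) (T : Subgroup K)
    (γ : Set M → 𝔨) : Prop :=
  ∀ Z ∈ fixedComponents M T, γ Z ∈ genericLieAlg T Z ∧
    (0 < rho B μ T Z → ∀ x ∈ Z, pairing B μ x (γ Z) ≠ 0)

end Actions

/-! ### Hyperkähler manifolds, frames and moment maps -/

/-- The triple with entries `∑ m, A l m • V m`. Applied to the triple of complex structures and to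
the three components of a moment map it gives the rotated frame and its moment map. -/
def rotate {X : Type*} {V : X → Type*} [∀ x, AddCommGroup (V x)] [∀ x, Module ℝ (V x)]
    (A : Matrix (Fin 3) (Fin 3) ℝ) (v : Fin 3 → Π x, V x) : Fin 3 → Π x, V x :=
  fun l x => ∑ m, A l m • v m x

section Hyperkahler

variable {E : Type*} [NormedAddCommGroup E] [NormedSpace ℝ E] [FiniteDimensional ℝ E]
  {M : Type*} [TopologicalSpace M] [ChartedSpace E M] [IsManifold 𝓘(ℝ, E) ∞ M]
  [RiemannianBundle (fun x : M => TangentSpace 𝓘(ℝ, E) x)]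
  [IsContMDiffRiemannianBundle 𝓘(ℝ, E) ∞ E (fun x : M => TangentSpace 𝓘(ℝ, E) x)]

/-- `cov` is the Levi-Civita connection: it is compatible with the metric,
`v⟨Y, Z⟩ = ⟨∇_v Y, Z⟩ + ⟨Y, ∇_v Z⟩`, and torsion-free. -/
structure IsLeviCivita (cov : CovariantDerivative 𝓘(ℝ, E) E (TangentSpace 𝓘(ℝ, E) : M → Type _)) :
    Prop where
  metric : ∀ (x : M) (Y Z : Π x : M, TangentSpace 𝓘(ℝ, E) x),
    MDiffAt (T% Y) x → MDiffAt (T% Z) x → ∀ v : TangentSpace 𝓘(ℝ, E) x,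
      (mfderiv 𝓘(ℝ, E) 𝓘(ℝ, ℝ) (fun y => (inner ℝ (Y y) (Z y) : ℝ)) x v : ℝ) =
        inner ℝ (cov Y x v) (Z x) + inner ℝ (Y x) (cov Z x v)
  torsion_free : cov.torsion = 0

/-- `J 0, J 1, J 2` is a hyperkähler frame `𝐢, 𝐣, 𝐤` on the Riemannian manifold `M`: smooth
orthogonal almost complex structures with the quaternion relations, which are parallel for the
Levi-Civita connection (the torsion-free metric connection). -/
structure IsHyperkahler
    (J : Fin 3 → Π x : M, TangentSpace 𝓘(ℝ, E) x →L[ℝ] TangentSpace 𝓘(ℝ, E) x) : Prop where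
  smooth : ∀ l, ContMDiff 𝓘(ℝ, E) (𝓘(ℝ, E).prod 𝓘(ℝ, E →L[ℝ] E)) ∞
    (fun x => TotalSpace.mk' (E →L[ℝ] E)
      (E := fun x : M => TangentSpace 𝓘(ℝ, E) x →L[ℝ] TangentSpace 𝓘(ℝ, E) x) x (J l x))
  sq : ∀ l x v, J l x (J l x v) = -v
  ij : ∀ x v, J 0 x (J 1 x v) = J 2 x v
  ji : ∀ x v, J 1 x (J 0 x v) = -J 2 x v
  orthogonal : ∀ l x v w, inner ℝ (J l x v) (J l x w) = inner ℝ v w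
  parallel : ∃ cov : CovariantDerivative 𝓘(ℝ, E) E (TangentSpace 𝓘(ℝ, E) : M → Type _),
    IsLeviCivita cov ∧
    ∀ (l : Fin 3) (x : M) (Y : Π x : M, TangentSpace 𝓘(ℝ, E) x), MDiffAt (T% Y) x →
      ∀ v, cov (fun y => J l y (Y y)) x v = J l x (cov Y x v)

/-- The action of `K` on `M` preserves the metric and the three complex structures. -/
structure PreservesHyperkahler (K : Type*) [Group K] [MulAction K M]
    (J : Fin 3 → Π x : M, TangentSpace 𝓘(ℝ, E) x →L[ℝ] TangentSpace 𝓘(ℝ, E) x) : Prop where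
  metric : ∀ (k : K) (x : M) (v w : TangentSpace 𝓘(ℝ, E) x),
    inner ℝ (mfderiv 𝓘(ℝ, E) 𝓘(ℝ, E) (fun y : M => k • y) x v)
      (mfderiv 𝓘(ℝ, E) 𝓘(ℝ, E) (fun y : M => k • y) x w) = inner ℝ v w
  complex : ∀ (k : K) (l : Fin 3) (x : M) (v : TangentSpace 𝓘(ℝ, E) x),
    mfderiv 𝓘(ℝ, E) 𝓘(ℝ, E) (fun y : M => k • y) x (J l x v) =
      J l (k • x) (mfderiv 𝓘(ℝ, E) 𝓘(ℝ, E) (fun y : M => k • y) x v)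

/-- `μ = (μ 0, μ 1, μ 2)` is a hyperkähler moment map, `𝔨` being identified with its dual by the
invariant inner product `B`: it is smooth, equivariant, and `d⟨μ l, ξ⟩ = ω_l(ξ_M, ·)` with
`ω_l(u, v) = g(u, J l v)`. -/
structure IsMomentMap {𝔨 : Type*} [NormedAddCommGroup 𝔨] [NormedSpace ℝ 𝔨]
    (K : Type*) [TopologicalSpace K] [ChartedSpace 𝔨 K] [Group K] [MulAction K M]
    (B : 𝔨 →L[ℝ] 𝔨 →L[ℝ] ℝ)
    (J : Fin 3 → Π x : M, TangentSpace 𝓘(ℝ, E) x →L[ℝ] TangentSpace 𝓘(ℝ, E) x)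
    (μ : Fin 3 → M → 𝔨) : Prop where
  smooth : ∀ l, ContMDiff 𝓘(ℝ, E) 𝓘(ℝ, 𝔨) ∞ (μ l)
  equivariant : ∀ (l : Fin 3) (k : K) (x : M), μ l (k • x) = Ad k (μ l x)
  deriv : ∀ (l : Fin 3) (x : M) (v : TangentSpace 𝓘(ℝ, E) x) (ξ : 𝔨),
    B (mfderiv 𝓘(ℝ, E) 𝓘(ℝ, 𝔨) (μ l) x v) ξ = inner ℝ (fund K ξ x) (J l x v)

end Hyperkahler

section Flow

variable {E : Type*} [NormedAddCommGroup E] [NormedSpace ℝ E] [FiniteDimensional ℝ E]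
  {M : Type*} [TopologicalSpace M] [ChartedSpace E M]
  [RiemannianBundle (fun x : M => TangentSpace 𝓘(ℝ, E) x)]

/-- The Riemannian gradient of `f`. -/
def grad (f : M → ℝ) (x : M) : TangentSpace 𝓘(ℝ, E) x :=
  haveI : FiniteDimensional ℝ (TangentSpace 𝓘(ℝ, E) x) := inferInstanceAs (FiniteDimensional ℝ E)
  haveI : CompleteSpace (TangentSpace 𝓘(ℝ, E) x) := FiniteDimensional.complete ℝ _
  (InnerProductSpace.toDual ℝ (TangentSpace 𝓘(ℝ, E) x)).symm (mfderiv 𝓘(ℝ, E) 𝓘(ℝ, ℝ) f x)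

theorem inner_grad (f : M → ℝ) (x : M) (v : TangentSpace 𝓘(ℝ, E) x) :
    inner ℝ (grad f x) v = (mfderiv 𝓘(ℝ, E) 𝓘(ℝ, ℝ) f x v : ℝ) := by
  have : FiniteDimensional ℝ (TangentSpace 𝓘(ℝ, E) x) := inferInstanceAs (FiniteDimensional ℝ E)
  have : CompleteSpace (TangentSpace 𝓘(ℝ, E) x) := FiniteDimensional.complete ℝ _
  exact InnerProductSpace.toDual_symm_apply

/-- `c` is on the time interval `s` a trajectory of the gradient flow of `-f`. -/
def IsDescentCurve (f : M → ℝ) (c : ℝ → M) (s : Set ℝ) : Prop :=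
  IsMIntegralCurveOn (I := 𝓘(ℝ, E)) c (fun x => -grad f x) s

/-- The (forward) gradient flow of `-f` from `x` is contained in `C`. -/
def FlowContained (f : M → ℝ) (x : M) (C : Set M) : Prop :=
  ∀ (c : ℝ → M) (t : ℝ), 0 ≤ t → c 0 = x → IsDescentCurve (E := E) f c (Icc 0 t) →
    ∀ s ∈ Icc 0 t, c s ∈ C

/-- The gradient flow of `-f` from `x` has, as time tends to infinity, a limit point in `S`. -/
def FlowHasLimitPointIn (f : M → ℝ) (x : M) (S : Set M) : Prop :=
  ∃ c : ℝ → M, c 0 = x ∧ IsDescentCurve (E := E) f c (Ici 0) ∧ ∃ y ∈ S, MapClusterPt y atTop c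

end Flow

section Level

variable {𝔨 : Type*} [NormedAddCommGroup 𝔨] [NormedSpace ℝ 𝔨]
  {E : Type*} [NormedAddCommGroup E] [NormedSpace ℝ E]
  {M : Type*} [TopologicalSpace M] [ChartedSpace E M]

/-- `W = μ_ℂ⁻¹(0)`, where `μ_ℂ = μ 1 + √-1 μ 2`. -/
def W (μ : Fin 3 → M → 𝔨) : Set M := {x | μ 1 x = 0 ∧ μ 2 x = 0}

/-- `‖μ 0‖²`. -/
def normSq (B : 𝔨 →L[ℝ] 𝔨 →L[ℝ] ℝ) (μ : Fin 3 → M → 𝔨) (x : M) : ℝ := B (μ 0 x) (μ 0 x)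

/-- The frame with moment map `μ` is general with respect to the choice `γ`, which has been made
for the moment map `μ₀` of a reference frame: `⟨μ_ℂ(Z), γ_Z⟩ ≠ 0` whenever `ρ_Z > 0`. -/
def IsGeneral {K : Type*} [TopologicalSpace K] [ChartedSpace 𝔨 K] [Group K] [MulAction K M]
    (B : 𝔨 →L[ℝ] 𝔨 →L[ℝ] ℝ) (μ₀ μ : Fin 3 → M → 𝔨) (T : Subgroup K) (γ : Set M → 𝔨) : Prop :=
  ∀ Z ∈ fixedComponents M T, 0 < rho B μ₀ T Z →
    ∀ x ∈ Z, (B (μ 1 x) (γ Z), B (μ 2 x) (γ Z)) ≠ (0 : ℝ × ℝ)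

variable (E) in
/-- `0` is a regular value of `μ : M → 𝔨 ⊗ ℝ³`. -/
def IsRegularZero (μ : Fin 3 → M → 𝔨) : Prop :=
  ∀ x, (∀ l, μ l x = 0) → Function.Surjective
    (fun (v : TangentSpace 𝓘(ℝ, E) x) (l : Fin 3) =>
      (mfderiv 𝓘(ℝ, E) 𝓘(ℝ, 𝔨) (μ l) x v : 𝔨))

variable (E) in
/-- `0` is a regular value of `μ_ℂ : M → 𝔨 ⊗ ℂ`. -/
def IsRegularZeroC (μ : Fin 3 → M → 𝔨) : Prop :=
  ∀ x ∈ W μ, Function.Surjective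
    (fun v : TangentSpace 𝓘(ℝ, E) x =>
      ((mfderiv 𝓘(ℝ, E) 𝓘(ℝ, 𝔨) (μ 1) x v : 𝔨), (mfderiv 𝓘(ℝ, E) 𝓘(ℝ, 𝔨) (μ 2) x v : 𝔨)))

/-- `S` is an embedded complex submanifold of `M` for the complex structure `I`: near each of its
points it corresponds to a linear subspace in a smooth chart of `M`, and its tangent spaces are
invariant under `I`. -/
def IsComplexSubmanifold [IsManifold 𝓘(ℝ, E) ∞ M]
    (I : Π x : M, TangentSpace 𝓘(ℝ, E) x →L[ℝ] TangentSpace 𝓘(ℝ, E) x) (S : Set M) : Prop :=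
  ∀ x ∈ S, ∃ φ ∈ IsManifold.maximalAtlas 𝓘(ℝ, E) ∞ M, x ∈ φ.source ∧ ∃ F : Submodule ℝ E,
    (∀ y ∈ φ.source, y ∈ S ↔ φ y ∈ F) ∧
    ∀ y ∈ φ.source ∩ S, ∀ v : TangentSpace 𝓘(ℝ, E) y,
      (mfderiv 𝓘(ℝ, E) 𝓘(ℝ, E) φ y v : E) ∈ F → (mfderiv 𝓘(ℝ, E) 𝓘(ℝ, E) φ y (I y v) : E) ∈ F

end Level

section Semistable

variable {𝔨 : Type*} [NormedAddCommGroup 𝔨] [NormedSpace ℝ 𝔨]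
  {E : Type*} [NormedAddCommGroup E] [NormedSpace ℝ E] [FiniteDimensional ℝ E]
  {M : Type*} [TopologicalSpace M] [ChartedSpace E M]
  [RiemannianBundle (fun x : M => TangentSpace 𝓘(ℝ, E) x)]

variable (E) in
/-- The semistable points `Wˢˢ`: the points of `W` whose gradient flow for `-‖μ 0‖²` has a limit
point in `(μ 0)⁻¹(0)`. -/
def Wss (B : 𝔨 →L[ℝ] 𝔨 →L[ℝ] ℝ) (μ : Fin 3 → M → 𝔨) : Set M :=
  {x | x ∈ W μ ∧ FlowHasLimitPointIn (E := E) (normSq B μ) x {y | μ 0 y = 0}}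

end Semistable

end HK

end

/-! Write i = `J 0` for the first structure of the rotated frame and f = ‖μ 0‖². Two facts drive the
proof. The gradient is explicit: -grad f = 2 i ξ_M with ξ = μ 0 x, so x is critical for f exactly
when the one-parameter group generated by μ 0 x fixes x. And μ_ℂ is holomorphic for i, so
equivariance turns its derivative along -grad f into (-2[μ 0, μ 2], 2[μ 0, μ 1]), which is linear in
μ_ℂ (`IsMomentMap.mfderiv_muC_neg_grad`). Hence μ_ℂ solves a linear differential equation along a
trajectory, and W is invariant under the flow.

Semistability. A trajectory confined to a compact set exists for all positive time. As f decreases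
and is bounded below, |grad f| is small at arbitrarily late times, so there is a critical limit
point y in W (`IsMomentMap.exists_descentCurve`). If μ 0 y were nonzero, a conjugate ξ = Ad k (μ 0
y) would lie in the Lie algebra of T and fix k • y. This point lies in a component Z with ξ in
Lie(T_Z), and ⟨μ 0 (k • y), ξ⟩ = ‖ξ‖² > 0 forces ρ_Z > 0. Generality then says that ⟨μ_ℂ(k • y),
γ_Z⟩ is nonzero, although μ_ℂ vanishes on W. So μ 0 y = 0 (`eq_zero_of_isGeneral`).

Conjugation into the torus (`exists_Ad_mem_adFixed`) maximizes ⟨Ad k η, τ⟩ over k, where the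
centralizer of τ is the Lie algebra of T. The existence of such τ uses that a closed connected
subgroup is determined by its one-parameter subgroups (`le_of_oneParam_mem`).

Regularity. If 0 is a regular value of μ, then dμ_ℂ is onto at y, hence at some c t near y.
Linearizing the equation for μ_ℂ along the trajectory shows that the rank defect of dμ_ℂ propagates
(`surjective_mfderiv_of_isMIntegralCurveOn`), so dμ_ℂ is onto at c 0 = x as well. W is then a
submanifold, complex because dμ_ℂ is complex linear. -/

set_option linter.unusedSectionVars false

noncomputable section

namespace HK

/-! ### One-parameter subgroups of a Lie group -/

section OneParam

variable {𝔨 : Type*} [NormedAddCommGroup 𝔨] [NormedSpace ℝ 𝔨]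
  {K : Type*} [TopologicalSpace K] [ChartedSpace 𝔨 K] [Group K]

/-- `c` is the one-parameter subgroup of `K` with initial velocity `ξ`. -/
structure IsOneParam (c : ℝ → K) (ξ : 𝔨) : Prop where
  add : ∀ s t, c (s + t) = c s * c t
  deriv : HasMFDerivAt 𝓘(ℝ, ℝ) 𝓘(ℝ, 𝔨) c 0 ((1 : ℝ →L[ℝ] ℝ).smulRight ξ)

theorem IsOneParam.zero {c : ℝ → K} {ξ : 𝔨} (h : IsOneParam c ξ) : c 0 = 1 := by
  have := h.add 0 0
  simpa using this

theorem IsOneParam.neg {c : ℝ → K} {ξ : 𝔨} (h : IsOneParam c ξ) (t : ℝ) : c (-t) = (c t)⁻¹ := by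
  rw [eq_inv_iff_mul_eq_one, ← h.add, neg_add_cancel, h.zero]

theorem IsOneParam.nat_mul {c : ℝ → K} {ξ : 𝔨} (h : IsOneParam c ξ) (t : ℝ) (n : ℕ) :
    c (n * t) = c t ^ n := by
  induction n with
  | zero => simp [h.zero]
  | succ n ih => rw [pow_succ, ← ih, ← h.add]; push_cast; ring_nf

theorem IsOneParam.comm {c : ℝ → K} {ξ : 𝔨} (h : IsOneParam c ξ) (s t : ℝ) :
    c s * c t = c t * c s := by
  rw [← h.add, ← h.add, add_comm]

theorem IsOneParam.comp_mul {c : ℝ → K} {ξ : 𝔨} (h : IsOneParam c ξ) (a : ℝ) :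
    IsOneParam (fun t => c (t * a)) (a • ξ) where
  add s t := by rw [add_mul, h.add]
  deriv := by
    have h1 : HasMFDerivAt 𝓘(ℝ, ℝ) 𝓘(ℝ, ℝ) (fun t : ℝ => t * a) 0
        ((1 : ℝ →L[ℝ] ℝ).smulRight a) :=
      ((hasDerivAt_id (0 : ℝ)).mul_const a |>.hasFDerivAt.hasMFDerivAt).congr_mfderiv (by
        ext; simp; exact (one_smul ℝ a).symm)
    have h2 : HasMFDerivAt 𝓘(ℝ, ℝ) 𝓘(ℝ, 𝔨) c (0 * a) ((1 : ℝ →L[ℝ] ℝ).smulRight ξ) := by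
      rw [zero_mul]; exact h.deriv
    refine (HasMFDerivAt.comp (0 : ℝ) h2 h1).congr_mfderiv ?_
    ext
    change (1 * a) • ξ = (1 : ℝ) • (a • ξ)
    simp

theorem mulInvariantVectorField_one (ξ : 𝔨) :
    (mulInvariantVectorField (I := 𝓘(ℝ, 𝔨)) (G := K) ξ 1 : 𝔨) = ξ := by
  have e : (fun b : K => 1 * b) = id := by ext b; simp
  have : mfderiv 𝓘(ℝ, 𝔨) 𝓘(ℝ, 𝔨) (fun b : K => 1 * b) 1 =
      ContinuousLinearMap.id ℝ (TangentSpace 𝓘(ℝ, 𝔨) (1 : K)) := by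
    rw [e]; exact mfderiv_id
  change mfderiv 𝓘(ℝ, 𝔨) 𝓘(ℝ, 𝔨) (fun b : K => 1 * b) 1 ξ = ξ
  rw [this]; rfl

variable [LieGroup 𝓘(ℝ, 𝔨) ∞ K]

theorem contMDiff_conj : ContMDiff (𝓘(ℝ, 𝔨).prod 𝓘(ℝ, 𝔨)) 𝓘(ℝ, 𝔨) ∞
    (fun p : K × K => p.1 * p.2 * p.1⁻¹) :=
  (contMDiff_fst.mul contMDiff_snd).mul contMDiff_fst.inv

/-- The homomorphism property c s = c t * c (s - t) moves the derivative at 0 to any time t. This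
makes c an integral curve of a left-invariant field, so the uniqueness theory of integral curves
applies. -/
theorem IsOneParam.hasMFDerivAt {c : ℝ → K} {ξ : 𝔨} (h : IsOneParam c ξ) (t : ℝ) :
    HasMFDerivAt 𝓘(ℝ, ℝ) 𝓘(ℝ, 𝔨) c t ((1 : ℝ →L[ℝ] ℝ).smulRight
      (mulInvariantVectorField (I := 𝓘(ℝ, 𝔨)) (G := K) ξ (c t))) := by
  have e : c = (fun b => c t * b) ∘ c ∘ (fun s => s + -t) := by
    ext s; simp [← h.add]
  have h0 : HasMFDerivAt 𝓘(ℝ, ℝ) 𝓘(ℝ, ℝ) (fun s : ℝ => s + -t) t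
      (ContinuousLinearMap.id ℝ ℝ) :=
    ((hasDerivAt_id t).add_const (-t)).hasFDerivAt.hasMFDerivAt.congr_mfderiv (by
      ext; simp)
  have h1 : HasMFDerivAt 𝓘(ℝ, ℝ) 𝓘(ℝ, 𝔨) c (t + -t) ((1 : ℝ →L[ℝ] ℝ).smulRight ξ) := by
    rw [add_neg_cancel]; exact h.deriv
  have h2 : HasMFDerivAt 𝓘(ℝ, 𝔨) 𝓘(ℝ, 𝔨) (fun b => c t * b) (c (t + -t))
      (mfderiv 𝓘(ℝ, 𝔨) 𝓘(ℝ, 𝔨) (fun b => c t * b) (1 : K)) := by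
    rw [add_neg_cancel, h.zero]
    exact ((contMDiff_mul_left (I := 𝓘(ℝ, 𝔨)) (n := ∞) (a := c t)).mdifferentiableAt
      (by simp)).hasMFDerivAt
  have := HasMFDerivAt.comp t h2 (HasMFDerivAt.comp t h1 h0)
  rw [← e] at this
  refine this.congr_mfderiv ?_
  ext
  change mfderiv 𝓘(ℝ, 𝔨) 𝓘(ℝ, 𝔨) (fun b => c t * b) (1 : K) ((1 : ℝ) • ξ) =
    (1 : ℝ) • mfderiv 𝓘(ℝ, 𝔨) 𝓘(ℝ, 𝔨) (fun b => c t * b) (1 : K) ξ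
  rw [one_smul, one_smul]

theorem contMDiff_one_mulInvariant (ξ : 𝔨) : ContMDiff 𝓘(ℝ, 𝔨) 𝓘(ℝ, 𝔨).tangent 1
    (fun g : K => (⟨g, mulInvariantVectorField (I := 𝓘(ℝ, 𝔨)) (G := K) ξ g⟩ :
      TangentBundle 𝓘(ℝ, 𝔨) K)) := by
  have : LieGroup 𝓘(ℝ, 𝔨) (minSmoothness ℝ 3) K := LieGroup.of_le (n := ∞) (by simpa using ENat.LEInfty.out)
  refine (contMDiff_mulInvariantVectorField (I := 𝓘(ℝ, 𝔨)) (G := K) ξ).of_le ?_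
  simp

theorem IsOneParam.isMIntegralCurve {c : ℝ → K} {ξ : 𝔨} (h : IsOneParam c ξ) :
    IsMIntegralCurve c (mulInvariantVectorField (I := 𝓘(ℝ, 𝔨)) (G := K) ξ) :=
  fun t => h.hasMFDerivAt t

theorem IsOneParam.continuous {c : ℝ → K} {ξ : 𝔨} (h : IsOneParam c ξ) : Continuous c :=
  h.isMIntegralCurve.continuous

theorem IsOneParam.unique [T2Space K] {c c' : ℝ → K} {ξ : 𝔨}
    (h : IsOneParam c ξ) (h' : IsOneParam c' ξ) : c = c' := by
  have : IsManifold 𝓘(ℝ, 𝔨) 1 K := .of_le (n := ∞) (by simp)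
  exact isMIntegralCurve_Ioo_eq_of_contMDiff_boundaryless (t₀ := 0)
    (contMDiff_one_mulInvariant ξ) h.isMIntegralCurve h'.isMIntegralCurve (by rw [h.zero, h'.zero])

theorem mfderiv_mul_left_mulInvariant (g h : K) (ξ : 𝔨) :
    mfderiv 𝓘(ℝ, 𝔨) 𝓘(ℝ, 𝔨) (fun b => g * b) h
      (mulInvariantVectorField (I := 𝓘(ℝ, 𝔨)) (G := K) ξ h) =
    mulInvariantVectorField (I := 𝓘(ℝ, 𝔨)) (G := K) ξ (g * h) := by
  have e : (fun b => g * h * b) = (fun b => g * b) ∘ (fun b => h * b) := by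
    ext b; simp [mul_assoc]
  have m (a b : K) : MDifferentiableAt 𝓘(ℝ, 𝔨) 𝓘(ℝ, 𝔨) (fun b => a * b) b :=
    (contMDiff_mul_left (I := 𝓘(ℝ, 𝔨)) (n := ∞) (a := a)).mdifferentiableAt (by simp)
  have e1 := mfderiv_comp (I := 𝓘(ℝ, 𝔨)) (I' := 𝓘(ℝ, 𝔨)) (I'' := 𝓘(ℝ, 𝔨)) (1 : K)
    (m g (h * 1)) (m h 1)
  have key : ∀ h' : K, h' = h → ∀ v : 𝔨, (mfderiv 𝓘(ℝ, 𝔨) 𝓘(ℝ, 𝔨) (fun b => g * b) h v : 𝔨) =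
      mfderiv 𝓘(ℝ, 𝔨) 𝓘(ℝ, 𝔨) (fun b => g * b) h' v := by rintro _ rfl v; rfl
  simp only [mulInvariantVectorField]
  rw [e, e1]
  exact key _ (mul_one h) _

theorem IsMIntegralCurveOn.mul_left {c : ℝ → K} {ξ : 𝔨} {s : Set ℝ}
    (h : IsMIntegralCurveOn c (mulInvariantVectorField (I := 𝓘(ℝ, 𝔨)) (G := K) ξ) s) (g : K) :
    IsMIntegralCurveOn (fun t => g * c t) (mulInvariantVectorField (I := 𝓘(ℝ, 𝔨)) (G := K) ξ) s := by
  intro t ht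
  have m : HasMFDerivAt 𝓘(ℝ, 𝔨) 𝓘(ℝ, 𝔨) (fun b => g * b) (c t) _ :=
    ((contMDiff_mul_left (I := 𝓘(ℝ, 𝔨)) (n := ∞) (a := g)).mdifferentiableAt
      (by simp)).hasMFDerivAt
  refine (HasMFDerivAt.comp_hasMFDerivWithinAt t m (h t ht)).congr_mfderiv ?_
  ext
  have := mfderiv_mul_left_mulInvariant g (c t) ξ
  change mfderiv 𝓘(ℝ, 𝔨) 𝓘(ℝ, 𝔨) (fun b => g * b) (c t)
    ((1 : ℝ) • mulInvariantVectorField (I := 𝓘(ℝ, 𝔨)) (G := K) ξ (c t)) =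
    (1 : ℝ) • mulInvariantVectorField (I := 𝓘(ℝ, 𝔨)) (G := K) ξ (g * c t)
  rw [one_smul, one_smul, this]

-- A local integral curve through 1 can be left-translated to any point, with the same life span;
-- such a uniform life span makes the field complete. The homomorphism law is uniqueness for the two
-- curves t ↦ c (s + t) and t ↦ c s * c t.
variable (K) in
theorem exists_isOneParam [CompleteSpace 𝔨] [T2Space K] (ξ : 𝔨) :
    ∃ c : ℝ → K, IsOneParam c ξ := by
  have : IsManifold 𝓘(ℝ, 𝔨) 1 K := .of_le (n := ∞) (by simp)
  have hv := contMDiff_one_mulInvariant (K := K) ξ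
  obtain ⟨γ, hγ0, hγ⟩ := exists_isMIntegralCurveAt_of_contMDiffAt_boundaryless 0
    (hv.contMDiffAt (x := 1))
  obtain ⟨ε, hε, hγ⟩ := isMIntegralCurveAt_iff'.1 hγ
  obtain ⟨c, hc0, hc⟩ := exists_isMIntegralCurve_of_isMIntegralCurveOn hv hε (fun x => by
    refine ⟨fun t => x * γ t, by simp [hγ0], ?_⟩
    have := IsMIntegralCurveOn.mul_left hγ x
    rwa [Real.ball_eq_Ioo, zero_sub, zero_add] at this) 1
  refine ⟨c, fun s t => ?_, ?_⟩
  · have h1 := hc.comp_add s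
    have h2 : IsMIntegralCurve (fun t => c s * c t)
        (mulInvariantVectorField (I := 𝓘(ℝ, 𝔨)) (G := K) ξ) := by
      rw [isMIntegralCurve_iff_isMIntegralCurveOn] at hc ⊢
      exact IsMIntegralCurveOn.mul_left hc (c s)
    have := isMIntegralCurve_Ioo_eq_of_contMDiff_boundaryless (t₀ := 0) hv h1 h2 (by simp [hc0])
    have := congrFun this t
    simpa [add_comm] using this
  · refine (hc 0).congr_mfderiv ?_
    ext
    change (1 : ℝ) • mulInvariantVectorField (I := 𝓘(ℝ, 𝔨)) (G := K) ξ (c 0) = (1 : ℝ) • ξ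
    rw [hc0, mulInvariantVectorField_one]
    rfl

theorem IsOneParam.conj {c : ℝ → K} {ξ : 𝔨} (h : IsOneParam c ξ) (k : K) :
    IsOneParam (fun t => k * c t * k⁻¹) (Ad k ξ) where
  add s t := by rw [h.add]; group
  deriv := by
    have m : HasMFDerivAt 𝓘(ℝ, 𝔨) 𝓘(ℝ, 𝔨) (fun h : K => k * h * k⁻¹) (c 0)
        (mfderiv 𝓘(ℝ, 𝔨) 𝓘(ℝ, 𝔨) (fun h : K => k * h * k⁻¹) 1) := by
      rw [h.zero]
      exact ((contMDiff_conj.comp (contMDiff_const.prodMk contMDiff_id)).mdifferentiableAt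
        (by simp)).hasMFDerivAt
    refine (HasMFDerivAt.comp (0 : ℝ) m h.deriv).congr_mfderiv ?_
    ext
    change mfderiv 𝓘(ℝ, 𝔨) 𝓘(ℝ, 𝔨) (fun h : K => k * h * k⁻¹) 1 ((1 : ℝ) • ξ) = (1 : ℝ) • Ad k ξ
    rw [one_smul, one_smul]; rfl

end OneParam

/-! ### The chain rule along curves -/

section Curves

variable {E : Type*} [NormedAddCommGroup E] [NormedSpace ℝ E]
  {M : Type*} [TopologicalSpace M] [ChartedSpace E M]
  {F : Type*} [NormedAddCommGroup F] [NormedSpace ℝ F]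

theorem hasDerivWithinAt_comp_curve {f : M → F} {c : ℝ → M} {t : ℝ} {s : Set ℝ}
    {v : TangentSpace 𝓘(ℝ, E) (c t)} (hf : MDifferentiableAt 𝓘(ℝ, E) 𝓘(ℝ, F) f (c t))
    (hc : HasMFDerivWithinAt 𝓘(ℝ, ℝ) 𝓘(ℝ, E) c s t ((1 : ℝ →L[ℝ] ℝ).smulRight v)) :
    HasDerivWithinAt (fun r => f (c r)) (mfderiv 𝓘(ℝ, E) 𝓘(ℝ, F) f (c t) v : F) s t := by
  have h : HasFDerivWithinAt (f ∘ c) ((mfderiv 𝓘(ℝ, E) 𝓘(ℝ, F) f (c t) : E →L[ℝ] F).comp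
      ((1 : ℝ →L[ℝ] ℝ).smulRight (v : E))) s t :=
    (HasMFDerivAt.comp_hasMFDerivWithinAt t hf.hasMFDerivAt hc).hasFDerivWithinAt
  have key (L : E →L[ℝ] F) (v : E)
      (h : HasFDerivWithinAt (f ∘ c) (L.comp ((1 : ℝ →L[ℝ] ℝ).smulRight v)) s t) :
      HasDerivWithinAt (f ∘ c) (L v) s t := by
    rw [hasDerivWithinAt_iff_hasFDerivWithinAt]
    refine h.congr_fderiv ?_
    ext; simp
  exact key _ _ h

theorem hasDerivAt_comp_curve {f : M → F} {c : ℝ → M} {t : ℝ}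
    {v : TangentSpace 𝓘(ℝ, E) (c t)} (hf : MDifferentiableAt 𝓘(ℝ, E) 𝓘(ℝ, F) f (c t))
    (hc : HasMFDerivAt 𝓘(ℝ, ℝ) 𝓘(ℝ, E) c t ((1 : ℝ →L[ℝ] ℝ).smulRight v)) :
    HasDerivAt (fun r => f (c r)) (mfderiv 𝓘(ℝ, E) 𝓘(ℝ, F) f (c t) v : F) t := by
  exact hasDerivWithinAt_univ.1 (hasDerivWithinAt_comp_curve hf hc.hasMFDerivWithinAt)

end Curves

/-! ### The adjoint representation and its differential -/

section Adjoint

variable {𝔨 : Type*} [NormedAddCommGroup 𝔨] [NormedSpace ℝ 𝔨]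
  {K : Type*} [TopologicalSpace K] [ChartedSpace 𝔨 K] [Group K]

theorem IsOneParam.velocity_unique {c : ℝ → K} {ξ η : 𝔨} (h : IsOneParam c ξ)
    (h' : IsOneParam c η) : ξ = η := by
  have := hasMFDerivAt_unique h.deriv h'.deriv
  have h1 : (1 : ℝ) • ξ = (1 : ℝ) • η := DFunLike.congr_fun this (1 : ℝ)
  simpa using h1

theorem IsOneParam.const_one : IsOneParam (fun _ : ℝ => (1 : K)) (0 : 𝔨) where
  add s t := by simp
  deriv := (hasMFDerivAt_const (1 : K) (0 : ℝ)).congr_mfderiv (by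
    ext; change (0 : 𝔨) = (1 : ℝ) • (0 : 𝔨); simp)

/-- The adjoint action as a continuous linear map. -/
def AdL (k : K) : 𝔨 →L[ℝ] 𝔨 := mfderiv 𝓘(ℝ, 𝔨) 𝓘(ℝ, 𝔨) (fun h : K => k * h * k⁻¹) 1

theorem AdL_apply (k : K) (ξ : 𝔨) : AdL k ξ = Ad k ξ := rfl

variable [LieGroup 𝓘(ℝ, 𝔨) ∞ K]

theorem Ad_one [CompleteSpace 𝔨] [T2Space K] (ξ : 𝔨) : Ad (1 : K) ξ = ξ := by
  obtain ⟨c, hc⟩ := exists_isOneParam K ξ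
  have h := hc.conj 1
  simp only [one_mul, inv_one, mul_one] at h
  exact h.velocity_unique hc

/-- Both sides are the initial velocity of the same conjugated one-parameter subgroup. -/
theorem Ad_mul [CompleteSpace 𝔨] [T2Space K] (k l : K) (ξ : 𝔨) :
    Ad (k * l) ξ = Ad k (Ad l ξ) := by
  obtain ⟨c, hc⟩ := exists_isOneParam K ξ
  have h := hc.conj (k * l)
  have h' := (hc.conj l).conj k
  have e : (fun t => k * l * c t * (k * l)⁻¹) = fun t => k * (l * c t * l⁻¹) * k⁻¹ := by
    ext t; group
  rw [e] at h
  exact h.velocity_unique h'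

/-- Conjugation is jointly smooth and always fixes 1. Differentials depend smoothly on parameters in
tangent coordinates, and here these coordinates are trivial because base point and image point are
constantly 1. -/
theorem contMDiff_AdL : ContMDiff 𝓘(ℝ, 𝔨) 𝓘(ℝ, 𝔨 →L[ℝ] 𝔨) ∞ (AdL : K → 𝔨 →L[ℝ] 𝔨) := by
  have : IsManifold 𝓘(ℝ, 𝔨) 1 K := .of_le (n := ∞) (by simp)
  intro k₀
  have h : ContMDiffAt 𝓘(ℝ, 𝔨) 𝓘(ℝ, 𝔨 →L[ℝ] 𝔨) ∞ (inTangentCoordinates 𝓘(ℝ, 𝔨) 𝓘(ℝ, 𝔨)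
      (fun _ : K => (1 : K)) (fun k : K => k * 1 * k⁻¹) AdL k₀) k₀ :=
    ContMDiffAt.mfderiv (I := 𝓘(ℝ, 𝔨)) (I' := 𝓘(ℝ, 𝔨)) (J := 𝓘(ℝ, 𝔨)) (m := ∞) (n := ∞)
      (x₀ := k₀) (fun k h : K => k * h * k⁻¹) (fun _ : K => (1 : K))
      (contMDiff_conj.contMDiffAt) contMDiffAt_const (by simp)
  have hg : (fun k : K => k * 1 * k⁻¹) = fun _ => 1 := by ext; simp
  rw [hg] at h
  refine h.congr_of_eventuallyEq (Eventually.of_forall fun k => ?_)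
  refine ((inTangentCoordinates_eq (fun _ : K => (1 : K)) (fun _ : K => (1 : K)) AdL
    (mem_chart_source 𝔨 (1 : K)) (mem_chart_source 𝔨 (1 : K))).trans ?_).symm
  ext v
  have hs := (tangentBundleCore 𝓘(ℝ, 𝔨) K).coordChange_self (achart 𝔨 (1 : K)) 1
    (mem_chart_source 𝔨 (1 : K))
  exact (hs _).trans (congrArg (AdL k) (hs v))

variable (K) in
/-- The differential at `1` of the adjoint representation: `adL ξ η = [ξ, η]`. -/
def adL : 𝔨 →L[ℝ] 𝔨 →L[ℝ] 𝔨 :=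
  mfderiv 𝓘(ℝ, 𝔨) 𝓘(ℝ, 𝔨 →L[ℝ] 𝔨) (AdL : K → 𝔨 →L[ℝ] 𝔨) 1

theorem continuous_Ad (η : 𝔨) : Continuous fun k : K => Ad k η :=
  (contMDiff_AdL.continuous).clm_apply continuous_const

theorem IsOneParam.hasDerivAt_AdL {c : ℝ → K} {ξ : 𝔨} (h : IsOneParam c ξ) :
    HasDerivAt (fun t => AdL (c t)) (adL K ξ) 0 := by
  have h1 := hasDerivAt_comp_curve (contMDiff_AdL.mdifferentiableAt (by simp)) h.deriv
  rw [h.zero] at h1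
  exact h1

theorem IsOneParam.Ad_eq_of_commute {c : ℝ → K} {ξ : 𝔨} (h : IsOneParam c ξ) {k : K}
    (hk : ∀ t, k * c t = c t * k) : Ad k ξ = ξ := by
  have h1 := h.conj k
  have e : (fun t => k * c t * k⁻¹) = c := by ext t; rw [hk]; group
  rw [e] at h1
  exact h1.velocity_unique h

variable [T2Space K]

/-- An element of `K` fixing `ξ` commutes with the one-parameter subgroup of `ξ`. -/
theorem IsOneParam.commute {c : ℝ → K} {ξ : 𝔨} (h : IsOneParam c ξ) {k : K} (hk : Ad k ξ = ξ)
    (t : ℝ) : k * c t = c t * k := by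
  have h1 := h.conj k
  rw [hk] at h1
  exact mul_inv_eq_iff_eq_mul.1 (congrFun (h1.unique h) t)


variable [CompleteSpace 𝔨]

theorem IsOneParam.hasDerivAt_Ad {c : ℝ → K} {ξ : 𝔨} (h : IsOneParam c ξ) (η : 𝔨) (t : ℝ) :
    HasDerivAt (fun t => Ad (c t) η) (Ad (c t) (adL K ξ η)) t := by
  have h0 : HasDerivAt (fun t => AdL (c t)) (adL K ξ) (t + -t) := by
    rw [add_neg_cancel]; exact h.hasDerivAt_AdL
  have h1 : HasDerivAt (fun s => AdL (c (s + -t)) η) (adL K ξ η) t := by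
    have := (h0.comp_add_const t (-t)).clm_apply (hasDerivAt_const t η)
    simpa using this
  have h2 := (AdL (c t) : 𝔨 →L[ℝ] 𝔨).hasFDerivAt.comp_hasDerivAt t h1
  have e : (fun t => Ad (c t) η) = fun s => AdL (c t) (AdL (c (s + -t)) η) := by
    ext s
    simp only [AdL_apply]
    rw [← Ad_mul, ← h.add]; simp
  rw [e]
  exact h2

theorem IsOneParam.Ad_eq_of_adL_eq_zero {c : ℝ → K} {ξ : 𝔨} (h : IsOneParam c ξ) {η : 𝔨}
    (h0 : adL K ξ η = 0) (t : ℝ) : Ad (c t) η = η := by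
  have hd (s : ℝ) : HasDerivAt (fun t => Ad (c t) η) 0 s := by
    have := h.hasDerivAt_Ad η s
    rwa [h0, ← AdL_apply, map_zero] at this
  have := is_const_of_deriv_eq_zero (fun s => (hd s).differentiableAt) (fun s => (hd s).deriv) t 0
  rwa [h.zero, Ad_one] at this

/-- Differentiate the constant function B (Ad (c t) η) (Ad (c t) ζ) at t = 0. -/
theorem IsInvariantInner.adL_skew {B : 𝔨 →L[ℝ] 𝔨 →L[ℝ] ℝ} (hB : IsInvariantInner K B)
    (ξ η ζ : 𝔨) : B (adL K ξ η) ζ = -B η (adL K ξ ζ) := by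
  obtain ⟨c, hc⟩ := exists_isOneParam K ξ
  have h1 := B.hasFDerivAt.comp_hasDerivAt 0 (hc.hasDerivAt_Ad η 0)
  have h2 := h1.clm_apply (hc.hasDerivAt_Ad ζ 0)
  have e : (fun t => (B ∘ fun t => Ad (c t) η) t (Ad (c t) ζ)) = fun _ => B η ζ := by
    ext t; exact hB.invariant _ _ _
  rw [e] at h2
  have := h2.unique (hasDerivAt_const 0 (B η ζ))
  simp only [hc.zero, Ad_one, Function.comp] at this
  linarith

end Adjoint

/-! ### Orbits, fundamental vector fields and equivariant maps -/

section Orbits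

variable {𝔨 : Type*} [NormedAddCommGroup 𝔨] [NormedSpace ℝ 𝔨]
  {K : Type*} [TopologicalSpace K] [ChartedSpace 𝔨 K] [Group K] [LieGroup 𝓘(ℝ, 𝔨) ∞ K]
  {E : Type*} [NormedAddCommGroup E] [NormedSpace ℝ E]
  {M : Type*} [TopologicalSpace M] [ChartedSpace E M] [IsManifold 𝓘(ℝ, E) ∞ M]
  [MulAction K M] [ContMDiffSMul 𝓘(ℝ, 𝔨) 𝓘(ℝ, E) ∞ K M]

theorem contMDiff_orbit (x : M) : ContMDiff 𝓘(ℝ, 𝔨) 𝓘(ℝ, E) ∞ fun k : K => k • x :=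
  (contMDiff_smul (I := 𝓘(ℝ, 𝔨)) (I' := 𝓘(ℝ, E)) (n := ∞) (G := K) (M := M)).comp
    (contMDiff_id.prodMk contMDiff_const)

theorem contMDiff_translate (𝔨 : Type*) [NormedAddCommGroup 𝔨] [NormedSpace ℝ 𝔨] {K : Type*}
    [TopologicalSpace K] [ChartedSpace 𝔨 K] [Group K]
    {E : Type*} [NormedAddCommGroup E] [NormedSpace ℝ E] {M : Type*} [TopologicalSpace M]
    [ChartedSpace E M] [MulAction K M] [ContMDiffSMul 𝓘(ℝ, 𝔨) 𝓘(ℝ, E) ∞ K M] (k : K) : ContMDiff 𝓘(ℝ, E) 𝓘(ℝ, E) ∞ fun x : M => k • x :=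
  (contMDiff_smul (I := 𝓘(ℝ, 𝔨)) (I' := 𝓘(ℝ, E)) (n := ∞) (G := K) (M := M)).comp
    (contMDiff_const.prodMk contMDiff_id)

theorem IsOneParam.hasMFDerivAt_orbit_zero {c : ℝ → K} {ξ : 𝔨} (h : IsOneParam c ξ) (x : M) :
    HasMFDerivAt 𝓘(ℝ, ℝ) 𝓘(ℝ, E) (fun t => c t • x) 0
      ((1 : ℝ →L[ℝ] ℝ).smulRight (fund K ξ x)) := by
  have h1 : HasMFDerivAt 𝓘(ℝ, 𝔨) 𝓘(ℝ, E) (fun k : K => k • x) (c 0)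
      (mfderiv 𝓘(ℝ, 𝔨) 𝓘(ℝ, E) (fun k : K => k • x) 1) := by
    rw [h.zero]
    exact ((contMDiff_orbit x).mdifferentiableAt (by simp)).hasMFDerivAt
  refine (HasMFDerivAt.comp (0 : ℝ) h1 h.deriv).congr_mfderiv ?_
  ext
  change mfderiv 𝓘(ℝ, 𝔨) 𝓘(ℝ, E) (fun k : K => k • x) 1 ((1 : ℝ) • ξ) = (1 : ℝ) • (fund K ξ x : E)
  exact (congrArg _ (one_smul ℝ ξ)).trans (one_smul ℝ (fund K ξ x : E)).symm

theorem IsOneParam.hasMFDerivAt_orbit {c : ℝ → K} {ξ : 𝔨} (h : IsOneParam c ξ) (x : M) (t : ℝ) :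
    HasMFDerivAt 𝓘(ℝ, ℝ) 𝓘(ℝ, E) (fun t => c t • x) t
      ((1 : ℝ →L[ℝ] ℝ).smulRight (mfderiv 𝓘(ℝ, E) 𝓘(ℝ, E) (fun y : M => c t • y) x (fund K ξ x))) := by
  have e : (fun t => c t • x) = (fun y : M => c t • y) ∘ (fun s => c s • x) ∘ (fun s => s + -t) := by
    ext s; simp [← mul_smul, ← h.add]
  have h0 : HasMFDerivAt 𝓘(ℝ, ℝ) 𝓘(ℝ, ℝ) (fun s : ℝ => s + -t) t
      (ContinuousLinearMap.id ℝ ℝ) :=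
    ((hasDerivAt_id t).add_const (-t)).hasFDerivAt.hasMFDerivAt.congr_mfderiv (by
      ext; simp)
  have h1 : HasMFDerivAt 𝓘(ℝ, ℝ) 𝓘(ℝ, E) (fun s => c s • x) (t + -t)
      ((1 : ℝ →L[ℝ] ℝ).smulRight (fund K ξ x)) := by
    rw [add_neg_cancel]; exact h.hasMFDerivAt_orbit_zero x
  have h2 : HasMFDerivAt 𝓘(ℝ, E) 𝓘(ℝ, E) (fun y : M => c t • y) (c (t + -t) • x)
      (mfderiv 𝓘(ℝ, E) 𝓘(ℝ, E) (fun y : M => c t • y) x) := by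
    rw [add_neg_cancel, h.zero, one_smul]
    exact ((contMDiff_translate 𝔨 (c t)).mdifferentiableAt (by simp)).hasMFDerivAt
  have := HasMFDerivAt.comp t h2 (HasMFDerivAt.comp t h1 h0)
  rw [← e] at this
  refine this.congr_mfderiv ?_
  ext
  change mfderiv 𝓘(ℝ, E) 𝓘(ℝ, E) (fun y : M => c t • y) x ((1 : ℝ) • fund K ξ x) =
    (1 : ℝ) • mfderiv 𝓘(ℝ, E) 𝓘(ℝ, E) (fun y : M => c t • y) x (fund K ξ x)
  rw [one_smul, one_smul]

/-- If the fundamental vector field of `ξ` vanishes at `x`, its one-parameter subgroup fixes `x`. -/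
theorem IsOneParam.smul_eq_of_fund_eq_zero [T2Space M] {c : ℝ → K} {ξ : 𝔨} (h : IsOneParam c ξ)
    {x : M} (hx : (fund K ξ x : TangentSpace 𝓘(ℝ, E) x) = 0) (t : ℝ) : c t • x = x := by
  have : IsManifold 𝓘(ℝ, E) 1 M := .of_le (n := ∞) (by simp)
  have h1 : IsMIntegralCurve (fun t => c t • x) (fun y => (0 : TangentSpace 𝓘(ℝ, E) y)) := by
    intro s
    have := h.hasMFDerivAt_orbit (E := E) x s
    rwa [hx, map_zero] at this
  have h2 : IsMIntegralCurve (fun _ : ℝ => x) (fun y => (0 : TangentSpace 𝓘(ℝ, E) y)) :=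
    isMIntegralCurve_const rfl
  have := isMIntegralCurve_Ioo_eq_of_contMDiff_boundaryless (t₀ := 0)
    (contMDiff_zeroSection ℝ (TangentSpace 𝓘(ℝ, E) : M → Type _)) h1 h2 (by simp [h.zero])
  exact congrFun this t

variable (K) in
/-- The fundamental vector field of a smooth `𝔨`-valued function is smooth. -/
theorem contMDiff_fund {ξ : M → 𝔨} (hξ : ContMDiff 𝓘(ℝ, E) 𝓘(ℝ, 𝔨) ∞ ξ) :
    ContMDiff 𝓘(ℝ, E) 𝓘(ℝ, E).tangent ∞
      (fun x : M => (⟨x, fund K (ξ x) x⟩ : TangentBundle 𝓘(ℝ, E) M)) := by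
  have : IsManifold 𝓘(ℝ, E) 1 M := .of_le (n := ∞) (by simp)
  have : IsManifold 𝓘(ℝ, 𝔨) 1 K := .of_le (n := ∞) (by simp)
  -- The field is the tangent map of the action K × M → M, applied to the vector ξ x at 1 in K and
  -- the zero vector at x in M.
  let fg : M → TangentBundle 𝓘(ℝ, E) M := fun g => TotalSpace.mk' E g 0
  have sfg : ContMDiff 𝓘(ℝ, E) 𝓘(ℝ, E).tangent ∞ fg := contMDiff_zeroSection _ _
  let fv : M → TangentBundle 𝓘(ℝ, 𝔨) K := fun x => TotalSpace.mk' 𝔨 (1 : K) (ξ x)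
  have sfv : ContMDiff 𝓘(ℝ, E) 𝓘(ℝ, 𝔨).tangent ∞ fv := by
    intro x₀
    refine contMDiffAt_totalSpace.2 ⟨contMDiffAt_const, ?_⟩
    refine (hξ x₀).congr_of_eventuallyEq (Eventually.of_forall fun x => ?_)
    exact (tangentBundleCore 𝓘(ℝ, 𝔨) K).coordChange_self (achart 𝔨 (1 : K)) 1
      (mem_chart_source 𝔨 (1 : K)) (ξ x)
  let F₁ : M → (TangentBundle 𝓘(ℝ, 𝔨) K × TangentBundle 𝓘(ℝ, E) M) := fun g => (fv g, fg g)
  have S₁ := sfv.prodMk sfg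
  have S₂ := contMDiff_equivTangentBundleProd_symm (I := 𝓘(ℝ, 𝔨)) (M := K) (I' := 𝓘(ℝ, E)) (M' := M) (n := ∞)
  have S₃ := (contMDiff_smul (I := 𝓘(ℝ, 𝔨)) (I' := 𝓘(ℝ, E)) (n := ∞) (G := K) (M := M)).contMDiff_tangentMap
    (m := ∞) (by simp)
  let S := (S₃.comp S₂).comp S₁
  convert! S with g
  · simp [fg, fv]
  · simp only [Function.comp_apply, tangentMap, fg, fv]
    rw [mfderiv_prod_eq_add_apply ((contMDiff_smul (I := 𝓘(ℝ, 𝔨)) (I' := 𝓘(ℝ, E)) (n := ∞)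
      (G := K) (M := M)).mdifferentiableAt (by simp))]
    simp +instances [fund]
    exact ((congrArg _ (map_zero _)).trans (add_zero _)).symm

variable [CompleteSpace 𝔨] [T2Space K]

/-- Differentiate μ (c t • x) = Ad (c t) (μ x) at t = 0. -/
theorem mfderiv_equivariant_fund {μ : M → 𝔨} (hs : ContMDiff 𝓘(ℝ, E) 𝓘(ℝ, 𝔨) ∞ μ)
    (he : ∀ (k : K) (x : M), μ (k • x) = Ad k (μ x)) (ξ : 𝔨) (x : M) :
    (mfderiv 𝓘(ℝ, E) 𝓘(ℝ, 𝔨) μ x (fund K ξ x) : 𝔨) = adL K ξ (μ x) := by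
  obtain ⟨c, hc⟩ := exists_isOneParam K ξ
  have h1 := hasDerivAt_comp_curve (hs.mdifferentiableAt (by simp))
    (hc.hasMFDerivAt_orbit_zero (E := E) x)
  have h2 := hc.hasDerivAt_Ad (μ x) 0
  simp only [he] at h1
  rw [hc.zero, Ad_one] at h2
  have h3 := h1.unique h2
  rw [hc.zero, one_smul] at h3
  exact h3

end Orbits

/-! ### Closed subgroups and their one-parameter subgroups -/

section ClosedSubgroups

/-- Telescoping: the factors a are replaced by b one at a time, and each replacement happens between
arbitrary left and right factors. Hence the need for a bound uniform over two-sided translates. -/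
theorem abs_sub_pow_le {K : Type*} [Group K] {f : K → ℝ} {a b : K} {C : ℝ}
    (h : ∀ k l : K, |f (k * a * l) - f (k * b * l)| ≤ C) (m : ℕ) (l : K) :
    |f (a ^ m * l) - f (b ^ m * l)| ≤ m * C := by
  induction m generalizing l with
  | zero => simp
  | succ m ih =>
    have h1 := h (a ^ m) l
    have h2 := ih (b * l)
    rw [← mul_assoc, ← mul_assoc, ← pow_succ] at h2
    rw [← pow_succ] at h1
    calc |f (a ^ (m + 1) * l) - f (b ^ (m + 1) * l)|
        ≤ |f (a ^ (m + 1) * l) - f (a ^ m * b * l)|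
          + |f (a ^ m * b * l) - f (b ^ (m + 1) * l)| := abs_sub_le _ _ _
      _ ≤ C + m * C := add_le_add h1 h2
      _ = _ := by push_cast; ring

variable {𝔨 : Type*} [NormedAddCommGroup 𝔨] [NormedSpace ℝ 𝔨]
  {K : Type*} [TopologicalSpace K] [ChartedSpace 𝔨 K] [Group K]

theorem IsOneParam.hasDerivAt_chart {c : ℝ → K} {ξ : 𝔨} (h : IsOneParam c ξ) :
    HasDerivAt (fun t => chartAt 𝔨 (1 : K) (c t)) ξ 0 := by
  have h1 := h.deriv.2
  simp only [writtenInExtChartAt, h.zero, mfld_simps] at h1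
  have key (f : ℝ → 𝔨) (h : HasFDerivAt f ((1 : ℝ →L[ℝ] ℝ).smulRight ξ) 0) :
      HasDerivAt f ξ 0 := by
    rw [hasDerivAt_iff_hasFDerivAt]
    refine h.congr_fderiv ?_
    ext; simp
  exact key _ (hasFDerivWithinAt_univ.1 h1)

variable [LieGroup 𝓘(ℝ, 𝔨) ∞ K]

theorem contMDiffAt_chart_symm_one : ContMDiffAt 𝓘(ℝ, 𝔨) 𝓘(ℝ, 𝔨) ∞ (chartAt 𝔨 (1 : K)).symm
    (chartAt 𝔨 (1 : K) 1) :=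
  (contMDiffOn_chart_symm (x := (1 : K))).contMDiffAt
    ((chartAt 𝔨 (1 : K)).open_target.mem_nhds (mem_chart_target _ _))

theorem exists_lipschitz_translates_local {f : K → ℝ} (hf : ContMDiff 𝓘(ℝ, 𝔨) 𝓘(ℝ, ℝ) ∞ f)
    (k₀ l₀ : K) : ∃ L : ℝ, ∃ V ∈ 𝓝 (k₀, l₀), ∃ U ∈ 𝓝 (1 : K), ∀ p ∈ V, ∀ a ∈ U, ∀ b ∈ U,
      |f (p.1 * a * p.2) - f (p.1 * b * p.2)| ≤
        L * ‖chartAt 𝔨 (1 : K) a - chartAt 𝔨 (1 : K) b‖ := by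
  set e := chartAt 𝔨 (1 : K)
  set ek := chartAt 𝔨 k₀
  set el := chartAt 𝔨 l₀
  have hs (k : K) : ContMDiffAt 𝓘(ℝ, 𝔨) 𝓘(ℝ, 𝔨) ∞ (chartAt 𝔨 k).symm (chartAt 𝔨 k k) :=
    (contMDiffOn_chart_symm (x := k)).contMDiffAt
      ((chartAt 𝔨 k).open_target.mem_nhds (mem_chart_target _ _))
  let F : 𝔨 × 𝔨 × 𝔨 → ℝ := fun q => f (ek.symm q.1 * e.symm q.2.2 * el.symm q.2.1)
  have hF : ContDiffAt ℝ 1 F (ek k₀, el l₀, e 1) := by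
    rw [← contMDiffAt_iff_contDiffAt]
    refine ContMDiffAt.of_le (n := ∞) ?_ (by simp)
    refine (hf _).comp (ek k₀, el l₀, e 1) ?_
    refine ContMDiffAt.mul (ContMDiffAt.mul ?_ ?_) ?_
    · exact ContMDiffAt.comp (ek k₀, el l₀, e 1) (hs k₀) contDiff_fst.contMDiff.contMDiffAt
    · exact ContMDiffAt.comp (ek k₀, el l₀, e 1) (hs 1)
        (contDiff_snd.comp contDiff_snd).contMDiff.contMDiffAt
    · exact ContMDiffAt.comp (ek k₀, el l₀, e 1) (hs l₀)
        (contDiff_fst.comp contDiff_snd).contMDiff.contMDiffAt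
  obtain ⟨L, t, ht, hL⟩ := hF.exists_lipschitzOnWith
  obtain ⟨t1, ht1, t23, ht23, h123⟩ := mem_nhds_prod_iff.1 ht
  obtain ⟨t2, ht2, t3, ht3, h23⟩ := mem_nhds_prod_iff.1 ht23
  have hc (k : K) : ContinuousAt (chartAt 𝔨 k) k :=
    (chartAt 𝔨 k).continuousAt (mem_chart_source _ _)
  have hsrc (k : K) : (chartAt 𝔨 k).source ∈ 𝓝 k :=
    (chartAt 𝔨 k).open_source.mem_nhds (mem_chart_source _ _)
  refine ⟨L, (ek.source ∩ ek ⁻¹' t1) ×ˢ (el.source ∩ el ⁻¹' t2), prod_mem_nhds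
    (inter_mem (hsrc _) (hc _ ht1)) (inter_mem (hsrc _) (hc _ ht2)),
    e.source ∩ e ⁻¹' t3, inter_mem (hsrc _) (hc _ ht3), ?_⟩
  rintro ⟨k, l⟩ ⟨⟨hk, hk'⟩, hl, hl'⟩ a ⟨ha, ha'⟩ b ⟨hb, hb'⟩
  have hm (a : K) (ha' : e a ∈ t3) : (ek k, el l, e a) ∈ t := h123 ⟨hk', h23 ⟨hl', ha'⟩⟩
  have := hL.dist_le_mul _ (hm a ha') _ (hm b hb')
  simp only [F, ek.left_inv hk, el.left_inv hl, e.left_inv ha, e.left_inv hb] at this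
  rw [Real.dist_eq] at this
  refine this.trans (le_of_eq ?_)
  rw [dist_eq_norm]
  simp

/-- Local Lipschitz bounds in charts are made uniform in k and l by compactness of K × K. This
supplies the constant C of `abs_sub_pow_le`. -/
theorem exists_lipschitz_translates [CompactSpace K] {f : K → ℝ}
    (hf : ContMDiff 𝓘(ℝ, 𝔨) 𝓘(ℝ, ℝ) ∞ f) : ∃ L : ℝ, ∃ U ∈ 𝓝 (1 : K), ∀ a ∈ U, ∀ b ∈ U,
      ∀ k l : K, |f (k * a * l) - f (k * b * l)| ≤
        L * ‖chartAt 𝔨 (1 : K) a - chartAt 𝔨 (1 : K) b‖ := by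
  have h := isCompact_univ (X := K × K) |>.induction_on
    (p := fun s => ∃ L : ℝ, ∃ U ∈ 𝓝 (1 : K), ∀ p ∈ s, ∀ a ∈ U, ∀ b ∈ U,
      |f (p.1 * a * p.2) - f (p.1 * b * p.2)| ≤
        L * ‖chartAt 𝔨 (1 : K) a - chartAt 𝔨 (1 : K) b‖)
    ⟨0, univ, univ_mem, by simp⟩
    (fun s t hst ⟨L, U, hU, h⟩ => ⟨L, U, hU, fun p hp => h p (hst hp)⟩)
    (fun s t ⟨L, U, hU, h⟩ ⟨L', U', hU', h'⟩ => ⟨max L L', U ∩ U', inter_mem hU hU', by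
      rintro p (hp | hp) a ⟨ha, ha'⟩ b ⟨hb, hb'⟩
      · exact (h p hp a ha b hb).trans (by gcongr; exact le_max_left _ _)
      · exact (h' p hp a ha' b hb').trans (by gcongr; exact le_max_right _ _)⟩)
    (fun p _ => by
      obtain ⟨L, V, hV, U, hU, h⟩ := exists_lipschitz_translates_local hf p.1 p.2
      exact ⟨V, mem_nhdsWithin_of_mem_nhds hV, L, U, hU, h⟩)
  obtain ⟨L, U, hU, h⟩ := h
  exact ⟨L, U, hU, fun a ha b hb k l => h (k, l) (mem_univ _) a ha b hb⟩

/-- A closed subgroup contains the one-parameter subgroups tangent to it at `1`. -/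
theorem IsOneParam.mem_of_tendsto [FiniteDimensional ℝ 𝔨] [T2Space K] [CompactSpace K]
    {T : Subgroup K} (hT : IsClosed (T : Set K)) {w : ℕ → K} (hw : ∀ n, w n ∈ T)
    (hw1 : Tendsto w atTop (𝓝 1)) {h : ℕ → ℝ} (h0 : ∀ n, 0 < h n) (hh : Tendsto h atTop (𝓝 0))
    {v : 𝔨} (hv : Tendsto (fun n => (h n)⁻¹ • (chartAt 𝔨 (1 : K) (w n) - chartAt 𝔨 (1 : K) 1))
      atTop (𝓝 v)) {c : ℝ → K} (hc : IsOneParam c v) (s : ℝ) : c s ∈ T := by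
  wlog hs : 0 ≤ s generalizing s
  · have := this (-s) (by linarith)
    rw [hc.neg] at this
    exact T.inv_mem_iff.1 this
  by_contra hcs
  -- The function f separates T from c s. With m = ⌊s / h n⌋, the power w n ^ m lies in T, where f =
  -- 0, while c (h n) ^ m = c (m * h n) tends to c s, where f = 1. Telescoping bounds the difference
  -- of the two values by s * L times the rescaled distance of w n and c (h n), which tends to 0
  -- because both have first-order term v.
  obtain ⟨f, hf0, hf1, -⟩ := exists_contMDiffMap_zero_one_of_isClosed 𝓘(ℝ, 𝔨) (n := ⊤)
    hT (isClosed_singleton (x := c s)) (disjoint_singleton_right.2 hcs)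
  obtain ⟨L, U, hU, hL⟩ := exists_lipschitz_translates f.contMDiff
  set e := chartAt 𝔨 (1 : K)
  have hc0 : Tendsto (fun n => c (h n)) atTop (𝓝 1) := by
    have := (hc.continuous.tendsto 0).comp hh
    rwa [hc.zero] at this
  have hd : Tendsto (fun n => (h n)⁻¹ • (e (c (h n)) - e 1)) atTop (𝓝 v) := by
    have := hc.hasDerivAt_chart.tendsto_slope_zero.comp
      (tendsto_nhdsWithin_iff.2 ⟨hh, Eventually.of_forall fun n => (h0 n).ne'⟩)
    simpa [Function.comp_def, hc.zero] using this
  have hdiff : Tendsto (fun n => s * (L * ‖(h n)⁻¹ • (e (w n) - e (c (h n)))‖)) atTop (𝓝 0) := by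
    have := ((hv.sub hd).norm.const_mul L).const_mul s
    simp only [← smul_sub, sub_sub_sub_cancel_right] at this
    simpa using this
  have hfl : Tendsto (fun n => (⌊s / h n⌋₊ : ℝ) * h n) atTop (𝓝 s) := by
    refine tendsto_of_tendsto_of_tendsto_of_le_of_le (g := fun n => s - h n) (h := fun _ => s)
      (by simpa using tendsto_const_nhds.sub hh) tendsto_const_nhds (fun n => ?_) (fun n => ?_)
    · have := Nat.lt_floor_add_one (s / h n)
      rw [div_lt_iff₀ (h0 n)] at this
      dsimp only
      linarith
    · have := Nat.floor_le (div_nonneg hs (h0 n).le)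
      rwa [le_div_iff₀ (h0 n)] at this
  have hlim : Tendsto (fun n => |f (w n ^ ⌊s / h n⌋₊) - f (c (h n) ^ ⌊s / h n⌋₊)|) atTop
      (𝓝 1) := by
    have h1 : Tendsto (fun n => |f (c (⌊s / h n⌋₊ * h n))|) atTop (𝓝 |f (c s)|) :=
      (((f.contMDiff.continuous.comp hc.continuous).abs).tendsto s).comp hfl
    have h2 : f (c s) = 1 := hf1 rfl
    rw [h2, abs_one] at h1
    refine h1.congr fun n => ?_
    have h3 : f (w n ^ ⌊s / h n⌋₊) = 0 := hf0 (T.pow_mem (hw n) _)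
    rw [h3, hc.nat_mul, zero_sub, abs_neg]
  have hle : ∀ᶠ n in atTop, |f (w n ^ ⌊s / h n⌋₊) - f (c (h n) ^ ⌊s / h n⌋₊)| ≤
      s * (L * ‖(h n)⁻¹ • (e (w n) - e (c (h n)))‖) := by
    filter_upwards [hw1 hU, hc0 hU] with n hn hn'
    have h1 := abs_sub_pow_le (f := f) (hL (w n) hn (c (h n)) hn') ⌊s / h n⌋₊ 1
    rw [mul_one, mul_one] at h1
    have hC : 0 ≤ L * ‖e (w n) - e (c (h n))‖ := (abs_nonneg _).trans (hL (w n) hn _ hn' 1 1)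
    refine h1.trans ?_
    calc (⌊s / h n⌋₊ : ℝ) * (L * ‖e (w n) - e (c (h n))‖)
        ≤ (s / h n) * (L * ‖e (w n) - e (c (h n))‖) := by
          gcongr; exact Nat.floor_le (div_nonneg hs (h0 n).le)
      _ = _ := by
          rw [norm_smul, norm_inv, Real.norm_of_nonneg (h0 n).le]; ring
  have := le_of_tendsto_of_tendsto hlim hdiff hle
  norm_num at this

/-- Since 1 is neutral, the partial derivative in each variable is the identity, so the differential
of multiplication at (1, 1) is addition. -/
theorem hasFDerivAt_mul_chart :
    HasFDerivAt (fun q : 𝔨 × 𝔨 => chartAt 𝔨 (1 : K)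
      ((chartAt 𝔨 (1 : K)).symm q.1 * (chartAt 𝔨 (1 : K)).symm q.2))
      (ContinuousLinearMap.fst ℝ 𝔨 𝔨 + ContinuousLinearMap.snd ℝ 𝔨 𝔨)
      (chartAt 𝔨 (1 : K) 1, chartAt 𝔨 (1 : K) 1) := by
  set e := chartAt 𝔨 (1 : K)
  set G : 𝔨 × 𝔨 → 𝔨 := fun q => e (e.symm q.1 * e.symm q.2)
  have he1 : e.symm (e 1) = 1 := e.left_inv (mem_chart_source 𝔨 (1 : K))
  have hG : ContDiffAt ℝ ∞ G (e 1, e 1) := by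
    rw [← contMDiffAt_iff_contDiffAt]
    have h1 : ContMDiffAt 𝓘(ℝ, 𝔨 × 𝔨) 𝓘(ℝ, 𝔨) ∞ (fun q : 𝔨 × 𝔨 => e.symm q.1 * e.symm q.2)
        (e 1, e 1) :=
      (ContMDiffAt.comp (e 1, e 1) contMDiffAt_chart_symm_one
        contDiff_fst.contMDiff.contMDiffAt).mul
      (ContMDiffAt.comp (e 1, e 1) contMDiffAt_chart_symm_one contDiff_snd.contMDiff.contMDiffAt)
    refine ContMDiffAt.comp (e 1, e 1) (I' := 𝓘(ℝ, 𝔨)) (g := e) ?_ h1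
    have h2 : ContMDiffAt 𝓘(ℝ, 𝔨) 𝓘(ℝ, 𝔨) ∞ e 1 :=
      (contMDiffOn_chart (x := (1 : K))).contMDiffAt
        (e.open_source.mem_nhds (mem_chart_source _ _))
    simpa [he1] using h2
  have hd := (hG.differentiableAt (by simp)).hasFDerivAt
  have htgt : ∀ᶠ x in 𝓝 (e 1), e (e.symm x) = x := by
    filter_upwards [e.open_target.mem_nhds (mem_chart_target 𝔨 (1 : K))] with x hx
    exact e.right_inv hx
  have hl : fderiv ℝ G (e 1, e 1) ∘L ContinuousLinearMap.inl ℝ 𝔨 𝔨 = ContinuousLinearMap.id ℝ 𝔨 := by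
    have h1 : HasFDerivAt (fun x => G (x, e 1)) (fderiv ℝ G (e 1, e 1) ∘L
      ContinuousLinearMap.inl ℝ 𝔨 𝔨) (e 1) := hd.comp (f := fun x => (x, e 1)) (e 1) (hasFDerivAt_prodMk_left (e 1) (e 1))
    refine h1.unique ((hasFDerivAt_id (e 1)).congr_of_eventuallyEq ?_)
    filter_upwards [htgt] with x hx
    simp [G, he1, hx]
  have hr : fderiv ℝ G (e 1, e 1) ∘L ContinuousLinearMap.inr ℝ 𝔨 𝔨 = ContinuousLinearMap.id ℝ 𝔨 := by
    have h1 : HasFDerivAt (fun x => G (e 1, x)) (fderiv ℝ G (e 1, e 1) ∘L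
      ContinuousLinearMap.inr ℝ 𝔨 𝔨) (e 1) := hd.comp (f := fun x => (e 1, x)) (e 1) (hasFDerivAt_prodMk_right (e 1) (e 1))
    refine h1.unique ((hasFDerivAt_id (e 1)).congr_of_eventuallyEq ?_)
    filter_upwards [htgt] with x hx
    simp [G, he1, hx]
  refine hd.congr_fderiv ?_
  ext x
  · simpa using DFunLike.congr_fun hl x
  · simpa using DFunLike.congr_fun hr x

/-- If `w n → 1` has coordinates `h n • v + o (h n)`, then the coordinates of `c (-h n) * w n` are
`o (h n)`, where `c` is the one-parameter subgroup of `v`. -/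
theorem IsOneParam.tendsto_chart_mul {w : ℕ → K} {h : ℕ → ℝ} (h0 : ∀ n, 0 < h n)
    (hh : Tendsto h atTop (𝓝 0)) (hw1 : Tendsto w atTop (𝓝 1))
    {v : 𝔨} (hv : Tendsto (fun n => (h n)⁻¹ • (chartAt 𝔨 (1 : K) (w n) - chartAt 𝔨 (1 : K) 1))
      atTop (𝓝 v)) {c : ℝ → K} (hc : IsOneParam c v) :
    Tendsto (fun n => (h n)⁻¹ • (chartAt 𝔨 (1 : K) (c (-h n) * w n) - chartAt 𝔨 (1 : K) 1))
      atTop (𝓝 0) := by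
  set e := chartAt 𝔨 (1 : K)
  have he1 : e.symm (e 1) = 1 := e.left_inv (mem_chart_source 𝔨 (1 : K))
  have hhn : Tendsto (fun n => -h n) atTop (𝓝 0) := by simpa using hh.neg
  have hc0 : Tendsto (fun n => c (-h n)) atTop (𝓝 1) := by
    have := (hc.continuous.tendsto 0).comp hhn
    rwa [hc.zero] at this
  have hd : Tendsto (fun n => (h n)⁻¹ • (e (c (-h n)) - e 1)) atTop (𝓝 (-v)) := by
    have := (hc.hasDerivAt_chart.tendsto_slope_zero.comp
      (tendsto_nhdsWithin_iff.2 ⟨hhn, Eventually.of_forall fun n => (neg_ne_zero.2 (h0 n).ne')⟩)).neg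
    simpa [Function.comp_def, hc.zero, inv_neg] using this
  have hsrc : e.source ∈ 𝓝 (1 : K) := e.open_source.mem_nhds (mem_chart_source _ _)
  have hcont : ContinuousAt e 1 := e.continuousAt (mem_chart_source _ _)
  have hpq : Tendsto (fun n => (h n)⁻¹ • ((e (c (-h n)), e (w n)) - (e 1, e 1))) atTop
      (𝓝 (-v, v)) := by
    refine (hd.prodMk_nhds hv).congr fun n => ?_
    simp
  have key := (hasFDerivAt_mul_chart (K := K) (𝔨 := 𝔨)).hasFDerivWithinAt (s := univ) |>.lim
    (α := ℕ) (l := atTop) (c := fun n => (h n)⁻¹)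
    (d := fun n => (e (c (-h n)), e (w n)) - (e 1, e 1)) (v := (-v, v))
  have := key (by
      have := ((hcont.tendsto.comp hc0).prodMk_nhds (hcont.tendsto.comp hw1)).sub_const (e 1, e 1)
      simpa [Function.comp_def] using this) (by simp) hpq
  simp only [add_apply, ContinuousLinearMap.coe_fst',
    ContinuousLinearMap.coe_snd', neg_add_cancel] at this
  refine this.congr' ?_
  filter_upwards [hc0 hsrc, hw1 hsrc] with n h1 h2
  change (h n)⁻¹ • (e (e.symm (e 1 + (e (c (-h n)) - e 1)) * e.symm (e 1 + (e (w n) - e 1))) -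
    e (e.symm (e 1) * e.symm (e 1))) = _
  rw [add_sub_cancel, add_sub_cancel, e.left_inv h1, e.left_inv h2, he1, one_mul]

/-- A closed subgroup which contains all one-parameter subgroups of a closed connected subgroup `T`
of a compact Lie group contains `T`. -/
theorem le_of_oneParam_mem [FiniteDimensional ℝ 𝔨] [T2Space K] [CompactSpace K] {S T : Subgroup K}
    (hT : IsClosed (T : Set K)) (hTc : IsConnected (T : Set K)) (hS : IsClosed (S : Set K))
    (h : ∀ (c : ℝ → K) (ξ : 𝔨), IsOneParam c ξ → (∀ t, c t ∈ T) → ∀ t, c t ∈ S) : T ≤ S := by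
  have : IsTopologicalGroup K := topologicalGroup_of_lieGroup 𝓘(ℝ, 𝔨) ∞
  by_contra hTS
  -- points of `T` outside `S` accumulate at `1`
  have hacc : ∀ U ∈ 𝓝 (1 : K), ∃ t ∈ T, t ∉ S ∧ t ∈ U := by
    by_contra! hU
    obtain ⟨U, hU, hUS⟩ := hU
    -- Otherwise the trace of S on T is a neighbourhood of 1, hence an open and closed subgroup of
    -- the connected group T, hence all of T.
    have : ConnectedSpace T := isConnected_iff_connectedSpace.1 hTc
    have hn : ((S.subgroupOf T : Subgroup T) : Set T) ∈ 𝓝 (1 : T) := by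
      refine mem_of_superset (continuous_subtype_val.continuousAt.preimage_mem_nhds
        (t := U) (by simpa using hU)) fun t ht => ?_
      by_contra hts
      exact hUS t t.2 hts ht
    have ho := Subgroup.isOpen_of_mem_nhds _ hn
    have hu := IsClopen.eq_univ ⟨Subgroup.isClosed_of_isOpen _ ho, ho⟩ ⟨1, Subgroup.one_mem _⟩
    refine hTS fun t ht => ?_
    have : (⟨t, ht⟩ : T) ∈ ((S.subgroupOf T : Subgroup T) : Set T) := by rw [hu]; trivial
    exact this
  set e := chartAt 𝔨 (1 : K)
  have hsrc : e.source ∈ 𝓝 (1 : K) := e.open_source.mem_nhds (mem_chart_source _ _)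
  obtain ⟨r, hr, hball⟩ := Metric.nhds_basis_closedBall.mem_iff.1
    (e.open_target.mem_nhds (mem_chart_target 𝔨 (1 : K)))
  set V : Set K := e.source ∩ e ⁻¹' Metric.closedBall (e 1) r with hV
  have hVe : V = e.symm '' Metric.closedBall (e 1) r := by
    rw [e.symm_image_eq_source_inter_preimage hball]
  have hVc : IsCompact V := by
    rw [hVe]
    exact (isCompact_closedBall _ _).image_of_continuousOn (e.continuousOn_symm.mono hball)
  have hVn : V ∈ 𝓝 (1 : K) := inter_mem hsrc
    ((e.continuousAt (mem_chart_source _ _)).preimage_mem_nhds (Metric.closedBall_mem_nhds _ hr))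
  -- a representative of minimal norm in the coset of a point near `1`
  have hmin : ∀ ε > 0, ∃ w ∈ T, w ∉ S ∧ w ∈ V ∧ ‖e w - e 1‖ < ε ∧
      ∀ s ∈ S, s ∈ T → s * w ∈ V → ‖e w - e 1‖ ≤ ‖e (s * w) - e 1‖ := by
    intro ε hε
    obtain ⟨t, htT, htS, htV, htε⟩ := hacc (V ∩ (e.source ∩ e ⁻¹' Metric.ball (e 1) ε))
      (inter_mem hVn (inter_mem hsrc
        ((e.continuousAt (mem_chart_source _ _)).preimage_mem_nhds (Metric.ball_mem_nhds _ hε))))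
    set C : Set K := V ∩ {w | w * t⁻¹ ∈ S ∧ w * t⁻¹ ∈ T} with hC
    have hCc : IsCompact C := hVc.inter_right
      ((hS.preimage (continuous_mul_const t⁻¹)).inter (hT.preimage (continuous_mul_const t⁻¹)))
    obtain ⟨w, hwC, hw⟩ := hCc.exists_isMinOn (f := fun w => ‖e w - e 1‖)
      ⟨t, htV, by simp [S.one_mem], by simp [T.one_mem]⟩
      (((e.continuousOn.mono (fun w hw => hw.1.1)).sub continuousOn_const).norm)
    have hwt : w = (w * t⁻¹) * t := by group
    refine ⟨w, ?_, ?_, hwC.1, ?_, fun s hs hsT hsV => ?_⟩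
    · rw [hwt]; exact T.mul_mem hwC.2.2 htT
    · intro hwS
      exact htS ((S.mul_mem_cancel_left hwC.2.1).1 (hwt ▸ hwS))
    · have := isMinOn_iff.1 hw t ⟨htV, by simp [S.one_mem], by simp [T.one_mem]⟩
      have h2 := htε.2
      rw [mem_preimage, Metric.mem_ball, dist_eq_norm] at h2
      exact this.trans_lt h2
    · refine isMinOn_iff.1 hw (s * w) ⟨hsV, ?_, ?_⟩
      · rw [mul_assoc]; exact S.mul_mem hs hwC.2.1
      · rw [mul_assoc]; exact T.mul_mem hsT hwC.2.2
  choose w hwT hwS hwV hwε hwmin using fun n : ℕ => hmin (1 / (n + 1 : ℝ)) (by positivity)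
  set a : ℕ → ℝ := fun n => ‖e (w n) - e 1‖ with ha
  have ha0 (n : ℕ) : 0 < a n := by
    rw [ha]
    refine norm_pos_iff.2 (sub_ne_zero.2 fun heq => ?_)
    have := e.injOn (hwV n).1 (mem_chart_source 𝔨 (1 : K)) heq
    exact hwS n (this ▸ S.one_mem)
  have hat : Tendsto a atTop (𝓝 0) :=
    squeeze_zero (fun n => (ha0 n).le) (fun n => (hwε n).le) tendsto_one_div_add_atTop_nhds_zero_nat
  have hw1 : Tendsto w atTop (𝓝 1) := by
    have h1 : Tendsto (fun n => e (w n)) atTop (𝓝 (e 1)) := tendsto_iff_norm_sub_tendsto_zero.2 hat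
    have h2 := (e.continuousAt_symm (mem_chart_target 𝔨 (1 : K))).tendsto.comp h1
    rw [e.left_inv (mem_chart_source 𝔨 (1 : K))] at h2
    exact h2.congr fun n => e.left_inv (hwV n).1
  -- The directions of the minimal representatives subconverge to a unit vector v. Its one-parameter
  -- subgroup lies in T, being tangent to T, and therefore in S. So c (-a n) * w n is in the same
  -- coset as w n but at distance o(a n) from 1, against minimality.
  obtain ⟨v, -, φ, hφ, hv⟩ := (isCompact_sphere (0 : 𝔨) 1).tendsto_subseq
    (x := fun n => (a n)⁻¹ • (e (w n) - e 1)) (fun n => by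
      rw [mem_sphere_zero_iff_norm, norm_smul, norm_inv, Real.norm_of_nonneg (ha0 n).le]
      exact inv_mul_cancel₀ (ha0 n).ne')
  obtain ⟨c, hc⟩ := exists_isOneParam K v
  have hφt := hφ.tendsto_atTop
  have hcT := hc.mem_of_tendsto hT (w := w ∘ φ) (fun n => hwT _) (hw1.comp hφt)
    (h := a ∘ φ) (fun n => ha0 _) (hat.comp hφt) hv
  have hcS := h c v hc hcT
  have hlim := hc.tendsto_chart_mul (w := w ∘ φ) (h := a ∘ φ) (fun n => ha0 _) (hat.comp hφt)
    (hw1.comp hφt) hv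
  have hV' : Tendsto (fun n => c (-(a ∘ φ) n) * (w ∘ φ) n) atTop (𝓝 1) := by
    have h1 : Tendsto (fun n => c (-(a ∘ φ) n)) atTop (𝓝 1) := by
      have := (hc.continuous.tendsto 0).comp (f := fun n => -(a ∘ φ) n)
        (by simpa using (hat.comp hφt).neg)
      rwa [hc.zero] at this
    simpa using h1.mul (hw1.comp hφt)
  have hlt := hlim.norm.eventually (gt_mem_nhds (by simp : ‖(0 : 𝔨)‖ < 1))
  obtain ⟨n, hn1, hn2⟩ := (hlt.and (hV' hVn)).exists
  have := hwmin (φ n) _ (hcS (-a (φ n))) (hcT _) hn2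
  simp only [Function.comp_apply] at hn1
  rw [norm_smul, norm_inv, Real.norm_of_nonneg (ha0 _).le, inv_mul_lt_iff₀ (ha0 _), mul_one] at hn1
  exact absurd this (not_le.2 hn1)

end ClosedSubgroups

/-! ### Maximal tori: generic elements and conjugation -/

section MaximalTorus

/-- D is injective on its range, hence bounded below there by 1 / C. If D x = -ε D' x, applying D
gives ‖D x‖ ≤ C ε ‖D'‖ ‖D x‖, and ε is chosen with C ε ‖D'‖ < 1. A small perturbation of D thus has
kernel inside ker D ∩ ker D'. -/
theorem exists_ker_add_smul_le {V : Type*} [NormedAddCommGroup V] [NormedSpace ℝ V]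
    [FiniteDimensional ℝ V] {D D' : V →L[ℝ] V} (hD : ∀ x, D (D x) = 0 → D x = 0)
    (hcomm : ∀ x, D (D' x) = D' (D x)) :
    ∃ ε : ℝ, ∀ x, D x + ε • D' x = 0 → D x = 0 ∧ D' x = 0 := by
  let f : LinearMap.range D.toLinearMap →ₗ[ℝ] V :=
    D.toLinearMap.comp (LinearMap.range D.toLinearMap).subtype
  have hf : LinearMap.ker f = ⊥ := by
    rw [LinearMap.ker_eq_bot']
    rintro ⟨_, x, rfl⟩ hx
    exact Subtype.ext (hD x hx)
  obtain ⟨C, hC, hanti⟩ := f.exists_antilipschitzWith hf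
  have hC' : (0 : ℝ) < C := hC
  have hle (y : V) (hy : y ∈ LinearMap.range D.toLinearMap) : ‖y‖ ≤ C * ‖D y‖ := by
    have := hanti.le_mul_dist ⟨y, hy⟩ 0
    simpa [f, dist_zero_right] using this
  refine ⟨(C * ‖D'‖ + 1)⁻¹, fun x hx => ?_⟩
  set ε : ℝ := (C * ‖D'‖ + 1)⁻¹ with hε
  have hpos : 0 < C * ‖D'‖ + 1 := by positivity
  have hε0 : 0 < ε := inv_pos.2 hpos
  have h1 : D (D x) = -(ε • D' (D x)) := by
    have := congrArg D hx
    rw [map_add, map_smul, hcomm, map_zero] at this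
    exact eq_neg_of_add_eq_zero_left this
  have h2 : ‖D x‖ ≤ C * (ε * (‖D'‖ * ‖D x‖)) := by
    refine (hle (D x) ⟨x, rfl⟩).trans ?_
    rw [h1, norm_neg, norm_smul, Real.norm_of_nonneg hε0.le]
    gcongr
    exact D'.le_opNorm _
  have h3 : D x = 0 := by
    by_contra hne
    have hn : 0 < ‖D x‖ := norm_pos_iff.2 hne
    have h4 : C * ‖D'‖ * ε < 1 := by
      rw [hε, ← div_eq_mul_inv, div_lt_one hpos]; linarith
    nlinarith
  refine ⟨h3, ?_⟩
  rw [h3, zero_add] at hx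
  exact (smul_eq_zero.1 hx).resolve_left hε0.ne'

variable {𝔨 : Type*} [NormedAddCommGroup 𝔨] [NormedSpace ℝ 𝔨]
  {K : Type*} [TopologicalSpace K] [ChartedSpace 𝔨 K] [Group K]

variable (𝔨) in
/-- The vectors of the Lie algebra fixed by the adjoint action of a subgroup `T`. -/
def adFixed (T : Subgroup K) : Submodule ℝ 𝔨 where
  carrier := {ξ | ∀ t ∈ T, Ad t ξ = ξ}
  add_mem' {a b} ha hb t ht := by
    rw [← AdL_apply, map_add, AdL_apply, AdL_apply, ha t ht, hb t ht]
  zero_mem' t ht := by rw [← AdL_apply, map_zero]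
  smul_mem' r a ha t ht := by rw [← AdL_apply, map_smul, AdL_apply, ha t ht]

variable [LieGroup 𝓘(ℝ, 𝔨) ∞ K]

theorem IsOneParam.mem_adFixed {T : Subgroup K} (hT : IsMaximalTorus T) {c : ℝ → K} {ξ : 𝔨}
    (hc : IsOneParam c ξ) (hcT : ∀ t, c t ∈ T) : ξ ∈ adFixed 𝔨 T := fun t ht =>
  hc.Ad_eq_of_commute fun s => hT.prop.2.2 t ht _ (hcT s)

variable [T2Space K]

/-- The product of T with the one-parameter subgroup is connected and commutative, and so is its
closure; maximality of T absorbs it. Consequently `adFixed` is the Lie algebra of T. -/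
theorem IsOneParam.mem_maximalTorus {T : Subgroup K} (hT : IsMaximalTorus T) {c : ℝ → K} {ξ : 𝔨}
    (hc : IsOneParam c ξ) (hξ : ξ ∈ adFixed 𝔨 T) (s : ℝ) : c s ∈ T := by
  have : IsTopologicalGroup K := topologicalGroup_of_lieGroup 𝓘(ℝ, 𝔨) ∞
  obtain ⟨-, hTconn, hTcomm⟩ := hT.prop
  have hcT (t : K) (ht : t ∈ T) (s : ℝ) : t * c s = c s * t := hc.commute (hξ t ht) s
  let T' : Subgroup K :=
    { carrier := (fun p : K × ℝ => p.1 * c p.2) '' ((T : Set K) ×ˢ univ)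
      mul_mem' := by
        rintro _ _ ⟨⟨t, r⟩, ⟨ht, -⟩, rfl⟩ ⟨⟨t', r'⟩, ⟨ht', -⟩, rfl⟩
        refine ⟨(t * t', r + r'), ⟨T.mul_mem ht ht', trivial⟩, ?_⟩
        simp only [hc.add]
        rw [mul_assoc, mul_assoc, ← mul_assoc t', hcT t' ht', mul_assoc]
      one_mem' := ⟨(1, 0), ⟨T.one_mem, trivial⟩, by simp [hc.zero]⟩
      inv_mem' := by
        rintro _ ⟨⟨t, r⟩, ⟨ht, -⟩, rfl⟩
        refine ⟨(t⁻¹, -r), ⟨T.inv_mem ht, trivial⟩, ?_⟩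
        simp only [mul_inv_rev]
        rw [hc.neg, ← hc.neg, hcT _ (T.inv_mem ht)] }
  have hT'conn : IsConnected (T' : Set K) :=
    (hTconn.prod isConnected_univ).image _
      (continuous_fst.mul (hc.continuous.comp continuous_snd)).continuousOn
  have hT'comm : ∀ a b : T', a * b = b * a := by
    rintro ⟨_, ⟨t, r⟩, ⟨ht, -⟩, rfl⟩ ⟨_, ⟨t', r'⟩, ⟨ht', -⟩, rfl⟩
    refine Subtype.ext ?_
    change t * c r * (t' * c r') = t' * c r' * (t * c r)
    rw [mul_assoc, ← mul_assoc (c r), ← hcT t' ht', mul_assoc t', ← mul_assoc t,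
      hTcomm t ht t' ht', hc.comm r r', mul_assoc, ← mul_assoc t, hcT t ht, mul_assoc, mul_assoc]
  have htor : IsTorus T'.topologicalClosure := by
    refine ⟨T'.isClosed_topologicalClosure, hT'conn.closure, fun a ha b hb => ?_⟩
    let := T'.commGroupTopologicalClosure hT'comm
    exact congrArg Subtype.val (mul_comm (⟨a, ha⟩ : T'.topologicalClosure) ⟨b, hb⟩)
  have hle : T ≤ T'.topologicalClosure := fun t ht =>
    T'.le_topologicalClosure ⟨(t, 0), ⟨ht, trivial⟩, by simp [hc.zero]⟩
  exact hT.le_of_ge htor hle (T'.le_topologicalClosure ⟨(1, s), ⟨T.one_mem, trivial⟩, by simp⟩)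

variable [FiniteDimensional ℝ 𝔨]

/-- The one-parameter subgroups of ξ and ξ' lie in the commutative group T; differentiate the
commutation of their adjoint actions in each parameter. -/
theorem adL_comm_of_mem {T : Subgroup K} (hT : IsMaximalTorus T) {ξ ξ' : 𝔨}
    (hξ : ξ ∈ adFixed 𝔨 T) (hξ' : ξ' ∈ adFixed 𝔨 T) (η : 𝔨) :
    adL K ξ (adL K ξ' η) = adL K ξ' (adL K ξ η) := by
  obtain ⟨c, hc⟩ := exists_isOneParam K ξ
  obtain ⟨c', hc'⟩ := exists_isOneParam K ξ'
  have h (s t : ℝ) : Ad (c s) (Ad (c' t) η) = Ad (c' t) (Ad (c s) η) := by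
    rw [← Ad_mul, ← Ad_mul, hT.prop.2.2 _ (hc.mem_maximalTorus hT hξ s) _
      (hc'.mem_maximalTorus hT hξ' t)]
  have h1 (s : ℝ) : Ad (c s) (adL K ξ' η) = adL K ξ' (Ad (c s) η) := by
    have ha := (AdL (c s) : 𝔨 →L[ℝ] 𝔨).hasFDerivAt.comp_hasDerivAt 0 (hc'.hasDerivAt_Ad η 0)
    have hb := hc'.hasDerivAt_Ad (Ad (c s) η) 0
    simp only [Function.comp_def, AdL_apply, h, hc'.zero, Ad_one] at ha hb
    exact ha.unique hb
  have ha := hc.hasDerivAt_Ad (adL K ξ' η) 0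
  have hb := (adL K ξ').hasFDerivAt.comp_hasDerivAt 0 (hc.hasDerivAt_Ad η 0)
  simp only [Function.comp_def, h1, hc.zero, Ad_one] at ha hb
  exact ha.unique hb

/-- The Lie algebra of a maximal torus contains a vector whose centralizer is that Lie algebra. -/
theorem exists_generic_mem_adFixed [CompactSpace K] {B : 𝔨 →L[ℝ] 𝔨 →L[ℝ] ℝ}
    (hB : IsInvariantInner K B) {T : Subgroup K} (hT : IsMaximalTorus T) :
    ∃ τ ∈ adFixed 𝔨 T, ∀ η, adL K τ η = 0 → η ∈ adFixed 𝔨 T := by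
  have hne : ((fun τ => Module.finrank ℝ (LinearMap.ker (adL K τ).toLinearMap)) ''
    (adFixed 𝔨 T : Set 𝔨)).Nonempty := ⟨_, 0, zero_mem _, rfl⟩
  -- Choose τ with the smallest centralizer. Its perturbation τ + ε τ' has a centralizer inside
  -- those of both τ and τ', so minimality forces whatever commutes with τ to commute with every τ'.
  -- Skewness of ad gives the required ker D² = ker D.
  obtain ⟨τ, hτ, hmin⟩ := Nat.sInf_mem hne
  refine ⟨τ, hτ, fun η hη => ?_⟩
  have hker (τ' : 𝔨) (hτ' : τ' ∈ adFixed 𝔨 T) : adL K τ' η = 0 := by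
    obtain ⟨ε, hε⟩ := exists_ker_add_smul_le (D := adL K τ) (D' := adL K τ') (fun x hx => by
      by_contra hne
      have h1 := hB.pos _ hne
      rw [hB.adL_skew, hx, map_zero, neg_zero] at h1
      exact lt_irrefl _ h1) (adL_comm_of_mem hT hτ hτ')
    have hle : LinearMap.ker (adL K (τ + ε • τ')).toLinearMap ≤
        LinearMap.ker (adL K τ).toLinearMap := fun x hx => by
      have : adL K (τ + ε • τ') x = 0 := hx
      rw [map_add, map_smul] at this
      exact (hε x this).1
    have heq := Submodule.eq_of_le_of_finrank_le hle (by
      have := Nat.sInf_le (mem_image_of_mem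
        (fun τ => Module.finrank ℝ (LinearMap.ker (adL K τ).toLinearMap))
        (add_mem hτ ((adFixed 𝔨 T).smul_mem ε hτ')))
      rw [← hmin] at this
      exact this)
    have h2 : η ∈ LinearMap.ker (adL K (τ + ε • τ')).toLinearMap := heq ▸ hη
    have : adL K (τ + ε • τ') η = 0 := h2
    rw [map_add, map_smul] at this
    exact (hε η this).2
  -- The stabilizer of η is closed and contains every one-parameter subgroup of T, hence T itself.
  let S : Subgroup K :=
    { carrier := {k | Ad k η = η}
      mul_mem' := fun {a b} ha hb => by
        rw [mem_ofPred_eq] at *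
        rw [Ad_mul, hb, ha]
      one_mem' := Ad_one η
      inv_mem' := fun {a} ha => by
        rw [mem_ofPred_eq] at *
        nth_rw 1 [← ha]
        rw [← Ad_mul, inv_mul_cancel, Ad_one] }
  have hS : IsClosed (S : Set K) := isClosed_eq (continuous_Ad η) continuous_const
  exact le_of_oneParam_mem hT.prop.1 hT.prop.2.1 hS fun c ξ hc hcT t =>
    hc.Ad_eq_of_adL_eq_zero (hker ξ (hc.mem_adFixed hT hcT)) t

/-- A vector satisfying an antisymmetry property on its orbit (as the Lie bracket does) is conjugate
to a vector in the Lie algebra of a given maximal torus. -/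
theorem exists_Ad_mem_adFixed [CompactSpace K] {B : 𝔨 →L[ℝ] 𝔨 →L[ℝ] ℝ}
    (hB : IsInvariantInner K B) {T : Subgroup K} (hT : IsMaximalTorus T) (η : 𝔨)
    (hη : ∀ (k : K) (ξ ζ : 𝔨), B (adL K ξ (Ad k η)) ζ = -B (adL K ζ (Ad k η)) ξ) :
    ∃ k : K, Ad k η ∈ adFixed 𝔨 T := by
  obtain ⟨τ, hτ, hgen⟩ := exists_generic_mem_adFixed hB hT
  -- At a maximum, the derivative B [ζ, Ad k η] τ vanishes for all ζ. The assumed antisymmetry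
  -- exchanges ζ and τ, so [τ, Ad k η] = 0, and τ is generic.
  obtain ⟨k, -, hk⟩ := isCompact_univ.exists_isMaxOn (f := fun k : K => B (Ad k η) τ) univ_nonempty
    ((B.continuous.comp (continuous_Ad η)).clm_apply continuous_const).continuousOn
  refine ⟨k, hgen _ ?_⟩
  have hzero (ζ : 𝔨) : B (adL K τ (Ad k η)) ζ = 0 := by
    obtain ⟨c, hc⟩ := exists_isOneParam K ζ
    have h1 := (B.hasFDerivAt.comp_hasDerivAt 0 (hc.hasDerivAt_Ad (Ad k η) 0)).clm_apply
      (hasDerivAt_const 0 τ)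
    have hmax : IsLocalMax (fun t => (B ∘ fun t => Ad (c t) (Ad k η)) t τ) 0 := by
      refine Eventually.of_forall fun t => ?_
      have := isMaxOn_iff.1 hk (c t * k) trivial
      rw [Ad_mul] at this
      simpa [hc.zero, Ad_one] using this
    have h2 := hmax.hasDerivAt_eq_zero h1
    simp only [hc.zero, Ad_one, map_zero, add_zero] at h2
    rw [hη, h2, neg_zero]
  by_contra hne
  exact (hB.pos _ hne).ne' (hzero _)

end MaximalTorus

/-! ### Long-time existence of integral curves in compact sets -/

section Completeness

variable {E : Type*} [NormedAddCommGroup E] [NormedSpace ℝ E]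
  {M : Type*} [TopologicalSpace M] [ChartedSpace E M] [IsManifold 𝓘(ℝ, E) 1 M]
  {v : (x : M) → TangentSpace 𝓘(ℝ, E) x}


/-- Integral curves of a `C¹` vector field through points near `x₀` exist for a uniform time. -/
theorem exists_uniform_isMIntegralCurveOn_nhds [CompleteSpace E] (x₀ : M)
    (hv : ContMDiffAt 𝓘(ℝ, E) 𝓘(ℝ, E).tangent 1
      (fun x => (⟨x, v x⟩ : TangentBundle 𝓘(ℝ, E) M)) x₀) :
    ∃ U ∈ 𝓝 x₀, ∃ ε > (0 : ℝ), ∀ x ∈ U, ∃ γ : ℝ → M, γ 0 = x ∧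
      IsMIntegralCurveOn γ v (Ioo (-ε) ε) := by
  have hx : 𝓘(ℝ, E).IsInteriorPoint x₀ := BoundarylessManifold.isInteriorPoint
  rw [contMDiffAt_iff] at hv
  obtain ⟨_, hv⟩ := hv
  obtain ⟨ε₀, hε₀, a, r, L, C, hr, hpl⟩ := IsPicardLindelof.of_contDiffAt_one
    (hv.contDiffAt (range_mem_nhds_isInteriorPoint hx)).snd
  obtain ⟨α, hα, hαc⟩ := (hpl 0).exists_forall_mem_closedBall_eq_hasDerivWithinAt_continuousOn
  set e := extChartAt 𝓘(ℝ, E) x₀ with he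
  have hr' : (0 : ℝ) < r := hr
  have hα0 : α (e x₀, 0) = e x₀ := (hα (e x₀) (Metric.mem_closedBall_self hr'.le)).1
  have hnhds : Metric.closedBall (e x₀) r ×ˢ Icc (0 - ε₀) (0 + ε₀) ∈ 𝓝 (e x₀, (0 : ℝ)) :=
    prod_mem_nhds (Metric.closedBall_mem_nhds _ hr') (Icc_mem_nhds (by linarith) (by linarith))
  have hcont : ContinuousAt α (e x₀, 0) := hαc.continuousAt hnhds
  have hint : interior e.target ∈ 𝓝 (α (e x₀, 0)) := by
    rw [hα0]
    exact isOpen_interior.mem_nhds (𝓘(ℝ, E).isInteriorPoint_iff.mp hx)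
  -- The Picard–Lindelöf solution is jointly continuous in initial point and time, so a common time
  -- interval keeps all nearby solutions inside the chart.
  obtain ⟨U, hU, V, hV, hUV⟩ := mem_nhds_prod_iff.1 (inter_mem hnhds (hcont hint))
  obtain ⟨ε, hε, hεV⟩ := Metric.mem_nhds_iff.1 hV
  rw [Real.ball_eq_Ioo, zero_sub, zero_add] at hεV
  refine ⟨e.source ∩ e ⁻¹' U, inter_mem (extChartAt_source_mem_nhds x₀)
    ((continuousAt_extChartAt x₀).preimage_mem_nhds hU), min ε ε₀, lt_min hε hε₀, ?_⟩
  rintro x ⟨hxs, hxU⟩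
  have hxball : e x ∈ Metric.closedBall (e x₀) r :=
    (hUV (⟨hxU, hεV ⟨by linarith, hε⟩⟩ : (e x, (0 : ℝ)) ∈ U ×ˢ V)).1.1
  obtain ⟨hα1, hα2⟩ := hα (e x) hxball
  refine ⟨fun t => e.symm (α (e x, t)), by
    change e.symm (α (e x, 0)) = x
    rw [show α (e x, 0) = e x from hα1]; exact e.left_inv hxs, ?_⟩
  intro t ht
  have ht1 : t ∈ Ioo (-ε) ε :=
    ⟨(neg_le_neg (min_le_left _ _)).trans_lt ht.1, ht.2.trans_le (min_le_left _ _)⟩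
  have ht2 : t ∈ Ioo (0 - ε₀) (0 + ε₀) := by
    rw [zero_sub, zero_add]
    exact ⟨(neg_le_neg (min_le_right _ _)).trans_lt ht.1, ht.2.trans_le (min_le_right _ _)⟩
  have h := (hα2 t (Ioo_subset_Icc_self ht2)).hasDerivAt (Icc_mem_nhds ht2.1 ht2.2)
  set f : ℝ → E := fun t => α (e x, t) with hf
  let xₜ : M := e.symm (f t)
  replace h : HasDerivAt f (x := t) <| fderivWithin ℝ (e ∘ (extChartAt 𝓘(ℝ, E) xₜ).symm)
    (range 𝓘(ℝ, E)) (extChartAt 𝓘(ℝ, E) xₜ xₜ) (v xₜ) := h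
  rw [he, ← tangentCoordChange_def] at h
  have hf3 : f t ∈ interior e.target := (hUV (⟨hxU, hεV ht1⟩ : (e x, t) ∈ U ×ˢ V)).2
  have hf3' := mem_of_mem_of_subset hf3 interior_subset
  have hft1 := mem_preimage.mp <| mem_of_mem_of_subset hf3' e.target_subset_preimage_source
  have hft2 := mem_extChartAt_source (I := 𝓘(ℝ, E)) xₜ
  apply HasMFDerivAt.hasMFDerivWithinAt
  have key (g : ℝ → E) (w : E) (hg : HasDerivAt g w t) :
      HasFDerivWithinAt g ((1 : ℝ →L[ℝ] ℝ).smulRight w) (range 𝓘(ℝ, ℝ)) t :=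
    (hg.hasFDerivAt.congr_fderiv (by ext; simp)).hasFDerivWithinAt
  refine ⟨(continuousAt_extChartAt_symm'' hf3').comp h.continuousAt, key _ _ ?_⟩
  change HasDerivAt ((extChartAt 𝓘(ℝ, E) xₜ ∘ e.symm) ∘ f) (v xₜ) t
  have e2 (w : E) : tangentCoordChange 𝓘(ℝ, E) x₀ xₜ xₜ
      (tangentCoordChange 𝓘(ℝ, E) xₜ x₀ xₜ w) = w := by
    rw [tangentCoordChange_comp ⟨⟨hft2, hft1⟩, hft2⟩, tangentCoordChange_self hft2]
  refine HasDerivAt.congr_deriv ?_ (e2 (v xₜ))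
  apply HasFDerivAt.comp_hasDerivAt _ _ h
  apply HasFDerivWithinAt.hasFDerivAt (s := range 𝓘(ℝ, E)) _ <|
    mem_nhds_iff.mpr ⟨interior e.target,
      subset_trans interior_subset (extChartAt_target_subset_range ..),
      isOpen_interior, hf3⟩
  rw [← e.right_inv hf3']
  exact hasFDerivWithinAt_tangentCoordChange ⟨hft1, hft2⟩

theorem exists_uniform_isMIntegralCurveOn [CompleteSpace E]
    (hv : ContMDiff 𝓘(ℝ, E) 𝓘(ℝ, E).tangent 1 (fun x => (⟨x, v x⟩ : TangentBundle 𝓘(ℝ, E) M)))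
    {C : Set M} (hC : IsCompact C) : ∃ ε > (0 : ℝ), ∀ x ∈ C, ∃ γ : ℝ → M, γ 0 = x ∧
      IsMIntegralCurveOn γ v (Ioo (-ε) ε) := by
  refine hC.induction_on (p := fun C => ∃ ε > (0 : ℝ), ∀ x ∈ C, ∃ γ : ℝ → M, γ 0 = x ∧
      IsMIntegralCurveOn γ v (Ioo (-ε) ε)) ⟨1, one_pos, by simp⟩
    (fun s t hst ⟨ε, hε, h⟩ => ⟨ε, hε, fun x hx => h x (hst hx)⟩) ?_ ?_
  · rintro s t ⟨ε, hε, h⟩ ⟨ε', hε', h'⟩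
    refine ⟨min ε ε', lt_min hε hε', ?_⟩
    rintro x (hx | hx)
    · obtain ⟨γ, h0, hγ⟩ := h x hx
      exact ⟨γ, h0, hγ.mono (Ioo_subset_Ioo (neg_le_neg (min_le_left _ _)) (min_le_left _ _))⟩
    · obtain ⟨γ, h0, hγ⟩ := h' x hx
      exact ⟨γ, h0, hγ.mono (Ioo_subset_Ioo (neg_le_neg (min_le_right _ _)) (min_le_right _ _))⟩
  · intro x _
    obtain ⟨U, hU, h⟩ := exists_uniform_isMIntegralCurveOn_nhds x (hv x)
    exact ⟨U, mem_nhdsWithin_of_mem_nhds hU, h⟩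

/-- An integral curve which stays in a compact set exists for all positive times. -/
theorem exists_isMIntegralCurveOn_Ici [CompleteSpace E] [T2Space M]
    (hv : ContMDiff 𝓘(ℝ, E) 𝓘(ℝ, E).tangent 1 (fun x => (⟨x, v x⟩ : TangentBundle 𝓘(ℝ, E) M)))
    {C : Set M} (hC : IsCompact C) (x : M)
    (h : ∀ (c : ℝ → M) (t : ℝ), 0 ≤ t → c 0 = x → IsMIntegralCurveOn c v (Icc 0 t) →
      ∀ s ∈ Icc 0 t, c s ∈ C) :
    ∃ c : ℝ → M, c 0 = x ∧ ∃ ε > 0, IsMIntegralCurveOn c v (Ioi (-ε)) := by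
  obtain ⟨ε, hε, hloc⟩ := exists_uniform_isMIntegralCurveOn hv (hC.insert x)
  have hstep (n : ℕ) : ∃ γ : ℝ → M, γ 0 = x ∧
      IsMIntegralCurveOn γ v (Ioo (-ε) (ε + n * (ε / 2))) := by
    induction n with
    | zero => simpa using hloc x (mem_insert _ _)
    | succ n ih =>
      obtain ⟨γ, h0, hγ⟩ := ih
      set b := ε + n * (ε / 2) with hb
      have hbε : ε ≤ b := by rw [hb]; have : 0 ≤ n * (ε / 2) := by positivity
                             linarith
      -- The prolongation restarts at b - ε / 2, inside the present interval, so that the two pieces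
      -- overlap; it lives until b + ε / 2.
      set t₁ := b - ε / 2 with ht₁
      have ht₁0 : 0 ≤ t₁ := by linarith
      have hin : γ t₁ ∈ C := h γ t₁ ht₁0 h0
        (hγ.mono fun s hs => ⟨by linarith [hs.1], by linarith [hs.2]⟩) t₁ ⟨ht₁0, le_rfl⟩
      obtain ⟨γ', h0', hγ'⟩ := hloc _ (mem_insert_of_mem _ hin)
      have h1 := hγ'.comp_add (-t₁)
      have h2 : {t | t + -t₁ ∈ Ioo (-ε) ε} = Ioo (t₁ - ε) (t₁ + ε) := by
        ext t
        simp only [mem_ofPred_eq, mem_Ioo]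
        constructor <;> rintro ⟨h3, h4⟩ <;> constructor <;> linarith
      rw [h2] at h1
      have h3 := isMIntegralCurveOn_piecewise hv hγ h1 (t₀ := t₁)
        ⟨⟨by linarith, by linarith⟩, by linarith, by linarith⟩ (by simp [h0'])
      refine ⟨_, ?_, h3.mono ?_⟩
      · rw [piecewise_eq_of_mem _ _ _ (by constructor <;> linarith), h0]
      · rintro s ⟨hs1, hs2⟩
        push_cast at hs2
        by_cases hsb : s < b
        · exact Or.inl ⟨hs1, hsb⟩
        · exact Or.inr ⟨by linarith, by linarith⟩
  have hall (b : ℝ) : ∃ γ : ℝ → M, γ 0 = x ∧ IsMIntegralCurveOn γ v (Ioo (-ε) b) := by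
    obtain ⟨n, hn⟩ := exists_nat_gt (b / (ε / 2))
    obtain ⟨γ, h0, hγ⟩ := hstep n
    rw [div_lt_iff₀ (by positivity)] at hn
    exact ⟨γ, h0, hγ.mono (Ioo_subset_Ioo le_rfl (by linarith))⟩
  choose γ hγ0 hγ using hall
  have huniq (b b' : ℝ) (hb : 0 < b) (hbb' : b ≤ b') : EqOn (γ b) (γ b') (Ioo (-ε) b) :=
    isMIntegralCurveOn_Ioo_eqOn_of_contMDiff_boundaryless (t₀ := 0) ⟨by linarith, hb⟩ hv (hγ b)
      ((hγ b').mono (Ioo_subset_Ioo le_rfl hbb')) (by rw [hγ0, hγ0])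
  -- At time t the solution living up to |t| + 1 is used. For s near t it agrees with the single
  -- solution living up to |t| + 2, since then |s| + 1 < |t| + 2. The interval is kept open to the
  -- left of 0, so that later arguments on open intervals include the starting point.
  refine ⟨fun t => γ (|t| + 1) t, by simp [hγ0], ε, hε, fun t ht => ?_⟩
  have htlt : t < |t| + 2 := by linarith [le_abs_self t]
  have heq : (fun t => γ (|t| + 1) t) =ᶠ[𝓝 t] γ (|t| + 2) := by
    have hn : Ioo (-ε) (|t| + 2) ∩ {s | |s| < |t| + 1} ∈ 𝓝 t :=
      inter_mem (Ioo_mem_nhds ht htlt)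
        ((isOpen_lt continuous_abs continuous_const).mem_nhds (by simp))
    filter_upwards [hn] with s hs
    have h2 : |s| < |t| + 1 := hs.2
    exact huniq (|s| + 1) (|t| + 2) (by positivity) (by linarith) ⟨hs.1.1, by linarith [le_abs_self s]⟩
  have hd := ((hγ (|t| + 2)) t ⟨ht, htlt⟩).hasMFDerivAt (Ioo_mem_nhds ht htlt)
  have hd' := hd.congr_of_eventuallyEq heq
  refine HasMFDerivAt.hasMFDerivWithinAt ?_
  have e : γ (|t| + 1) t = γ (|t| + 2) t := heq.self_of_nhds
  change HasMFDerivAt 𝓘(ℝ, ℝ) 𝓘(ℝ, E) (fun t => γ (|t| + 1) t) t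
    ((1 : ℝ →L[ℝ] ℝ).smulRight (v (γ (|t| + 1) t)))
  rw [e]
  exact hd'

end Completeness

/-! ### Rotated hyperkähler frames and moment maps -/

section Frames

variable {E : Type*} [NormedAddCommGroup E] [NormedSpace ℝ E] [FiniteDimensional ℝ E]
  {M : Type*} [TopologicalSpace M] [ChartedSpace E M] [IsManifold 𝓘(ℝ, E) ∞ M]
  [RiemannianBundle (fun x : M => TangentSpace 𝓘(ℝ, E) x)]

/-- The pointwise properties of a hyperkähler frame: skew-adjoint endomorphisms with the quaternion
relations. -/
structure IsQuaternionicFrame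
    (J : Fin 3 → Π x : M, TangentSpace 𝓘(ℝ, E) x →L[ℝ] TangentSpace 𝓘(ℝ, E) x) : Prop where
  smooth : ContMDiff 𝓘(ℝ, E) (𝓘(ℝ, E).prod 𝓘(ℝ, E →L[ℝ] E)) ∞
    (fun x => TotalSpace.mk' (E →L[ℝ] E)
      (E := fun x : M => TangentSpace 𝓘(ℝ, E) x →L[ℝ] TangentSpace 𝓘(ℝ, E) x) x (J 0 x))
  skew : ∀ l x v w, inner ℝ (J l x v) w = -inner ℝ v (J l x w)
  sq : ∀ x v, J 0 x (J 0 x v) = -v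
  one_zero : ∀ x v, J 1 x (J 0 x v) = -J 2 x v
  two_zero : ∀ x v, J 2 x (J 0 x v) = J 1 x v

theorem rotate_apply {A : Matrix (Fin 3) (Fin 3) ℝ}
    {J : Fin 3 → Π x : M, TangentSpace 𝓘(ℝ, E) x →L[ℝ] TangentSpace 𝓘(ℝ, E) x} (l : Fin 3) (x : M)
    (v : TangentSpace 𝓘(ℝ, E) x) :
    rotate A J l x v = A l 0 • J 0 x v + A l 1 • J 1 x v + A l 2 • J 2 x v := by
  simp [rotate, Fin.sum_univ_three]

/-- Determinant 1 makes the inverse equal to the adjugate. The entries of Aᵀ = adj A say that each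
row is the cross product of the next two in cyclic order, which yields the quaternion relations of
the rotated frame. -/
theorem specialOrthogonal_three_relations {A : Matrix (Fin 3) (Fin 3) ℝ}
    (hA : A ∈ Matrix.specialOrthogonalGroup (Fin 3) ℝ) : A * A.transpose = 1 ∧
    A.transpose = A.adjugate := by
  rw [Matrix.mem_specialOrthogonalGroup_iff, Matrix.mem_orthogonalGroup_iff] at hA
  have h1 : A * A.transpose = 1 := hA.1
  refine ⟨h1, ?_⟩
  calc A.transpose = (A.adjugate * A) * A.transpose := by
        rw [Matrix.adjugate_mul, hA.2, one_smul, one_mul]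
    _ = A.adjugate := by rw [mul_assoc, h1, mul_one]

variable [IsContMDiffRiemannianBundle 𝓘(ℝ, E) ∞ E (fun x : M => TangentSpace 𝓘(ℝ, E) x)]

theorem IsHyperkahler.isQuaternionicFrame_rotate
    {J : Fin 3 → Π x : M, TangentSpace 𝓘(ℝ, E) x →L[ℝ] TangentSpace 𝓘(ℝ, E) x}
    (hJ : IsHyperkahler J) {A : Matrix (Fin 3) (Fin 3) ℝ}
    (hA : A ∈ Matrix.specialOrthogonalGroup (Fin 3) ℝ) : IsQuaternionicFrame (rotate A J) := by
  obtain ⟨hA1, hA2⟩ := specialOrthogonal_three_relations hA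
  have e (i j : Fin 3) := congrFun (congrFun hA1 i) j
  have a (i j : Fin 3) := congrFun (congrFun hA2 i) j
  simp only [Matrix.mul_apply, Fin.sum_univ_three, Matrix.transpose_apply] at e
  simp only [Matrix.adjugate_fin_three, Matrix.transpose_apply] at a
  have e00 := e 0 0
  have e10 := e 1 0
  have e20 := e 2 0
  have a00 := a 0 0
  have a01 := a 0 1
  have a02 := a 0 2
  have a10 := a 1 0
  have a11 := a 1 1
  have a12 := a 1 2
  have a20 := a 2 0
  have a21 := a 2 1
  have a22 := a 2 2
  simp at e00 e10 e20 a00 a01 a02 a10 a11 a12 a20 a21 a22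
  have h02 (x) (v : TangentSpace 𝓘(ℝ, E) x) : J 0 x (J 2 x v) = -J 1 x v := by
    rw [← hJ.ij, hJ.sq]
  have h21 (x) (v : TangentSpace 𝓘(ℝ, E) x) : J 2 x (J 1 x v) = -J 0 x v := by
    rw [← hJ.ij, hJ.sq, map_neg]
  have h20 (x) (v : TangentSpace 𝓘(ℝ, E) x) : J 2 x (J 0 x v) = J 1 x v := by
    have := hJ.ji x (J 0 x v)
    rw [hJ.sq, map_neg] at this
    exact (neg_injective this).symm
  have h12 (x) (v : TangentSpace 𝓘(ℝ, E) x) : J 1 x (J 2 x v) = J 0 x v := by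
    have := hJ.ji x (J 1 x v)
    rw [hJ.ij, h21, neg_neg] at this
    exact this
  have hskew (l x) (v w : TangentSpace 𝓘(ℝ, E) x) :
      inner ℝ (J l x v) w = -inner ℝ v (J l x w) := by
    have := hJ.orthogonal l x v (J l x w)
    rw [hJ.sq, inner_neg_right] at this
    rw [← this, neg_neg]
  refine ⟨?_, ?_, ?_, ?_, ?_⟩
  · have h := ContMDiff.sum_section (s := Finset.univ) (t := fun m x => A 0 m • J m x)
      fun m _ => (hJ.smooth m).const_smul_section (a := A 0 m)
    exact h
  · intro l x v w
    simp only [rotate_apply, inner_add_left, inner_add_right, inner_smul_left, inner_smul_right,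
      hskew]
    simp
    ring
  · intro x v
    simp only [rotate_apply, map_add, map_smul, hJ.sq, hJ.ij, hJ.ji, h02, h20, h12, h21]
    linear_combination (norm := module) (-e00) • v
  · intro x v
    simp only [rotate_apply, map_add, map_smul, hJ.sq, hJ.ij, hJ.ji, h02, h20, h12, h21]
    linear_combination (norm := module) (-e10) • v + a02 • J 0 x v + a12 • J 1 x v + a22 • J 2 x v
  · intro x v
    simp only [rotate_apply, map_add, map_smul, hJ.sq, hJ.ij, hJ.ji, h02, h20, h12, h21]
    linear_combination (norm := module) (-e20) • v + (-a01) • J 0 x v + (-a11) • J 1 x v + (-a21) • J 2 x v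

variable {𝔨 : Type*} [NormedAddCommGroup 𝔨] [NormedSpace ℝ 𝔨]
  {K : Type*} [TopologicalSpace K] [ChartedSpace 𝔨 K] [Group K] [MulAction K M]

theorem isMomentMap_rotate {B : 𝔨 →L[ℝ] 𝔨 →L[ℝ] ℝ}
    {J : Fin 3 → Π x : M, TangentSpace 𝓘(ℝ, E) x →L[ℝ] TangentSpace 𝓘(ℝ, E) x}
    {μ : Fin 3 → M → 𝔨} (hμ : IsMomentMap K B J μ) (A : Matrix (Fin 3) (Fin 3) ℝ) :
    IsMomentMap K B (rotate A J) (rotate A μ) := by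
  have hd (m x) : MDifferentiableAt 𝓘(ℝ, E) 𝓘(ℝ, 𝔨) (μ m) x :=
    (hμ.smooth m).mdifferentiable (by simp) x
  have hfun (l) : rotate A μ l = A l 0 • μ 0 + A l 1 • μ 1 + A l 2 • μ 2 := by
    funext x
    simp [rotate, Fin.sum_univ_three]
  refine ⟨fun l => ?_, fun l k x => ?_, fun l x v ξ => ?_⟩
  · rw [hfun]
    have hs (m) (a : ℝ) : ContMDiff 𝓘(ℝ, E) 𝓘(ℝ, 𝔨) ∞ (a • μ m) :=
      (contMDiff_const (I' := 𝓘(ℝ, ℝ)) (c := a)).smul (hμ.smooth m)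
    exact ((hs 0 _).add (hs 1 _)).add (hs 2 _)
  · simp only [rotate, hμ.equivariant]
    simp only [← AdL_apply, map_sum, map_smul]
  · have h := ((((hd 0 x).hasMFDerivAt.const_smul (A l 0)).add
      ((hd 1 x).hasMFDerivAt.const_smul (A l 1))).add
      ((hd 2 x).hasMFDerivAt.const_smul (A l 2))).mfderiv
    rw [← hfun] at h
    have h2 := congrArg (fun L : E →L[ℝ] 𝔨 => B (L v) ξ) h
    refine h2.trans ?_
    rw [rotate_apply, inner_add_right, inner_add_right, inner_smul_right, inner_smul_right,
      inner_smul_right, ← hμ.deriv, ← hμ.deriv, ← hμ.deriv]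
    have key (L0 L1 L2 : E →L[ℝ] 𝔨) (w : E) (a b c : ℝ) : B ((a • L0 + b • L1 + c • L2) w) ξ =
        a * B (L0 w) ξ + b * B (L1 w) ξ + c * B (L2 w) ξ := by simp
    exact key _ _ _ _ _ _ _

end Frames

/-! ### The gradient flow of -‖μ 0‖² -/

section Descent

variable {E : Type*} [NormedAddCommGroup E] [NormedSpace ℝ E] [FiniteDimensional ℝ E]
  {M : Type*} [TopologicalSpace M] [ChartedSpace E M] [IsManifold 𝓘(ℝ, E) ∞ M]
  [RiemannianBundle (fun x : M => TangentSpace 𝓘(ℝ, E) x)]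
  [IsContMDiffRiemannianBundle 𝓘(ℝ, E) ∞ E (fun x : M => TangentSpace 𝓘(ℝ, E) x)]
  {𝔨 : Type*} [NormedAddCommGroup 𝔨] [NormedSpace ℝ 𝔨]
  {K : Type*} [TopologicalSpace K] [ChartedSpace 𝔨 K] [Group K] [MulAction K M]
  {B : 𝔨 →L[ℝ] 𝔨 →L[ℝ] ℝ}
  {J : Fin 3 → Π x : M, TangentSpace 𝓘(ℝ, E) x →L[ℝ] TangentSpace 𝓘(ℝ, E) x}
  {μ : Fin 3 → M → 𝔨}

theorem IsInvariantInner.ext (hB : IsInvariantInner K B) {ξ η : 𝔨} (h : ∀ ζ, B ξ ζ = B η ζ) :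
    ξ = η := by
  by_contra hne
  have h1 := hB.pos (ξ - η) (sub_ne_zero.2 hne)
  have h2 : B (ξ - η) (ξ - η) = 0 := by
    rw [B.map_sub₂, h, sub_self]
  rw [h2] at h1
  exact lt_irrefl _ h1

theorem IsMomentMap.mdifferentiableAt (hμ : IsMomentMap K B J μ) (l : Fin 3) (x : M) :
    MDifferentiableAt 𝓘(ℝ, E) 𝓘(ℝ, 𝔨) (μ l) x :=
  (hμ.smooth l).mdifferentiable (by simp) x

/-- Together with `IsMomentMap.mfderiv_two_comp` these are the Cauchy–Riemann equations for μ 1 +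
√-1 μ 2 with respect to `J 0`. They come from the products of `J 1` and `J 2` with `J 0`, paired
with the fundamental fields. -/
theorem IsMomentMap.mfderiv_one_comp (hμ : IsMomentMap K B J μ) (hB : IsInvariantInner K B)
    (hJ : IsQuaternionicFrame J) (x : M) (v : TangentSpace 𝓘(ℝ, E) x) :
    (mfderiv 𝓘(ℝ, E) 𝓘(ℝ, 𝔨) (μ 1) x (J 0 x v) : 𝔨) =
      -(mfderiv 𝓘(ℝ, E) 𝓘(ℝ, 𝔨) (μ 2) x v : 𝔨) := by
  refine hB.ext fun ζ => ?_
  refine (hμ.deriv 1 x _ ζ).trans ?_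
  rw [hJ.one_zero, inner_neg_right, ← hμ.deriv]
  have key (a : 𝔨) : -B a ζ = B (-a) ζ := by simp
  exact key _

theorem IsMomentMap.mfderiv_two_comp (hμ : IsMomentMap K B J μ) (hB : IsInvariantInner K B)
    (hJ : IsQuaternionicFrame J) (x : M) (v : TangentSpace 𝓘(ℝ, E) x) :
    (mfderiv 𝓘(ℝ, E) 𝓘(ℝ, 𝔨) (μ 2) x (J 0 x v) : 𝔨) =
      (mfderiv 𝓘(ℝ, E) 𝓘(ℝ, 𝔨) (μ 1) x v : 𝔨) := by
  refine hB.ext fun ζ => ?_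
  refine (hμ.deriv 2 x _ ζ).trans ?_
  rw [hJ.two_zero, ← hμ.deriv]

theorem IsMomentMap.mfderiv_normSq (hμ : IsMomentMap K B J μ) (hB : IsInvariantInner K B) (x : M)
    (v : TangentSpace 𝓘(ℝ, E) x) : (mfderiv 𝓘(ℝ, E) 𝓘(ℝ, ℝ) (normSq B μ) x v : ℝ) =
      2 * inner ℝ (fund K (μ 0 x) x) (J 0 x v) := by
  have h1 : HasFDerivAt (fun η => B η η) ((2 : ℝ) • B (μ 0 x)) (μ 0 x) := by
    refine (B.hasFDerivAt.clm_apply (hasFDerivAt_id (μ 0 x))).congr_fderiv ?_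
    ext ζ
    simp [two_mul, hB.symm ζ]
  have h2 := (h1.hasMFDerivAt.comp x (hμ.mdifferentiableAt 0 x).hasMFDerivAt).mfderiv
  refine (congrArg (fun L : E →L[ℝ] ℝ => L v) h2).trans ?_
  rw [← hμ.deriv]
  have key (L : E →L[ℝ] 𝔨) (w : E) (η : 𝔨) : (((2 : ℝ) • B η).comp L) w = 2 * B (L w) η := by
    simp [hB.symm η]
  exact key _ _ _

/-- The moment map equation with ξ = μ 0 x expresses the differential through `J 0`, and skewness of
`J 0` moves it to the fundamental field. -/
theorem IsMomentMap.neg_grad_normSq (hμ : IsMomentMap K B J μ) (hB : IsInvariantInner K B)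
    (hJ : IsQuaternionicFrame J) (x : M) :
    -grad (E := E) (normSq B μ) x = (2 : ℝ) • J 0 x (fund K (μ 0 x) x) := by
  refine ext_inner_right ℝ fun v => ?_
  rw [inner_neg_left, inner_grad, hμ.mfderiv_normSq hB, inner_smul_left, hJ.skew]
  exact (mul_neg _ _).symm

theorem fund_smul (a : ℝ) (ξ : 𝔨) (x : M) : fund (E := E) K (a • ξ) x = a • fund K ξ x :=
  map_smul (mfderiv 𝓘(ℝ, 𝔨) 𝓘(ℝ, E) (fun k : K => k • x) 1) a ξ

theorem IsMomentMap.mfderiv_normSq_neg_grad (hμ : IsMomentMap K B J μ) (hB : IsInvariantInner K B)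
    (hJ : IsQuaternionicFrame J) (x : M) :
    (mfderiv 𝓘(ℝ, E) 𝓘(ℝ, ℝ) (normSq B μ) x (-grad (E := E) (normSq B μ) x) : ℝ) =
      -(4 * inner ℝ (fund (E := E) K (μ 0 x) x) (fund (E := E) K (μ 0 x) x)) := by
  rw [hμ.mfderiv_normSq hB, hμ.neg_grad_normSq hB hJ, map_smul, hJ.sq, smul_neg, inner_neg_right,
    inner_smul_right]
  have key (a : ℝ) : 2 * -(2 * a) = -(4 * a) := by ring
  exact key _

variable [LieGroup 𝓘(ℝ, 𝔨) ∞ K] [ContMDiffSMul 𝓘(ℝ, 𝔨) 𝓘(ℝ, E) ∞ K M]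

theorem IsMomentMap.contMDiff_neg_grad (hμ : IsMomentMap K B J μ) (hB : IsInvariantInner K B)
    (hJ : IsQuaternionicFrame J) : ContMDiff 𝓘(ℝ, E) 𝓘(ℝ, E).tangent ∞
      (fun x : M => (⟨x, -grad (normSq B μ) x⟩ : TangentBundle 𝓘(ℝ, E) M)) := by
  have : IsManifold 𝓘(ℝ, E) 1 M := .of_le (n := ∞) (by simp)
  have h1 : ContMDiff 𝓘(ℝ, E) 𝓘(ℝ, E).tangent ∞
      (fun x : M => (⟨x, J 0 x (fund K (μ 0 x) x)⟩ : TangentBundle 𝓘(ℝ, E) M)) :=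
    ContMDiff.clm_bundle_apply hJ.smooth (contMDiff_fund K (hμ.smooth 0))
  have h2 := h1.const_smul_section (a := (2 : ℝ))
  simp only [hμ.neg_grad_normSq hB hJ]
  exact h2

theorem IsMomentMap.continuous_inner_fund (hμ : IsMomentMap K B J μ) : Continuous fun x : M =>
    (inner ℝ (fund (E := E) K (μ 0 x) x) (fund (E := E) K (μ 0 x) x) : ℝ) :=
  have h := contMDiff_fund (E := E) K (hμ.smooth 0)
  have h2 : ContMDiff 𝓘(ℝ, E) 𝓘(ℝ, ℝ) ∞ fun x : M =>
      (inner ℝ (fund (E := E) K (μ 0 x) x) (fund (E := E) K (μ 0 x) x) : ℝ) := by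
    apply ContMDiff.inner_bundle (IB := 𝓘(ℝ, E)) (F := E) (b := fun x : M => x)
      (E := fun x : M => TangentSpace 𝓘(ℝ, E) x)
    · exact h
    · exact h
  h2.continuous

variable [CompleteSpace 𝔨] [T2Space K]

/-- The Cauchy–Riemann equations convert the derivative of μ 1 along `J 0` of the fundamental field
into minus that of μ 2 along the orbit, which equivariance computes as a bracket. -/
theorem IsMomentMap.mfderiv_one_neg_grad (hμ : IsMomentMap K B J μ) (hB : IsInvariantInner K B)
    (hJ : IsQuaternionicFrame J) (x : M) :
    (mfderiv 𝓘(ℝ, E) 𝓘(ℝ, 𝔨) (μ 1) x (-grad (E := E) (normSq B μ) x) : 𝔨) =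
      (-2 : ℝ) • adL K (μ 0 x) (μ 2 x) := by
  rw [hμ.neg_grad_normSq hB hJ, ← map_smul, hμ.mfderiv_one_comp hB hJ, ← fund_smul]
  refine (congrArg Neg.neg (mfderiv_equivariant_fund (hμ.smooth 2) (hμ.equivariant 2) _ x)).trans ?_
  rw [map_smul, smul_apply, neg_smul]
  rfl

theorem IsMomentMap.mfderiv_two_neg_grad (hμ : IsMomentMap K B J μ) (hB : IsInvariantInner K B)
    (hJ : IsQuaternionicFrame J) (x : M) :
    (mfderiv 𝓘(ℝ, E) 𝓘(ℝ, 𝔨) (μ 2) x (-grad (E := E) (normSq B μ) x) : 𝔨) =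
      (2 : ℝ) • adL K (μ 0 x) (μ 1 x) := by
  rw [hμ.neg_grad_normSq hB hJ, ← map_smul, hμ.mfderiv_two_comp hB hJ, ← fund_smul]
  refine (mfderiv_equivariant_fund (hμ.smooth 1) (hμ.equivariant 1) _ x).trans ?_
  rw [map_smul, smul_apply]

/-- A descent curve of `‖μ 0‖²` in a compact set has a limit point which is critical. -/
theorem IsMomentMap.exists_mapClusterPt_fund_eq_zero (hμ : IsMomentMap K B J μ)
    (hB : IsInvariantInner K B) (hJ : IsQuaternionicFrame J) {c : ℝ → M} {C : Set M}
    (hC : IsCompact C) (hcC : ∀ t, 0 ≤ t → c t ∈ C)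
    (hc : IsMIntegralCurveOn (I := 𝓘(ℝ, E)) c (fun x => -grad (normSq B μ) x) (Ici 0)) :
    ∃ y, MapClusterPt y atTop c ∧ fund (E := E) K (μ 0 y) y = 0 := by
  set q : M → ℝ := fun x => inner ℝ (fund (E := E) K (μ 0 x) x) (fund (E := E) K (μ 0 x) x) with hq
  have hqc : Continuous q := hμ.continuous_inner_fund
  have hdf (x) : MDifferentiableAt 𝓘(ℝ, E) 𝓘(ℝ, ℝ) (normSq B μ) x := by
    have hBs : ContDiff ℝ 1 fun η => B η η := B.contDiff.clm_apply contDiff_id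
    exact (hBs.contMDiff.mdifferentiable (by simp) _).comp x (hμ.mdifferentiableAt 0 x)
  have hd (t) (ht : t ∈ Ici (0 : ℝ)) :
      HasDerivWithinAt (fun r => normSq B μ (c r)) (-(4 * q (c t))) (Ici 0) t := by
    have e := hμ.mfderiv_normSq_neg_grad hB hJ (c t)
    change _ = -(4 * q (c t)) at e
    rw [← e]
    exact hasDerivWithinAt_comp_curve (hdf _) (hc t ht)
  have hpos (t) : 0 ≤ normSq B μ (c t) := by
    by_cases h : μ 0 (c t) = 0
    · simp [normSq, h]
    · exact (hB.pos _ h).le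
  -- Along the curve ‖μ 0‖² has derivative -4 q. If q stayed at least δ after time n, then ‖μ 0‖² +
  -- δ r would be nonincreasing there, making ‖μ 0‖² negative at time n + L.
  have hsmall (n : ℕ) : ∃ t, (n : ℝ) ≤ t ∧ q (c t) < 1 / (n + 1) := by
    by_contra! hn
    have hδ : (0 : ℝ) < 1 / (n + 1) := by positivity
    set δ : ℝ := 1 / (n + 1)
    obtain ⟨L, hL⟩ : ∃ L, normSq B μ (c n) < δ * L := by
      obtain ⟨L, hL⟩ := exists_gt (normSq B μ (c n) / δ)
      exact ⟨L, by rwa [div_lt_iff₀' hδ] at hL⟩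
    have hL0 : 0 ≤ L := by
      by_contra! h
      nlinarith [hpos n]
    have hmono : AntitoneOn (fun r => normSq B μ (c r) + δ * r) (Ici (n : ℝ)) := by
      have hn0 : (0 : ℝ) ≤ n := n.cast_nonneg
      have hd' (t) (ht : t ∈ Ici (n : ℝ)) : HasDerivWithinAt
          (fun r => normSq B μ (c r) + δ * r) (-(4 * q (c t)) + δ * 1) (Ici (n : ℝ)) t :=
        ((hd t (hn0.trans ht)).mono (Ici_subset_Ici.2 hn0)).add
          ((hasDerivWithinAt_id _ _).const_mul δ)
      refine antitoneOn_of_hasDerivWithinAt_nonpos (convex_Ici _)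
        (fun t ht => (hd' t ht).continuousWithinAt)
        (fun t ht => (hd' t (interior_subset ht)).mono interior_subset) fun t ht => ?_
      have := hn t (interior_subset ht)
      linarith
    have h1 := hmono (self_mem_Ici (a := (n : ℝ))) (show (n : ℝ) + L ∈ Ici (n : ℝ) by simpa using hL0)
      (by linarith)
    have h2 := hpos (n + L)
    simp only at h1
    nlinarith
  choose t htn htq using hsmall
  have htend : Tendsto t atTop atTop := tendsto_atTop_mono htn tendsto_natCast_atTop_atTop
  obtain ⟨y, -, hy⟩ := hC.exists_mapClusterPt (f := atTop) (u := fun n => c (t n))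
    (le_principal_iff.2 (mem_map.2 (Eventually.of_forall fun n : ℕ => hcC _
      ((Nat.cast_nonneg n).trans (htn n)))))
  refine ⟨y, hy.of_comp htend, ?_⟩
  have hq0 : Tendsto (fun n => q (c (t n))) atTop (𝓝 0) := by
    refine squeeze_zero (fun n => real_inner_self_nonneg) (fun n => (htq n).le)
      tendsto_one_div_add_atTop_nhds_zero_nat
  have hqy : MapClusterPt (q y) atTop fun n => q (c (t n)) :=
    hy.continuousAt_comp hqc.continuousAt
  have : q y = 0 := by
    by_contra hne
    exact (hqy.clusterPt.mono hq0).ne (disjoint_iff.1 (disjoint_nhds_nhds.2 hne))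
  exact inner_self_eq_zero.1 this

end Descent

/-! ### Critical points on W for a general frame -/

section Generic

variable {𝔨 : Type*} [NormedAddCommGroup 𝔨] [NormedSpace ℝ 𝔨]
  {K : Type*} [TopologicalSpace K] [ChartedSpace 𝔨 K] [Group K] [LieGroup 𝓘(ℝ, 𝔨) ∞ K]

/-- A point fixed by a nontrivial one-parameter subgroup of `T` lies in a component whose generic
stabilizer contains that one-parameter subgroup. -/
theorem IsOneParam.exists_mem_fixedComponents {M : Type*} [TopologicalSpace M] [MulAction K M]
    {T : Subgroup K} {c : ℝ → K} {ξ : 𝔨} (hc : IsOneParam c ξ) (hξ : ξ ≠ 0) (hcT : ∀ t, c t ∈ T)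
    {x : M} (hcx : ∀ t, c t • x = x) :
    ∃ Z ∈ fixedComponents M T, x ∈ Z ∧ ∀ a : ℝ, a • ξ ∈ genericLieAlg (𝔨 := 𝔨) T Z := by
  set S : Set K := idComponent (stabIn T x) with hS
  have hcS (t : ℝ) : c t ∈ S :=
    (isPreconnected_range hc.continuous).subset_connectedComponentIn ⟨0, hc.zero⟩
      (by rintro _ ⟨s, rfl⟩; exact ⟨hcT s, hcx s⟩) ⟨t, rfl⟩
  have hSx : S ⊆ stabIn T x := connectedComponentIn_subset _ _
  have hxS : x ∈ fixedSet M S := fun k hk => (hSx hk).2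
  have hS1 : S ≠ {1} := by
    intro h
    have h1 (t) : c t = 1 := by simpa [h] using hcS t
    rw [funext h1] at hc
    exact hξ (hc.velocity_unique IsOneParam.const_one)
  refine ⟨connectedComponentIn (fixedSet M S) x, ⟨S, ⟨hS1, x, rfl⟩, x, hxS, rfl⟩,
    mem_connectedComponentIn hxS, fun a => ⟨univ, isOpen_univ, ?_, fun z hz => ?_⟩⟩
  · rw [inter_univ]
    exact subset_closure
  have hzS : z ∈ fixedSet M S := connectedComponentIn_subset _ _ hz.1
  -- S is connected and fixes every point z of Z, so it lies in the identity component of each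
  -- stabilizer. Genericity therefore needs no exceptional set.
  have hsub : S ⊆ idComponent (stabIn T z) :=
    isPreconnected_connectedComponentIn.subset_connectedComponentIn
      (mem_connectedComponentIn (one_mem _)) fun k hk => ⟨(hSx hk).1, hzS k hk⟩
  have hca := hc.comp_mul a
  exact ⟨fun t => c (t * a), hca.add, fun t => hsub (hcS _), hca.deriv⟩

variable {E : Type*} [NormedAddCommGroup E] [NormedSpace ℝ E] [FiniteDimensional ℝ E]
  {M : Type*} [TopologicalSpace M] [ChartedSpace E M] [IsManifold 𝓘(ℝ, E) ∞ M] [T2Space M]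
  [RiemannianBundle (fun x : M => TangentSpace 𝓘(ℝ, E) x)]
  [IsContMDiffRiemannianBundle 𝓘(ℝ, E) ∞ E (fun x : M => TangentSpace 𝓘(ℝ, E) x)]
  [FiniteDimensional ℝ 𝔨] [T2Space K] [CompactSpace K]
  [MulAction K M] [ContMDiffSMul 𝓘(ℝ, 𝔨) 𝓘(ℝ, E) ∞ K M]
  {B : 𝔨 →L[ℝ] 𝔨 →L[ℝ] ℝ}
  {J : Fin 3 → Π x : M, TangentSpace 𝓘(ℝ, E) x →L[ℝ] TangentSpace 𝓘(ℝ, E) x}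

/-- The right side is antisymmetric in ξ and ζ, because `J 0` is skew. This supplies the
antisymmetry needed in `exists_Ad_mem_adFixed` for values of the moment map. -/
theorem IsMomentMap.inner_adL {μ : Fin 3 → M → 𝔨} (hμ : IsMomentMap K B J μ) (ξ ζ : 𝔨) (x : M) :
    B (adL K ξ (μ 0 x)) ζ = inner ℝ (fund (E := E) K ζ x) (J 0 x (fund K ξ x)) := by
  rw [← hμ.deriv]
  exact congrArg (fun a => B a ζ)
    (mfderiv_equivariant_fund (hμ.smooth 0) (hμ.equivariant 0) ξ x).symm

/-- For a general frame, all critical points of `‖μ 0‖²` on `W` are zeros of `μ 0`. -/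
theorem eq_zero_of_isGeneral {μ : Fin 3 → M → 𝔨} {A : Matrix (Fin 3) (Fin 3) ℝ}
    (hμ : IsMomentMap K B J (rotate A μ)) (hJ : IsQuaternionicFrame J)
    (hB : IsInvariantInner K B) {T : Subgroup K} (hT : IsMaximalTorus T) {γ : Set M → 𝔨}
    (hgen : IsGeneral B μ (rotate A μ) T γ) {y : M} (hy : y ∈ W (rotate A μ))
    (hf : fund (E := E) K (rotate A μ 0 y) y = 0) : rotate A μ 0 y = 0 := by
  have : CompleteSpace 𝔨 := FiniteDimensional.complete ℝ 𝔨
  by_contra hne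
  obtain ⟨k, hk⟩ := exists_Ad_mem_adFixed hB hT (rotate A μ 0 y) fun k ξ ζ => by
    rw [← hμ.equivariant, hμ.inner_adL, hμ.inner_adL, real_inner_comm, hJ.skew]
  obtain ⟨c₀, hc₀⟩ := exists_isOneParam K (rotate A μ 0 y)
  have hc := hc₀.conj k
  have hcx (t : ℝ) : (k * c₀ t * k⁻¹) • (k • y) = k • y := by
    rw [mul_smul, mul_smul, inv_smul_smul, hc₀.smul_eq_of_fund_eq_zero hf]
  set ξ := Ad k (rotate A μ 0 y) with hξ
  have hpos : 0 < B ξ ξ := by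
    rw [hξ, hB.invariant]
    exact hB.pos _ hne
  have hξ0 : ξ ≠ 0 := by
    rintro h
    simp [h] at hpos
  obtain ⟨Z, hZ, hxZ, hgenLie⟩ := hc.exists_mem_fixedComponents hξ0 (hc.mem_maximalTorus hT hk) hcx
  -- ρ_Z is a supremum over unit vectors, so ξ is normalized by a = 1 / ‖ξ‖.
  set a : ℝ := (√(B ξ ξ))⁻¹ with ha
  have ha0 : a ≠ 0 := inv_ne_zero (Real.sqrt_pos.2 hpos).ne'
  have hunit : B (a • ξ) (a • ξ) = 1 := by
    rw [map_smul, B.map_smul₂, smul_eq_mul, smul_eq_mul, ha, ← mul_assoc, ← mul_inv,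
      Real.mul_self_sqrt hpos.le, inv_mul_cancel₀ hpos.ne']
  have hpair : pairing B μ (k • y) (a • ξ) ≠ 0 := by
    intro h
    have h1 (m : Fin 3) : B (μ m (k • y)) (a • ξ) = 0 := congrFun (congrArg WithLp.ofLp h) m
    have h2 : B (rotate A μ 0 (k • y)) (a • ξ) = 0 := by
      simp [rotate, Fin.sum_univ_three, h1, -map_smul]
    rw [hμ.equivariant, map_smul, smul_eq_mul] at h2
    exact (mul_ne_zero ha0 hpos.ne') h2
  have hrho : 0 < rho B μ T Z := by
    refine lt_of_lt_of_le ?_ (le_iSup₂_of_le (a • ξ) ⟨hgenLie a, hunit⟩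
      (le_iSup₂_of_le (k • y) hxZ le_rfl))
    exact enorm_pos.2 hpair
  -- Generality fails at k • y, because μ_ℂ (k • y) = Ad k (μ_ℂ y) = 0.
  refine hgen Z hZ hrho (k • y) hxZ ?_
  rw [hμ.equivariant, hμ.equivariant, hy.1, hy.2, ← AdL_apply, map_zero]
  simp

end Generic

/-! ### Linear differential equations and propagation of rank defects -/

section LinearODE

/-- Local existence for linear differential equations with continuous coefficients. -/
theorem exists_eventually_hasDerivAt_clm {D : Type*} [NormedAddCommGroup D] [NormedSpace ℝ D]
    [CompleteSpace D] {G : ℝ → D →L[ℝ] D} {s₀ : ℝ} (hG : ∀ᶠ s in 𝓝 s₀, ContinuousAt G s) (u₀ : D) :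
    ∃ u : ℝ → D, u s₀ = u₀ ∧ ∀ᶠ s in 𝓝 s₀, HasDerivAt u (G s (u s)) s := by
  obtain ⟨p, hp0, hp⟩ : ∃ p > 0, ∀ᶠ s in 𝓝 s₀, ‖G s‖ ≤ p :=
    ⟨‖G s₀‖ + 1, by positivity, (hG.self_of_nhds.norm.eventually_lt_const (lt_add_one _)).mono
      fun s hs => hs.le⟩
  obtain ⟨ε, hε, hεs⟩ := Metric.eventually_nhds_iff.1 (hG.and hp)
  -- On the unit ball around u₀ the right side is at most p (‖u₀‖ + 1); the time δ is short enough
  -- for solutions to stay in that ball.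
  set L := p * (‖u₀‖ + 1) with hL
  have hL0 : 0 < L := by positivity
  set δ := min (ε / 2) (1 / L) with hδ
  have hδ0 : 0 < δ := by positivity
  have hδL : L * δ ≤ 1 := by
    calc L * δ ≤ L * (1 / L) := by gcongr; exact min_le_right _ _
      _ = 1 := by field_simp
  have hmem (t) (ht : t ∈ Icc (s₀ - δ) (s₀ + δ)) : ContinuousAt G t ∧ ‖G t‖ ≤ p := by
    refine hεs (lt_of_le_of_lt ?_ (half_lt_self hε))
    rw [Real.dist_eq, abs_le]
    have : δ ≤ ε / 2 := min_le_left _ _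
    constructor <;> linarith [ht.1, ht.2]
  have hpl : IsPicardLindelof (fun s u => G s u) (tmin := s₀ - δ) (tmax := s₀ + δ)
      ⟨s₀, by linarith, by linarith⟩ u₀ 1 0 L.toNNReal p.toNNReal := by
    refine ⟨fun t ht => ?_, fun x _ t ht => ?_, fun t ht x hx => ?_, ?_⟩
    · refine ((G t).lipschitz.weaken ?_).lipschitzOnWith
      rw [← NNReal.coe_le_coe, Real.coe_toNNReal _ hp0.le]
      exact (hmem t ht).2
    · exact ((hmem t ht).1.clm_apply continuousAt_const).continuousWithinAt
    · rw [Real.coe_toNNReal _ hL0.le]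
      refine ((G t).le_opNorm x).trans (mul_le_mul (hmem t ht).2 ?_ (norm_nonneg _) hp0.le)
      rw [mem_closedBall_iff_norm] at hx
      calc ‖x‖ = ‖u₀ + (x - u₀)‖ := by rw [add_sub_cancel]
        _ ≤ ‖u₀‖ + ‖x - u₀‖ := norm_add_le _ _
        _ ≤ ‖u₀‖ + 1 := by gcongr; exact hx
    · rw [Real.coe_toNNReal _ hL0.le]
      simpa using hδL
  obtain ⟨u, hu0, hu⟩ := hpl.exists_eq_forall_mem_Icc_hasDerivWithinAt₀
  refine ⟨u, hu0, ?_⟩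
  filter_upwards [Icc_mem_nhds (a := s₀ - δ) (b := s₀ + δ) (by linarith) (by linarith),
    Ioo_mem_nhds (a := s₀ - δ) (b := s₀ + δ) (x := s₀) (by linarith) (by linarith)] with t ht ht'
  exact (hu t ht).hasDerivAt (Icc_mem_nhds ht'.1 ht'.2)

variable {E V : Type*} [NormedAddCommGroup E] [NormedSpace ℝ E] [NormedAddCommGroup V]
  [NormedSpace ℝ V] [FiniteDimensional ℝ V]

/-- Non-surjectivity propagates along solutions of `L' = P L - L Q`. -/
theorem eventually_not_surjective_of_hasDerivAt {L : ℝ → E →L[ℝ] V} {P : ℝ → V →L[ℝ] V}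
    {Q : ℝ → E →L[ℝ] E} {s₀ : ℝ} (hP : ∀ᶠ s in 𝓝 s₀, ContinuousAt P s) (hQ : ContinuousAt Q s₀)
    (hL : ∀ᶠ s in 𝓝 s₀, HasDerivAt L ((P s).comp (L s) - (L s).comp (Q s)) s)
    (hs : ¬ Function.Surjective (L s₀)) : ∀ᶠ s in 𝓝 s₀, ¬ Function.Surjective (L s) := by
  obtain ⟨l₀, hl₀, hker⟩ : ∃ l₀ : V →L[ℝ] ℝ, l₀ ≠ 0 ∧ l₀.comp (L s₀) = 0 := by
    have hlt : LinearMap.range (L s₀).toLinearMap < ⊤ := by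
      rw [lt_top_iff_ne_top]
      exact fun h => hs (LinearMap.range_eq_top.1 h)
    obtain ⟨f, hf, hf'⟩ := Submodule.exists_le_ker_of_lt_top _ hlt
    refine ⟨f.toContinuousLinearMap, fun h => hf ?_, ?_⟩
    · ext v
      exact congrArg (fun g : V →L[ℝ] ℝ => g v) h
    · ext v
      exact hf' ⟨v, rfl⟩
  let C : (V →L[ℝ] V) →L[ℝ] (V →L[ℝ] ℝ) →L[ℝ] (V →L[ℝ] ℝ) :=
    (ContinuousLinearMap.compL ℝ V V ℝ).flip
  -- The functional annihilating the range of L s₀ is transported by l' = -l P. Then ν = l L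
  -- satisfies ν' = -ν Q with ν s₀ = 0, so ν = 0, while l stays nonzero near s₀.
  obtain ⟨l, hl0, hl⟩ := exists_eventually_hasDerivAt_clm (G := fun s => C (-P s)) (s₀ := s₀)
    (hP.mono fun s hs => C.continuous.continuousAt.comp hs.neg) l₀
  have hν : ∀ᶠ s in 𝓝 s₀,
      HasDerivAt (fun s => (l s).comp (L s)) (-((l s).comp (L s)).comp (Q s)) s := by
    filter_upwards [hL, hl] with s h1 h2
    have e : C (-P s) (l s) = -(l s).comp (P s) := by
      ext v
      exact map_neg (l s) (P s v)
    rw [e] at h2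
    refine (h2.clm_comp h1).congr_deriv ?_
    ext v
    simp only [ContinuousLinearMap.comp_apply, add_apply, neg_apply, sub_apply, map_sub]
    abel
  obtain ⟨q, hq⟩ : ∃ q : NNReal, ∀ᶠ s in 𝓝 s₀, ‖Q s‖ ≤ q :=
    ⟨‖Q s₀‖₊ + 1, (hQ.norm.eventually_lt_const (lt_add_one _)).mono fun s hs => hs.le⟩
  have hz : (fun s => (l s).comp (L s)) =ᶠ[𝓝 s₀] fun _ => 0 := by
    refine ODE_solution_unique_of_eventually (K := q) (s := fun _ => univ)
      (v := fun s (ν : E →L[ℝ] ℝ) => -ν.comp (Q s)) ?_ (hν.mono fun s hs => ⟨hs, mem_univ _⟩) ?_ ?_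
    · filter_upwards [hq] with s hs
      refine LipschitzOnWith.of_dist_le_mul fun x _ y _ => ?_
      rw [dist_eq_norm, dist_eq_norm, neg_sub_neg, ← ContinuousLinearMap.sub_comp, mul_comm,
        norm_sub_rev x y]
      exact (ContinuousLinearMap.opNorm_comp_le _ _).trans (by gcongr)
    · refine Eventually.of_forall fun s => ⟨?_, mem_univ _⟩
      simpa using hasDerivAt_const s (0 : E →L[ℝ] ℝ)
    · simp [hl0, hker]
  have hlne : ∀ᶠ s in 𝓝 s₀, l s ≠ 0 :=
    hl.self_of_nhds.continuousAt.eventually_ne (by rwa [hl0])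
  filter_upwards [hz, hlne] with s h1 h2 hsurj
  refine h2 (ContinuousLinearMap.ext fun v => ?_)
  obtain ⟨w, rfl⟩ := hsurj v
  exact congrArg (fun g : E →L[ℝ] ℝ => g w) h1

/-- Surjectivity of continuous linear maps onto a finite-dimensional space is an open condition. -/
theorem eventually_surjective {L₀ : E →L[ℝ] V} (h : Function.Surjective L₀) :
    ∀ᶠ L : E →L[ℝ] V in 𝓝 L₀, Function.Surjective L := by
  have : CompleteSpace V := FiniteDimensional.complete ℝ V
  obtain ⟨R, hR⟩ := L₀.toLinearMap.exists_rightInverse_of_surjective (LinearMap.range_eq_top.2 h)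
  have h1 : L₀.comp R.toContinuousLinearMap = 1 := by
    ext v
    exact LinearMap.congr_fun hR v
  have h2 : ContinuousAt (fun L : E →L[ℝ] V => L.comp R.toContinuousLinearMap) L₀ := by fun_prop
  have h3 : {f : V →L[ℝ] V | IsUnit f} ∈ 𝓝 (L₀.comp R.toContinuousLinearMap) := by
    rw [h1]
    exact Units.isOpen.mem_nhds isUnit_one
  filter_upwards [h2 h3] with L hL v
  obtain ⟨u, hu⟩ := hL
  refine ⟨R.toContinuousLinearMap ((↑u⁻¹ : V →L[ℝ] V) v), ?_⟩
  have h4 := congrArg (fun f : V →L[ℝ] V => f v) u.mul_inv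
  rw [hu] at h4
  exact h4

/-- If the derivative of `m` along the vector field `X` is `A m`, with a linear map `A z` for every
point `z`, then non-surjectivity of the differential of `m` propagates along integral curves
of `X` in the zero set of `m`. -/
theorem eventually_not_surjective_fderiv {m : E → V} {X : E → E} {A : E → V →L[ℝ] V} {z₀ : E}
    (hm : ContDiffAt ℝ 2 m z₀) (hX : ContDiffAt ℝ 1 X z₀) (hA : ContDiffAt ℝ 1 A z₀)
    (hid : ∀ᶠ z in 𝓝 z₀, fderiv ℝ m z (X z) = A z (m z)) {c : ℝ → E} {s₀ : ℝ} (hc0 : c s₀ = z₀)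
    (hc : ∀ᶠ s in 𝓝 s₀, HasDerivAt c (X (c s)) s) (hmc : ∀ᶠ s in 𝓝 s₀, m (c s) = 0)
    (hs : ¬ Function.Surjective (fderiv ℝ m (c s₀))) :
    ∀ᶠ s in 𝓝 s₀, ¬ Function.Surjective (fderiv ℝ m (c s)) := by
  subst hc0
  have hcc : ContinuousAt c s₀ := hc.self_of_nhds.continuousAt
  have hP : ∀ᶠ s in 𝓝 s₀, ContinuousAt (fun s => A (c s)) s := by
    filter_upwards [hcc.eventually (hA.eventually (by simp)), hc] with s h1 h2
    exact h1.continuousAt.comp h2.continuousAt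
  have hQ : ContinuousAt (fun s => fderiv ℝ X (c s)) s₀ :=
    ContinuousAt.comp (g := fderiv ℝ X) (hX.fderiv_right (m := 0) (by simp)).continuousAt hcc
  refine eventually_not_surjective_of_hasDerivAt hP hQ ?_ hs
  filter_upwards [hcc.eventually (hm.eventually (by simp)), hcc.eventually (hX.eventually (by simp)),
    hcc.eventually (hA.eventually (by simp)), hcc.eventually hid.eventually_nhds, hc, hmc]
    with s h1 h2 h3 h4 h5 h6
  have hm2 : DifferentiableAt ℝ (fderiv ℝ m) (c s) :=
    (h1.fderiv_right (m := 1) (by norm_num)).differentiableAt (by simp)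
  have hsymm : IsSymmSndFDerivAt ℝ m (c s) := h1.isSymmSndFDerivAt (by simp)
  have hl := hm2.hasFDerivAt.comp_hasDerivAt s h5
  refine hl.congr_deriv (ContinuousLinearMap.ext fun w => ?_)
  -- Differentiating Dm(X) = A m in the direction w, at a zero of m, gives D²m(w, X) + Dm(DX w) = A
  -- Dm w. By symmetry of D²m this is L' = P L - L Q for L = Dm, P = A, Q = DX along c.
  have e1 := hm2.hasFDerivAt.clm_apply (h2.differentiableAt (by simp)).hasFDerivAt
  have e2 := (h3.differentiableAt (by simp)).hasFDerivAt.clm_apply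
    (h1.differentiableAt (by simp)).hasFDerivAt
  have e3 := congrArg (fun g : E →L[ℝ] V => g w)
    (e1.unique (e2.congr_of_eventuallyEq h4))
  simp [h6] at e3
  rw [hsymm.eq, sub_apply]
  exact eq_sub_of_add_eq' e3

end LinearODE

/-! ### Transfer to manifolds through charts -/

section Charts

variable {E : Type*} [NormedAddCommGroup E] [NormedSpace ℝ E]
  {M : Type*} [TopologicalSpace M] [ChartedSpace E M] [IsManifold 𝓘(ℝ, E) ∞ M]
  {V : Type*} [NormedAddCommGroup V] [NormedSpace ℝ V]
  {φ : OpenPartialHomeomorph M E}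

theorem mdifferentiable_of_mem_maximalAtlas (hφ : φ ∈ IsManifold.maximalAtlas 𝓘(ℝ, E) ∞ M) :
    φ.MDifferentiable 𝓘(ℝ, E) 𝓘(ℝ, E) :=
  ⟨(contMDiffOn_of_mem_maximalAtlas hφ).mdifferentiableOn (by simp),
    (contMDiffOn_symm_of_mem_maximalAtlas hφ).mdifferentiableOn (by simp)⟩

theorem contDiffAt_comp_chart_symm (hφ : φ ∈ IsManifold.maximalAtlas 𝓘(ℝ, E) ∞ M) {m : M → V}
    {x : M} (hx : x ∈ φ.source) (hm : ContMDiffAt 𝓘(ℝ, E) 𝓘(ℝ, V) ∞ m x) :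
    ContDiffAt ℝ ∞ (m ∘ φ.symm) (φ x) := by
  rw [← contMDiffAt_iff_contDiffAt]
  have h1 : ContMDiffAt 𝓘(ℝ, E) 𝓘(ℝ, E) ∞ φ.symm (φ x) :=
    (contMDiffOn_symm_of_mem_maximalAtlas hφ).contMDiffAt
      (φ.open_target.mem_nhds (φ.map_source hx))
  refine ContMDiffAt.comp (I' := 𝓘(ℝ, E)) (φ x) ?_ h1
  rwa [φ.left_inv hx]

theorem mfderiv_eq_fderiv_comp_chart (hφ : φ ∈ IsManifold.maximalAtlas 𝓘(ℝ, E) ∞ M) {m : M → V}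
    {x : M} (hx : x ∈ φ.source) (hm : ContMDiffAt 𝓘(ℝ, E) 𝓘(ℝ, V) ∞ m x)
    (v : TangentSpace 𝓘(ℝ, E) x) : (mfderiv 𝓘(ℝ, E) 𝓘(ℝ, V) m x v : V) =
      fderiv ℝ (m ∘ φ.symm) (φ x) (mfderiv 𝓘(ℝ, E) 𝓘(ℝ, E) φ x v : E) := by
  have h1 : HasMFDerivAt 𝓘(ℝ, E) 𝓘(ℝ, V) (m ∘ φ.symm) (φ x) (fderiv ℝ (m ∘ φ.symm) (φ x)) :=
    ((contDiffAt_comp_chart_symm hφ hx hm).differentiableAt (by simp)).hasFDerivAt.hasMFDerivAt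
  have h2 := h1.comp x ((mdifferentiable_of_mem_maximalAtlas hφ).mdifferentiableAt hx).hasMFDerivAt
  have h3 : m =ᶠ[𝓝 x] (m ∘ φ.symm) ∘ φ := by
    filter_upwards [φ.open_source.mem_nhds hx] with y hy
    simp [φ.left_inv hy]
  have h4 := (h2.congr_of_eventuallyEq h3).mfderiv
  exact congrArg (fun L : E →L[ℝ] V => L v) h4

theorem surjective_mfderiv_iff (hφ : φ ∈ IsManifold.maximalAtlas 𝓘(ℝ, E) ∞ M) {m : M → V}
    {x : M} (hx : x ∈ φ.source) (hm : ContMDiffAt 𝓘(ℝ, E) 𝓘(ℝ, V) ∞ m x) :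
    Function.Surjective (mfderiv 𝓘(ℝ, E) 𝓘(ℝ, V) m x) ↔
      Function.Surjective (fderiv ℝ (m ∘ φ.symm) (φ x)) := by
  have e : (mfderiv 𝓘(ℝ, E) 𝓘(ℝ, V) m x : TangentSpace 𝓘(ℝ, E) x → V) =
      fderiv ℝ (m ∘ φ.symm) (φ x) ∘ mfderiv 𝓘(ℝ, E) 𝓘(ℝ, E) φ x :=
    funext fun v => mfderiv_eq_fderiv_comp_chart hφ hx hm v
  change Function.Surjective (mfderiv 𝓘(ℝ, E) 𝓘(ℝ, V) m x : TangentSpace 𝓘(ℝ, E) x → V) ↔ _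
  rw [e]
  exact ((mdifferentiable_of_mem_maximalAtlas hφ).mfderiv_surjective hx).of_comp_iff _

theorem eventually_surjective_mfderiv [FiniteDimensional ℝ V] {m : M → V}
    (hm : ContMDiff 𝓘(ℝ, E) 𝓘(ℝ, V) ∞ m) {x₀ : M}
    (h : Function.Surjective (mfderiv 𝓘(ℝ, E) 𝓘(ℝ, V) m x₀)) :
    ∀ᶠ x in 𝓝 x₀, Function.Surjective (mfderiv 𝓘(ℝ, E) 𝓘(ℝ, V) m x) := by
  have hφ := IsManifold.chart_mem_maximalAtlas (I := 𝓘(ℝ, E)) (n := ∞) x₀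
  have hx₀ := mem_chart_source E x₀
  rw [surjective_mfderiv_iff hφ hx₀ (hm x₀)] at h
  have hc : ContinuousAt (fun x => fderiv ℝ (m ∘ (chartAt E x₀).symm) (chartAt E x₀ x)) x₀ :=
    ContinuousAt.comp (g := fderiv ℝ (m ∘ (chartAt E x₀).symm))
      ((contDiffAt_comp_chart_symm hφ hx₀ (hm x₀)).fderiv_right (m := 0) (by simp)).continuousAt
      ((chartAt E x₀).continuousAt hx₀)
  filter_upwards [hc.eventually (eventually_surjective h), (chartAt E x₀).open_source.mem_nhds hx₀]
    with x h1 h2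
  exact (surjective_mfderiv_iff hφ h2 (hm x)).2 h1

theorem contMDiffAt_mfderiv_chart_apply {X : Π x : M, TangentSpace 𝓘(ℝ, E) x} {x₀ : M}
    (hX : ContMDiffAt 𝓘(ℝ, E) 𝓘(ℝ, E).tangent ∞
      (fun x => (⟨x, X x⟩ : TangentBundle 𝓘(ℝ, E) M)) x₀) :
    ContMDiffAt 𝓘(ℝ, E) 𝓘(ℝ, E) ∞
      (fun x => (mfderiv 𝓘(ℝ, E) 𝓘(ℝ, E) (chartAt E x₀) x (X x) : E)) x₀ := by
  have : IsManifold 𝓘(ℝ, E) 1 M := .of_le (n := ∞) (by simp)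
  refine (contMDiffAt_totalSpace.1 hX).2.congr_of_eventuallyEq ?_
  filter_upwards [(chartAt E x₀).open_source.mem_nhds (mem_chart_source E x₀)] with x hx
  have h1 := TangentBundle.continuousLinearMapAt_trivializationAt (I := 𝓘(ℝ, E)) hx
  have h2 := congrArg (fun L : E →L[ℝ] E => L (X x)) h1
  refine Eq.trans ?_ (h2.symm.trans ?_)
  · rfl
  · exact congrFun (Trivialization.coe_linearMapAt_of_mem (R := ℝ)
      (trivializationAt E (TangentSpace 𝓘(ℝ, E) : M → Type _) x₀) (b := x) hx) (X x)

variable [FiniteDimensional ℝ V]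

theorem eventually_not_surjective_mfderiv {m : M → V} (hm : ContMDiff 𝓘(ℝ, E) 𝓘(ℝ, V) ∞ m)
    {X : Π x : M, TangentSpace 𝓘(ℝ, E) x} (hX : ContMDiff 𝓘(ℝ, E) 𝓘(ℝ, E).tangent ∞
      (fun x => (⟨x, X x⟩ : TangentBundle 𝓘(ℝ, E) M)))
    {A : M → V →L[ℝ] V} (hA : ContMDiff 𝓘(ℝ, E) 𝓘(ℝ, V →L[ℝ] V) ∞ A)
    (hid : ∀ x, (mfderiv 𝓘(ℝ, E) 𝓘(ℝ, V) m x (X x) : V) = A x (m x)) {c : ℝ → M} {s₀ : ℝ}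
    (hc : ∀ᶠ s in 𝓝 s₀, HasMFDerivAt 𝓘(ℝ, ℝ) 𝓘(ℝ, E) c s ((1 : ℝ →L[ℝ] ℝ).smulRight (X (c s))))
    (hmc : ∀ᶠ s in 𝓝 s₀, m (c s) = 0)
    (hs : ¬ Function.Surjective (mfderiv 𝓘(ℝ, E) 𝓘(ℝ, V) m (c s₀))) :
    ∀ᶠ s in 𝓝 s₀, ¬ Function.Surjective (mfderiv 𝓘(ℝ, E) 𝓘(ℝ, V) m (c s)) := by
  set φ := chartAt E (c s₀)
  have hφ := IsManifold.chart_mem_maximalAtlas (I := 𝓘(ℝ, E)) (n := ∞) (c s₀)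
  have hx₀ : c s₀ ∈ φ.source := mem_chart_source E (c s₀)
  have hcs : ∀ᶠ s in 𝓝 s₀, c s ∈ φ.source :=
    hc.self_of_nhds.continuousAt.eventually (φ.open_source.mem_nhds hx₀)
  rw [surjective_mfderiv_iff hφ hx₀ (hm _)] at hs
  have key := eventually_not_surjective_fderiv (m := m ∘ φ.symm)
    (X := (fun x => (mfderiv 𝓘(ℝ, E) 𝓘(ℝ, E) φ x (X x) : E)) ∘ φ.symm) (A := A ∘ φ.symm)
    (z₀ := φ (c s₀)) (c := φ ∘ c) (s₀ := s₀)
    ((contDiffAt_comp_chart_symm hφ hx₀ (hm _)).of_le ENat.LEInfty.out)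
    ((contDiffAt_comp_chart_symm hφ hx₀ (contMDiffAt_mfderiv_chart_apply (hX _))).of_le (by simp))
    ((contDiffAt_comp_chart_symm hφ hx₀ (hA _)).of_le (by simp)) ?_ rfl ?_ ?_ hs
  · filter_upwards [key, hcs] with s h1 h2
    rwa [surjective_mfderiv_iff hφ h2 (hm _)]
  · filter_upwards [φ.open_target.mem_nhds (φ.map_source hx₀)] with z hz
    have h1 := mfderiv_eq_fderiv_comp_chart hφ (φ.map_target hz) (hm _) (X (φ.symm z))
    rw [hid, φ.right_inv hz] at h1
    exact h1.symm
  · filter_upwards [hc, hcs] with s h1 h2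
    have h3 := hasDerivAt_comp_curve
      ((mdifferentiable_of_mem_maximalAtlas hφ).mdifferentiableAt h2) h1
    refine h3.congr_deriv ?_
    simp only [Function.comp]
    rw [φ.left_inv h2]
    rfl
  · filter_upwards [hmc, hcs] with s h1 h2
    simp [φ.left_inv h2, h1]

/-- Surjectivity of the differential of `m` is constant along integral curves in the zero set. -/
theorem surjective_mfderiv_of_isMIntegralCurveOn {m : M → V} (hm : ContMDiff 𝓘(ℝ, E) 𝓘(ℝ, V) ∞ m)
    {X : Π x : M, TangentSpace 𝓘(ℝ, E) x} (hX : ContMDiff 𝓘(ℝ, E) 𝓘(ℝ, E).tangent ∞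
      (fun x => (⟨x, X x⟩ : TangentBundle 𝓘(ℝ, E) M)))
    {A : M → V →L[ℝ] V} (hA : ContMDiff 𝓘(ℝ, E) 𝓘(ℝ, V →L[ℝ] V) ∞ A)
    (hid : ∀ x, (mfderiv 𝓘(ℝ, E) 𝓘(ℝ, V) m x (X x) : V) = A x (m x)) {c : ℝ → M} {s : Set ℝ}
    (hs : IsOpen s) (hs' : IsPreconnected s) (hc : IsMIntegralCurveOn (I := 𝓘(ℝ, E)) c X s)
    (hmc : ∀ t ∈ s, m (c t) = 0) {a b : ℝ} (ha : a ∈ s) (hb : b ∈ s)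
    (h : Function.Surjective (mfderiv 𝓘(ℝ, E) 𝓘(ℝ, V) m (c a))) :
    Function.Surjective (mfderiv 𝓘(ℝ, E) 𝓘(ℝ, V) m (c b)) := by
  have hc' (t) (ht : t ∈ s) : HasMFDerivAt 𝓘(ℝ, ℝ) 𝓘(ℝ, E) c t
      ((1 : ℝ →L[ℝ] ℝ).smulRight (X (c t))) := (hc t ht).hasMFDerivAt (hs.mem_nhds ht)
  have hopen (t) (ht : t ∈ s)
      (hn : ¬ Function.Surjective (mfderiv 𝓘(ℝ, E) 𝓘(ℝ, V) m (c t))) :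
      ∀ᶠ r in 𝓝 t, ¬ Function.Surjective (mfderiv 𝓘(ℝ, E) 𝓘(ℝ, V) m (c r)) :=
    eventually_not_surjective_mfderiv hm hX hA hid
      (Filter.eventually_of_mem (hs.mem_nhds ht) hc')
      (Filter.eventually_of_mem (hs.mem_nhds ht) hmc) hn
  have hopen' (t) (ht : t ∈ s) (hn : Function.Surjective (mfderiv 𝓘(ℝ, E) 𝓘(ℝ, V) m (c t))) :
      ∀ᶠ r in 𝓝 t, Function.Surjective (mfderiv 𝓘(ℝ, E) 𝓘(ℝ, V) m (c r)) :=
    (hc' t ht).continuousAt.eventually (eventually_surjective_mfderiv hm hn)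
  by_contra hn
  -- Surjectivity and its failure are both open conditions along the curve, so connectedness of the
  -- time interval excludes a change.
  obtain ⟨t, -, ht1, ht2⟩ := hs'
    (interior {t | Function.Surjective (mfderiv 𝓘(ℝ, E) 𝓘(ℝ, V) m (c t))})
    (interior {t | ¬ Function.Surjective (mfderiv 𝓘(ℝ, E) 𝓘(ℝ, V) m (c t))})
    isOpen_interior isOpen_interior
    (fun t ht => by
      by_cases h1 : Function.Surjective (mfderiv 𝓘(ℝ, E) 𝓘(ℝ, V) m (c t))
      · exact Or.inl (mem_interior_iff_mem_nhds.2 (hopen' t ht h1))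
      · exact Or.inr (mem_interior_iff_mem_nhds.2 (hopen t ht h1)))
    ⟨a, ha, mem_interior_iff_mem_nhds.2 (hopen' a ha h)⟩
    ⟨b, hb, mem_interior_iff_mem_nhds.2 (hopen b hb hn)⟩
  exact (interior_subset ht2) (interior_subset ht1)

end Charts

/-! ### Straightening submersions and invariance of zero sets -/

section Submersions

variable {E : Type*} [NormedAddCommGroup E] [NormedSpace ℝ E] [FiniteDimensional ℝ E]
  {V : Type*} [NormedAddCommGroup V] [NormedSpace ℝ V] [FiniteDimensional ℝ V]

/-- In suitable smooth coordinates a submersion is linear. -/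
theorem exists_openPartialHomeomorph_of_surjective {m : E → V} {O : Set E} (hO : IsOpen O)
    (hm : ∀ z ∈ O, ContDiffAt ℝ ∞ m z) {z₀ : E} (hz₀ : z₀ ∈ O)
    (h : Function.Surjective (fderiv ℝ m z₀)) :
    ∃ ψ : OpenPartialHomeomorph E E, z₀ ∈ ψ.source ∧ ψ.source ⊆ O ∧ ContDiffOn ℝ ∞ ψ ψ.source ∧
      ContDiffOn ℝ ∞ ψ.symm ψ.target ∧ ∃ L : E →L[ℝ] V, ∀ z ∈ ψ.source, m z = L (ψ z) := by
  have : CompleteSpace E := FiniteDimensional.complete ℝ E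
  set L := fderiv ℝ m z₀
  obtain ⟨R₀, hR₀⟩ := L.toLinearMap.exists_rightInverse_of_surjective (LinearMap.range_eq_top.2 h)
  set R : V →L[ℝ] E := R₀.toContinuousLinearMap
  have hLR (v : V) : L (R v) = v := LinearMap.congr_fun hR₀ v
  -- R is a right inverse of L = Dm(z₀). Then L ∘ Ψ = m, and the differential of Ψ at z₀ is the
  -- identity.
  set Ψ : E → E := fun z => z - R (L z) + R (m z) with hΨ
  have hΨs (z) (hz : z ∈ O) : ContDiffAt ℝ ∞ Ψ z :=
    (contDiffAt_id.sub (R.contDiff.contDiffAt.comp z L.contDiff.contDiffAt)).add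
      (R.contDiff.contDiffAt.comp z (hm z hz))
  have hd : HasFDerivAt Ψ ((ContinuousLinearEquiv.refl ℝ E : E ≃L[ℝ] E) : E →L[ℝ] E) z₀ := by
    have h1 := (hasFDerivAt_id z₀).sub (R.hasFDerivAt.comp z₀ L.hasFDerivAt)
    have h2 := R.hasFDerivAt.comp z₀ ((hm z₀ hz₀).differentiableAt (by simp)).hasFDerivAt
    refine (h1.add h2).congr_fderiv ?_
    ext v
    simp [L]
  have h1 : ∀ᶠ z in 𝓝 z₀, fderiv ℝ Ψ z ∈ range ((↑) : (E ≃L[ℝ] E) → E →L[ℝ] E) := by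
    have hc : ContinuousAt (fderiv ℝ Ψ) z₀ :=
      ((hΨs z₀ hz₀).fderiv_right (m := 0) (by simp)).continuousAt
    refine hc.eventually ?_
    rw [hd.fderiv]
    exact ContinuousLinearEquiv.nhds _
  -- Restricting to points where the differential of Ψ is invertible makes the inverse smooth on the
  -- whole target.
  obtain ⟨O', hO'sub, hO', hz₀'⟩ := mem_nhds_iff.1 (h1.and (hO.mem_nhds hz₀))
  set ψ₀ := (hΨs z₀ hz₀).toOpenPartialHomeomorph Ψ hd (by simp)
  have hψ₀ : z₀ ∈ ψ₀.source :=
    ContDiffAt.mem_toOpenPartialHomeomorph_source (hΨs z₀ hz₀) hd (by simp)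
  have hcoe : (ψ₀.restrOpen O' hO' : E → E) = Ψ := rfl
  have hsrc (z) (hz : z ∈ (ψ₀.restrOpen O' hO').source) : z ∈ O' := by
    rw [OpenPartialHomeomorph.restrOpen_source] at hz
    exact hz.2
  refine ⟨ψ₀.restrOpen O' hO', ?_, fun z hz => (hO'sub (hsrc z hz)).2, ?_, ?_, L, ?_⟩
  · rw [OpenPartialHomeomorph.restrOpen_source]
    exact ⟨hψ₀, hz₀'⟩
  · rw [hcoe]
    exact fun z hz => (hΨs z (hO'sub (hsrc z hz)).2).contDiffWithinAt
  · intro w hw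
    have hz := (ψ₀.restrOpen O' hO').map_target hw
    have hz' := hO'sub (hsrc _ hz)
    obtain ⟨e, he⟩ := hz'.1
    have hs := hΨs _ hz'.2
    refine ((ψ₀.restrOpen O' hO').contDiffAt_symm (f₀' := e) hw ?_ ?_).contDiffWithinAt
    · rw [hcoe, he]
      exact (hs.differentiableAt (by simp)).hasFDerivAt
    · rw [hcoe]
      exact hs
  · intro z _
    rw [hcoe, hΨ]
    simp [hLR]

variable {M : Type*} [TopologicalSpace M] [ChartedSpace E M] [IsManifold 𝓘(ℝ, E) ∞ M]

theorem exists_chart_of_surjective {m : M → V} (hm : ContMDiff 𝓘(ℝ, E) 𝓘(ℝ, V) ∞ m) {x : M}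
    (h : Function.Surjective (mfderiv 𝓘(ℝ, E) 𝓘(ℝ, V) m x)) :
    ∃ φ ∈ IsManifold.maximalAtlas 𝓘(ℝ, E) ∞ M, x ∈ φ.source ∧
      ∃ L : E →L[ℝ] V, (∀ y ∈ φ.source, m y = L (φ y)) ∧
        ∀ y ∈ φ.source, ∀ v : TangentSpace 𝓘(ℝ, E) y,
          (mfderiv 𝓘(ℝ, E) 𝓘(ℝ, V) m y v : V) = L (mfderiv 𝓘(ℝ, E) 𝓘(ℝ, E) φ y v : E) := by
  set χ := chartAt E x
  have hχ := IsManifold.chart_mem_maximalAtlas (I := 𝓘(ℝ, E)) (n := ∞) x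
  have hx : x ∈ χ.source := mem_chart_source E x
  rw [surjective_mfderiv_iff hχ hx (hm _)] at h
  obtain ⟨ψ, hψx, hψO, hψ, hψ', L, hL⟩ := exists_openPartialHomeomorph_of_surjective χ.open_target
    (m := m ∘ χ.symm) (fun z hz => by
      have := contDiffAt_comp_chart_symm hχ (χ.map_target hz) (hm _)
      rwa [χ.right_inv hz] at this) (χ.map_source hx) h
  have hφ : χ.trans ψ ∈ IsManifold.maximalAtlas 𝓘(ℝ, E) ∞ M := by
    refine OpenPartialHomeomorph.mem_maximalAtlas_of_contMDiffOn _ ?_ ?_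
    · exact hψ.contMDiffOn.comp ((contMDiffOn_of_mem_maximalAtlas hχ).mono fun y hy => by
        simp at hy; exact hy.1) fun y hy => by simp at hy; exact hy.2
    · exact (contMDiffOn_symm_of_mem_maximalAtlas hχ).comp (hψ'.contMDiffOn.mono fun y hy => by
        simp at hy; exact hy.1) fun y hy => by simp at hy; exact hy.2
  have hmL (y) (hy : y ∈ (χ.trans ψ).source) : m y = L ((χ.trans ψ) y) := by
    simp at hy
    have := hL _ hy.2
    rwa [Function.comp_apply, χ.left_inv hy.1] at this
  refine ⟨χ.trans ψ, hφ, by simp [hx, hψx], L, hmL, fun y hy v => ?_⟩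
  have h1 : m =ᶠ[𝓝 y] L ∘ χ.trans ψ := by
    filter_upwards [(χ.trans ψ).open_source.mem_nhds hy] with z hz using hmL z hz
  have h2 := (L.hasMFDerivAt (x := (χ.trans ψ) y)).comp y
    ((mdifferentiable_of_mem_maximalAtlas hφ).mdifferentiableAt hy).hasMFDerivAt
  have h3 := (h2.congr_of_eventuallyEq h1).mfderiv
  exact congrArg (fun T : E →L[ℝ] V => T v) h3

/-- The zero set of `m` is invariant under the flow of `X` if the derivative of `m` along `X` is
`A m`, with a linear map `A x` for every point `x`. -/
theorem eq_zero_of_isMIntegralCurveOn {m : M → V} (hm : ContMDiff 𝓘(ℝ, E) 𝓘(ℝ, V) ∞ m)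
    {X : Π x : M, TangentSpace 𝓘(ℝ, E) x} {A : M → V →L[ℝ] V} (hA : Continuous A)
    (hid : ∀ x, (mfderiv 𝓘(ℝ, E) 𝓘(ℝ, V) m x (X x) : V) = A x (m x)) {c : ℝ → M} {s : Set ℝ}
    (hs : IsOpen s) (hs' : IsPreconnected s) (hc : IsMIntegralCurveOn (I := 𝓘(ℝ, E)) c X s)
    {a b : ℝ} (ha : a ∈ s) (hb : b ∈ s) (h : m (c a) = 0) : m (c b) = 0 := by
  have hc' (t) (ht : t ∈ s) : HasMFDerivAt 𝓘(ℝ, ℝ) 𝓘(ℝ, E) c t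
      ((1 : ℝ →L[ℝ] ℝ).smulRight (X (c t))) := (hc t ht).hasMFDerivAt (hs.mem_nhds ht)
  have hd (t) (ht : t ∈ s) : HasDerivAt (fun r => m (c r)) (A (c t) (m (c t))) t := by
    rw [← hid]
    exact hasDerivAt_comp_curve (hm.mdifferentiable (by simp) _) (hc' t ht)
  -- m ∘ c and 0 solve the same linear equation u' = A (c r) u, so a zero at one time spreads to
  -- nearby times.
  have hopen (t) (ht : t ∈ s) (h0 : m (c t) = 0) : (fun r => m (c r)) =ᶠ[𝓝 t] fun _ => 0 := by
    have hq : ∀ᶠ r in 𝓝 t, ‖A (c r)‖ ≤ (‖A (c t)‖₊ + 1 : NNReal) :=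
      (((hA.continuousAt.comp (hc' t ht).continuousAt).norm).eventually_lt_const
        (lt_add_one _)).mono fun r hr => hr.le
    refine ODE_solution_unique_of_eventually (K := ‖A (c t)‖₊ + 1) (s := fun _ => univ)
      (v := fun r u => A (c r) u) (hq.mono fun r hr => ?_)
      (eventually_of_mem (hs.mem_nhds ht) fun r hr => ⟨hd r hr, mem_univ _⟩)
      (Eventually.of_forall fun r => ⟨?_, mem_univ _⟩) h0
    · exact ((A (c r)).lipschitz.weaken hr).lipschitzOnWith
    · simpa using hasDerivAt_const r (0 : V)
  by_contra hn
  obtain ⟨t, -, ht1, ht2⟩ := hs' (interior {t | m (c t) = 0}) (interior {t | m (c t) ≠ 0})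
    isOpen_interior isOpen_interior
    (fun t ht => by
      by_cases h1 : m (c t) = 0
      · exact Or.inl (mem_interior_iff_mem_nhds.2 (hopen t ht h1))
      · exact Or.inr (mem_interior_iff_mem_nhds.2 ((hd t ht).continuousAt.eventually_ne h1)))
    ⟨a, ha, mem_interior_iff_mem_nhds.2 (hopen a ha h)⟩
    ⟨b, hb, mem_interior_iff_mem_nhds.2 ((hd b hb).continuousAt.eventually_ne hn)⟩
  have h1 : t ∈ {t | m (c t) = 0} := interior_subset ht1
  have h2 : t ∈ {t | m (c t) ≠ 0} := interior_subset ht2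
  exact h2 h1

end Submersions

/-! ### Invariance of W, limit points and the complex structure -/

section Regularity

variable {𝔨 : Type*} [NormedAddCommGroup 𝔨] [NormedSpace ℝ 𝔨] [FiniteDimensional ℝ 𝔨]
  {K : Type*} [TopologicalSpace K] [ChartedSpace 𝔨 K] [Group K] [LieGroup 𝓘(ℝ, 𝔨) ∞ K] [T2Space K]
  {E : Type*} [NormedAddCommGroup E] [NormedSpace ℝ E] [FiniteDimensional ℝ E]
  {M : Type*} [TopologicalSpace M] [ChartedSpace E M] [IsManifold 𝓘(ℝ, E) ∞ M] [T2Space M]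
  [RiemannianBundle (fun x : M => TangentSpace 𝓘(ℝ, E) x)]
  [IsContMDiffRiemannianBundle 𝓘(ℝ, E) ∞ E (fun x : M => TangentSpace 𝓘(ℝ, E) x)]
  [MulAction K M] [ContMDiffSMul 𝓘(ℝ, 𝔨) 𝓘(ℝ, E) ∞ K M]
  {B : 𝔨 →L[ℝ] 𝔨 →L[ℝ] ℝ}
  {J : Fin 3 → Π x : M, TangentSpace 𝓘(ℝ, E) x →L[ℝ] TangentSpace 𝓘(ℝ, E) x} {μ : Fin 3 → M → 𝔨}

/-- The complex moment map `μ 1 + √-1 μ 2`. -/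
def muC (μ : Fin 3 → M → 𝔨) (x : M) : 𝔨 × 𝔨 := (μ 1 x, μ 2 x)

theorem mem_W_iff {x : M} : x ∈ W μ ↔ muC μ x = 0 := Prod.mk_eq_zero.symm

theorem IsMomentMap.contMDiff_muC (hμ : IsMomentMap K B J μ) :
    ContMDiff 𝓘(ℝ, E) 𝓘(ℝ, 𝔨 × 𝔨) ∞ (muC μ) :=
  (hμ.smooth 1).prodMk_space (hμ.smooth 2)

theorem IsMomentMap.isClosed_W (hμ : IsMomentMap K B J μ) : IsClosed (W μ) :=
  (isClosed_eq (hμ.smooth 1).continuous continuous_const).inter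
    (isClosed_eq (hμ.smooth 2).continuous continuous_const)

theorem IsMomentMap.mfderiv_muC (hμ : IsMomentMap K B J μ) (x : M) (v : TangentSpace 𝓘(ℝ, E) x) :
    (mfderiv 𝓘(ℝ, E) 𝓘(ℝ, 𝔨 × 𝔨) (muC μ) x v : 𝔨 × 𝔨) =
      ((mfderiv 𝓘(ℝ, E) 𝓘(ℝ, 𝔨) (μ 1) x v : 𝔨), (mfderiv 𝓘(ℝ, E) 𝓘(ℝ, 𝔨) (μ 2) x v : 𝔨)) := by
  have h := hμ.contMDiff_muC.mdifferentiable (by simp) x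
  have h1 := ((ContinuousLinearMap.fst ℝ 𝔨 𝔨).hasMFDerivAt (x := muC μ x)).comp x h.hasMFDerivAt
  have h2 := ((ContinuousLinearMap.snd ℝ 𝔨 𝔨).hasMFDerivAt (x := muC μ x)).comp x h.hasMFDerivAt
  have e1 := congrArg (fun L : E →L[ℝ] 𝔨 => L v) h1.mfderiv
  have e2 := congrArg (fun L : E →L[ℝ] 𝔨 => L v) h2.mfderiv
  exact Prod.ext e1.symm e2.symm

variable (K) in
/-- The endomorphism `(a, b) ↦ (-2 [ξ, b], 2 [ξ, a])`. -/
def adC (ξ : 𝔨) : 𝔨 × 𝔨 →L[ℝ] 𝔨 × 𝔨 :=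
  ((adL K ξ).prodMap (adL K ξ)).comp
    (((-2 : ℝ) • ContinuousLinearMap.snd ℝ 𝔨 𝔨).prod ((2 : ℝ) • ContinuousLinearMap.fst ℝ 𝔨 𝔨))

variable (K) in
theorem adC_apply (ξ a b : 𝔨) :
    adC K ξ (a, b) = ((-2 : ℝ) • adL K ξ b, (2 : ℝ) • adL K ξ a) :=
  Prod.ext ((adL K ξ).map_smul (-2) b) ((adL K ξ).map_smul 2 a)

variable (K) in
theorem contDiff_adC : ContDiff ℝ ∞ (adC K : 𝔨 → 𝔨 × 𝔨 →L[ℝ] 𝔨 × 𝔨) := by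
  have h1 : ContDiff ℝ ∞ fun ξ : 𝔨 => (adL K ξ).prodMap (adL K ξ) :=
    (ContinuousLinearMap.prodMapL ℝ 𝔨 𝔨 𝔨 𝔨).contDiff.comp
      ((adL K).contDiff.prodMk (adL K).contDiff)
  exact h1.clm_comp contDiff_const

theorem IsMomentMap.contMDiff_adC (hμ : IsMomentMap K B J μ) :
    ContMDiff 𝓘(ℝ, E) 𝓘(ℝ, 𝔨 × 𝔨 →L[ℝ] 𝔨 × 𝔨) ∞ (fun x => adC K (μ 0 x)) :=
  ContMDiff.comp (I' := 𝓘(ℝ, 𝔨)) (g := (adC K : 𝔨 → 𝔨 × 𝔨 →L[ℝ] 𝔨 × 𝔨))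
    (contDiff_adC (𝔨 := 𝔨) K).contMDiff (hμ.smooth 0)

theorem IsMomentMap.mfderiv_muC_neg_grad (hμ : IsMomentMap K B J μ) (hB : IsInvariantInner K B)
    (hJ : IsQuaternionicFrame J) (x : M) :
    (mfderiv 𝓘(ℝ, E) 𝓘(ℝ, 𝔨 × 𝔨) (muC μ) x (-grad (E := E) (normSq B μ) x) : 𝔨 × 𝔨) =
      adC K (μ 0 x) (muC μ x) := by
  have : CompleteSpace 𝔨 := FiniteDimensional.complete ℝ 𝔨
  rw [hμ.mfderiv_muC, hμ.mfderiv_one_neg_grad hB hJ, hμ.mfderiv_two_neg_grad hB hJ]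
  exact (adC_apply K (μ 0 x) (μ 1 x) (μ 2 x)).symm

/-- A descent curve starting on `W` and staying in a compact set exists for all times, stays on
`W` and has a critical limit point. -/
theorem IsMomentMap.exists_descentCurve (hμ : IsMomentMap K B J μ) (hB : IsInvariantInner K B)
    (hJ : IsQuaternionicFrame J) {x : M} (hx : x ∈ W μ) {C : Set M} (hC : IsCompact C)
    (hflow : FlowContained (E := E) (normSq B μ) x C) :
    ∃ c : ℝ → M, c 0 = x ∧ ∃ ε > 0,
      IsMIntegralCurveOn (I := 𝓘(ℝ, E)) c (fun x => -grad (normSq B μ) x) (Ioi (-ε)) ∧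
      (∀ t ∈ Ioi (-ε), c t ∈ W μ) ∧
      ∃ y ∈ W μ, MapClusterPt y atTop c ∧ fund (E := E) K (μ 0 y) y = 0 := by
  have : CompleteSpace E := FiniteDimensional.complete ℝ E
  have : IsManifold 𝓘(ℝ, E) 1 M := .of_le (n := ∞) (by simp)
  obtain ⟨c, hc0, ε, hε, hc⟩ := exists_isMIntegralCurveOn_Ici
    ((hμ.contMDiff_neg_grad hB hJ).of_le (by simp)) hC x hflow
  have h0 : (0 : ℝ) ∈ Ioi (-ε) := neg_lt_zero.2 hε
  have hcW (t) (ht : t ∈ Ioi (-ε)) : c t ∈ W μ := by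
    rw [mem_W_iff]
    exact eq_zero_of_isMIntegralCurveOn hμ.contMDiff_muC hμ.contMDiff_adC.continuous
      (hμ.mfderiv_muC_neg_grad hB hJ) isOpen_Ioi isPreconnected_Ioi hc h0 ht
      (by rwa [hc0, ← mem_W_iff])
  have hsub : Ici (0 : ℝ) ⊆ Ioi (-ε) := Ici_subset_Ioi.2 h0
  obtain ⟨y, hy, hfy⟩ := hμ.exists_mapClusterPt_fund_eq_zero hB hJ hC
    (fun t ht => hflow c t ht hc0 (hc.mono (Icc_subset_Ici_self.trans hsub)) t ⟨ht, le_rfl⟩)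
    (hc.mono hsub)
  refine ⟨c, hc0, ε, hε, hc, hcW, y, ?_, hy, hfy⟩
  exact hμ.isClosed_W.mem_of_mapClusterPt hy
    ((eventually_ge_atTop 0).mono fun t ht => hcW t (hsub ht))

theorem IsMomentMap.surjective_muC (hμ : IsMomentMap K B J μ) (hreg : IsRegularZero E μ) {y : M}
    (hy : y ∈ W μ) (hy0 : μ 0 y = 0) :
    Function.Surjective (mfderiv 𝓘(ℝ, E) 𝓘(ℝ, 𝔨 × 𝔨) (muC μ) y) := by
  rintro ⟨a, b⟩
  obtain ⟨v, hv⟩ := hreg y (fun l => by fin_cases l; exacts [hy0, hy.1, hy.2]) ![0, a, b]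
  exact ⟨v, (hμ.mfderiv_muC y v).trans (Prod.ext (congrFun hv 1) (congrFun hv 2))⟩

/-- In a chart straightening μ_ℂ, W is the kernel of a linear map. Its tangent spaces are ker dμ_ℂ,
which the Cauchy–Riemann equations make invariant under `J 0`. -/
theorem IsMomentMap.isComplexSubmanifold (hμ : IsMomentMap K B J μ) (hB : IsInvariantInner K B)
    (hJ : IsQuaternionicFrame J) (hreg : ∀ x ∈ W μ,
      Function.Surjective (mfderiv 𝓘(ℝ, E) 𝓘(ℝ, 𝔨 × 𝔨) (muC μ) x)) :
    IsComplexSubmanifold (J 0) (W μ) := by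
  intro x hx
  obtain ⟨φ, hφ, hxφ, L, hL, hdL⟩ := exists_chart_of_surjective hμ.contMDiff_muC (hreg x hx)
  refine ⟨φ, hφ, hxφ, LinearMap.ker L.toLinearMap, fun y hy => ?_, fun y hy v hv => ?_⟩
  · rw [mem_W_iff, hL y hy]
    rfl
  · have h1 : ((mfderiv 𝓘(ℝ, E) 𝓘(ℝ, 𝔨) (μ 1) y v : 𝔨), (mfderiv 𝓘(ℝ, E) 𝓘(ℝ, 𝔨) (μ 2) y v : 𝔨)) =
        (0 : 𝔨 × 𝔨) := by
      rw [← hμ.mfderiv_muC]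
      exact (hdL y hy.1 v).trans hv
    refine (show L _ = 0 from (hdL y hy.1 (J 0 y v)).symm.trans ?_)
    rw [hμ.mfderiv_muC, hμ.mfderiv_one_comp hB hJ, hμ.mfderiv_two_comp hB hJ]
    have h2 := congrArg Prod.fst h1
    have h3 := congrArg Prod.snd h1
    exact Prod.ext ((congrArg Neg.neg h3).trans neg_zero) h2

end Regularity

end HK

end

/-! ### The proposition: limit points, then transport back to the start -/

theorem mainTheorem7
    {E : Type*} [NormedAddCommGroup E] [NormedSpace ℝ E] [FiniteDimensional ℝ E]
    {M : Type*} [TopologicalSpace M] [ChartedSpace E M] [IsManifold 𝓘(ℝ, E) ∞ M]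
    [T2Space M] [SecondCountableTopology M]
    [RiemannianBundle (fun x : M => TangentSpace 𝓘(ℝ, E) x)]
    [IsContMDiffRiemannianBundle 𝓘(ℝ, E) ∞ E (fun x : M => TangentSpace 𝓘(ℝ, E) x)]
    (J : Fin 3 → Π x : M, TangentSpace 𝓘(ℝ, E) x →L[ℝ] TangentSpace 𝓘(ℝ, E) x)
    (hJ : HK.IsHyperkahler J)
    {𝔨 : Type*} [NormedAddCommGroup 𝔨] [NormedSpace ℝ 𝔨] [FiniteDimensional ℝ 𝔨]
    {K : Type*} [TopologicalSpace K] [ChartedSpace 𝔨 K] [Group K] [LieGroup 𝓘(ℝ, 𝔨) ∞ K]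
    [T2Space K] [CompactSpace K] [ConnectedSpace K]
    [MulAction K M] [ContMDiffSMul 𝓘(ℝ, 𝔨) 𝓘(ℝ, E) ∞ K M]
    (hK : HK.PreservesHyperkahler K J)
    (B : 𝔨 →L[ℝ] 𝔨 →L[ℝ] ℝ) (hB : HK.IsInvariantInner K B)
    (μ : Fin 3 → M → 𝔨) (hμ : HK.IsMomentMap K B J μ)
    (T : Subgroup K) (hT : HK.IsMaximalTorus T)
    (γ : Set M → 𝔨) (hγ : HK.IsGammaChoice B μ T γ)
    (A : Matrix (Fin 3) (Fin 3) ℝ) (hA : A ∈ Matrix.specialOrthogonalGroup (Fin 3) ℝ)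
    (hgen : HK.IsGeneral B μ (HK.rotate A μ) T γ)
    (hflow : ∀ x ∈ HK.W (HK.rotate A μ), ∃ C : Set M, IsCompact C ∧
      HK.FlowContained (E := E) (HK.normSq B (HK.rotate A μ)) x C) :
    HK.W (HK.rotate A μ) = HK.Wss E B (HK.rotate A μ) ∧
    (HK.IsRegularZero E (HK.rotate A μ) →
      HK.IsRegularZeroC E (HK.rotate A μ) ∧
      HK.IsComplexSubmanifold (HK.rotate A J 0) (HK.W (HK.rotate A μ))) := by
  have hμ' := HK.isMomentMap_rotate hμ A
  have hJ' := hJ.isQuaternionicFrame_rotate hA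
  have hpt (x) (hx : x ∈ HK.W (HK.rotate A μ)) : ∃ c : ℝ → M, c 0 = x ∧ ∃ ε > 0,
      IsMIntegralCurveOn (I := 𝓘(ℝ, E)) c
        (fun x => -HK.grad (HK.normSq B (HK.rotate A μ)) x) (Ioi (-ε)) ∧
      (∀ t ∈ Ioi (-ε), c t ∈ HK.W (HK.rotate A μ)) ∧
      ∃ y ∈ HK.W (HK.rotate A μ), MapClusterPt y atTop c ∧ HK.rotate A μ 0 y = 0 := by
    obtain ⟨C, hC, hflowC⟩ := hflow x hx
    obtain ⟨c, hc0, ε, hε, hc, hcW, y, hyW, hy, hf⟩ :=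
      hμ'.exists_descentCurve hB hJ' hx hC hflowC
    exact ⟨c, hc0, ε, hε, hc, hcW, y, hyW, hy,
      HK.eq_zero_of_isGeneral hμ' hJ' hB hT hgen hyW hf⟩
  refine ⟨Subset.antisymm (fun x hx => ⟨hx, ?_⟩) fun x hx => hx.1, fun hreg => ?_⟩
  · obtain ⟨c, hc0, ε, hε, hc, -, y, -, hy, hy0⟩ := hpt x hx
    exact ⟨c, hc0, hc.mono (Ici_subset_Ioi.2 (neg_lt_zero.2 hε)), y, hy0, hy⟩
  have hsurj (x) (hx : x ∈ HK.W (HK.rotate A μ)) : Function.Surjective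
      (mfderiv 𝓘(ℝ, E) 𝓘(ℝ, 𝔨 × 𝔨) (HK.muC (HK.rotate A μ)) x) := by
    obtain ⟨c, hc0, ε, hε, hc, hcW, y, hyW, hy, hy0⟩ := hpt x hx
    -- Surjectivity at the limit point y is an open condition, and the curve comes back near y at
    -- arbitrarily late times.
    obtain ⟨t, ht, ht0⟩ := ((hy.frequently (HK.eventually_surjective_mfderiv hμ'.contMDiff_muC
      (hμ'.surjective_muC hreg hyW hy0))).and_eventually (eventually_ge_atTop 0)).exists
    have h0 : (0 : ℝ) ∈ Ioi (-ε) := neg_lt_zero.2 hε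
    rw [← hc0]
    exact HK.surjective_mfderiv_of_isMIntegralCurveOn hμ'.contMDiff_muC
      (hμ'.contMDiff_neg_grad hB hJ') hμ'.contMDiff_adC (hμ'.mfderiv_muC_neg_grad hB hJ')
      isOpen_Ioi isPreconnected_Ioi hc (fun s hs => HK.mem_W_iff.1 (hcW s hs))
      (lt_of_lt_of_le h0 ht0) h0 ht
  refine ⟨fun x hx p => ?_, hμ'.isComplexSubmanifold hB hJ' hsurj⟩
  obtain ⟨v, hv⟩ := hsurj x hx p
  exact ⟨v, (hμ'.mfderiv_muC x v).symm.trans hv⟩
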